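/- **Setting.** Let $\ell\ge 1$ and $n\ge 0$ be integers, $\zeta\in\mathbb C$ a primitive $\ell$-th root of unity and $t$ an indeterminate. $\mathscr P(\ell,n)$ is the set of $\ell$-multipartitions $\boldsymbol\lambda=(\lambda^{(0)},\dots,\lambda^{(\ell-1)})$ of $n$, and $\mathbf 1=((n),\emptyset,\dots,\emptyset)$. For a partition $\lambda$ let $H_\lambda(t)=\prod_{s\in\lambda}(1-t^{h(s)})$ be its hook polynomial ($h(s)$ the hook length of the box $s$), $b(\lambda)=\sum_i(i-1)\lambda_i$, and $s_\lambda$ its Schur function. *The group and its characters.* $W=C_\ell\wr\mathfrak S_n$ consists of pairs $w=(a,\sigma)$ with $a\in(\mathbb Z/\ell)^n$, $\sigma\in\mathfrak S_n$. The element $w$ has cycle type $\boldsymbol\rho\in\mathscr P(\ell,n)$ if $\rho^{(j)}$ lists the lengths of the cycles of $\sigma$ along which the $a_i$ add up to $j$ modulo $\ell$. Let $\chi^{\boldsymbol\lambda}$ be the character of the irreducible $W$-module $V_{\boldsymbol\lambda}$ obtained by inducing $\bigotimes_j\big(S^{\lambda^{(j)}}\otimes\gamma^{j}\big)$ from $\prod_j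 C_\ell\wr\mathfrak S_{|\lambda^{(j)}|}$, where $S^{\lambda}$ is the Specht module ($S^{(n)}$ trivial) and $\gamma^j(a)=\zeta^{j\sum_i a_i}$; $\chi^{\boldsymbol\lambda}_{\boldsymbol\rho}$ is its value at elements of cycle type $\boldsymbol\rho$. $W$ acts on $\mathfrak h=\mathbb C^n$ by monomial matrices so that $w\cdot x_i=\zeta^{a_{\sigma(i)}}x_{\sigma(i)}$ on coordinate functions. *The fake degree* is $f_{\boldsymbol\mu}(t)=\sum_{d\ge0}[(\mathbb C[\mathfrak h]_W)_d:V_{\boldsymbol\mu}]\,t^d$, where $\mathbb C[\mathfrak h]_W$ is the graded algebra of coinvariants, the quotient of $\mathbb C[\mathfrak h]$ by the ideal generated by the $W$-invariants without constant term; only finitely many of these multiplicities are nonzero. *The $t,t$-Kostka–Macdonald coefficients.* For a partition $\lambda$ let $P_\lambda(x;q,t)$ be the Macdonald symmetric function, $J_\lambda(x;q,t)=\prod_{s\in\lambda}(1-q^{a(s)}t^{l(s)+1})P_\lambda(x;q,t)$ its integral form ($a(s)$ and $l(s)$ the numbers of boxes to the right of $s$ and below $s$), $H_\lambda(x;q,t)=t^{b(\lambda)}J_\lambda(x;q,t^{-1})\big[\tfrac{X}{1-t^{-1}}\big]$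 and $G_\lambda(x;t,t)=t^{b(\lambda)}H_\lambda(x;t,t^{-1})$. Let $X^{(0)},\dots,X^{(\ell-1)}$ be alphabets, and for $0\le p<\ell$ put $Z^{(p)}=\sum_{i=0}^{\ell-1}t^{\overline{i-p}}X^{(i)}$, where $\overline{i-p}\in\{0,\dots,\ell-1\}$ is the residue of $i-p$ modulo $\ell$. In plethysms, $p_r[t]=t^r$ and $p_r$ fixes complex constants. The coefficients $K_{\boldsymbol\mu\boldsymbol\lambda}(t,t)\in\mathbb C(t)$ are the unique ones with $$\prod_{j=0}^{\ell-1}G_{\lambda^{(j)}}(x;t^\ell,t^\ell)\big[Z^{(j)}\big]=\sum_{\boldsymbol\mu\in\mathscr P(\ell,n)}K_{\boldsymbol\mu\boldsymbol\lambda}(t,t)\prod_{j=0}^{\ell-1}s_{\mu^{(j)}}\big[X^{(j)}\big]\qquad(\boldsymbol\lambda\in\mathscr P(\ell,n)).$$ **Proposition.** These coefficients exist and are unique, and: (i) for all $\boldsymbol\lambda,\boldsymbol\rho\in\mathscr P(\ell,n)$, $$\sum_{\boldsymbol\mu\in\mathscr P(\ell,n)}K_{\boldsymbol\mu\boldsymbol\lambda}(t,t)\,\chi^{\boldsymbol\mu}_{\boldsymbol\rho}=\prod_{j=0}^{\ell-1}\Big(H_{\lambda^{(j)}}(t^\ell)\prod_i\big(1-\zeta^jt^{\rho^{(j)}_i}\big)^{-1}\Big)\chi^{\boldsymbol\lambda}_{\boldsymbol\rho};$$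 (ii) for all $\boldsymbol\mu\in\mathscr P(\ell,n)$, $K_{\boldsymbol\mu\mathbf 1}(t,t)=f_{\boldsymbol\mu}(t)$. -/

import Mathlib

open scoped BigOperators

noncomputable section

namespace WreathKM

/-! ## Partitions and Young diagrams -/

/-- The rows `lam_1 ≥ lam_2 ≥ ... > 0` of a partition, as a list. -/
def rows {n : ℕ} (lam : n.Partition) : List ℕ := lam.parts.sort (· ≥ ·)

/-- The length of the row with index `i` (indices start at `0`; zero beyond the last row). -/
def row {n : ℕ} (lam : n.Partition) (i : ℕ) : ℕ := (rows lam).getD i 0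

/-- The length of the column with index `j` (indices start at `0`). -/
def col {n : ℕ} (lam : n.Partition) (j : ℕ) : ℕ := (lam.parts.filter (fun r => j < r)).card

/-- The boxes of the Young diagram: `⟨i, j⟩` is the box in row `i` and column `j`. -/
abbrev Cell {n : ℕ} (lam : n.Partition) : Type :=
  Σ i : Fin (rows lam).length, Fin ((rows lam).get i)

/-- The number of boxes to the right of the box `s`. -/
def arm {n : ℕ} {lam : n.Partition} (s : Cell lam) : ℕ := row lam s.1 - s.2 - 1

/-- The number of boxes below the box `s`. -/
def leg {n : ℕ} {lam : n.Partition} (s : Cell lam) : ℕ := col lam s.2 - s.1 - 1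

/-- The hook length of the box `s`. -/
def hookLength {n : ℕ} {lam : n.Partition} (s : Cell lam) : ℕ := 1 + arm s + leg s

/-- `b(lam) = ∑ (i - 1) lam_i` (with rows numbered from `1`). -/
def bInv {n : ℕ} (lam : n.Partition) : ℕ := ∑ i : Fin (rows lam).length, (i : ℕ) * (rows lam).get i

/-- The dominance order `lam ⊴ mu`. -/
def Dominated {n : ℕ} (lam mu : n.Partition) : Prop :=
  ∀ k : ℕ, ((rows lam).take k).sum ≤ ((rows mu).take k).sum

/-- `z_mu = ∏ i ^ (a_i) * a_i !`, where `i` occurs `a_i` times in `mu`. -/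
def zNum {n : ℕ} (mu : n.Partition) : ℕ :=
  ∏ i ∈ mu.parts.toFinset, i ^ mu.parts.count i * (mu.parts.count i).factorial

/-- The hook polynomial `H_lam` evaluated at `u`: the product of `1 - u ^ h` over all hook
lengths `h` of `lam`. -/
def hookPoly {K : Type*} [CommRing K] {n : ℕ} (lam : n.Partition) (u : K) : K :=
  ∏ s : Cell lam, (1 - u ^ hookLength s)

/-- The `l`-multipartitions of `n`: a vector of sizes with sum `n` and a partition of each size. -/
abbrev MultiPartition (l n : ℕ) : Type :=
  Σ α : {α : Fin l → ℕ // α ∈ Finset.piAntidiag (Finset.univ : Finset (Fin l)) n},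
    ∀ j : Fin l, Nat.Partition (α.1 j)

/-- The multipartition `((n), ∅, ..., ∅)`. -/
def trivialMP (l n : ℕ) [NeZero l] : MultiPartition l n :=
  ⟨⟨Pi.single 0 n, by simp [Finset.mem_piAntidiag]⟩, fun _ => Nat.Partition.indiscrete _⟩

/-! ## Multisymmetric functions over `ℂ(t)` and plethysm -/

/-- The field `ℂ(t)`. -/
abbrev Kt : Type := RatFunc ℂ

/-- The indeterminate `t`. -/
abbrev tt : Kt := RatFunc.X

/-- `l`-multisymmetric functions `Λ ⊗ ... ⊗ Λ` (`l` factors) with coefficients in `ℂ(t)`, as the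
polynomial ring in the power sums `p_r[X^(j)]`, for `0 ≤ j < l` and `r ≥ 1`.  The ring of
symmetric functions is the case `l = 1`. -/
abbrev MultiSym (l : ℕ) : Type := MvPolynomial (Fin l × ℕ+) Kt

/-- Symmetric functions with coefficients in `ℂ(t)`. -/
abbrev Sym1 : Type := MultiSym 1

/-- The power sum `p_r[X^(j)]`, for `r ≥ 1`. -/
def pow {l : ℕ} (j : Fin l) (r : ℕ) : MultiSym l := MvPolynomial.X (j, r.toPNat')

/-- The alphabet `X^(j)`, that is `p_1[X^(j)]`. -/
def alphabet {l : ℕ} (j : Fin l) : MultiSym l := pow j 1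

lemma expand_mem_nonZeroDivisors (r : ℕ+) :
    nonZeroDivisors (Polynomial ℂ) ≤
      (nonZeroDivisors (Polynomial ℂ)).comap (Polynomial.expand ℂ (r : ℕ)) := by
  intro f hf
  rw [Submonoid.mem_comap]
  rw [mem_nonZeroDivisors_iff_ne_zero] at hf ⊢
  exact (Polynomial.expand_ne_zero r.pos).2 hf

/-- The substitution `t ↦ t ^ r` on `ℂ(t)`. -/
def scalarAdams (r : ℕ+) : Kt →+* Kt :=
  RatFunc.mapRingHom (Polynomial.expand ℂ (r : ℕ)) (expand_mem_nonZeroDivisors r)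

/-- `g ↦ p_r[g]`: the `ℂ`-algebra endomorphism with `t ↦ t ^ r` and
`p_s[X^(j)] ↦ p_{rs}[X^(j)]`. -/
def adams {l : ℕ} (r : ℕ+) : MultiSym l →+* MultiSym l :=
  MvPolynomial.eval₂Hom (MvPolynomial.C.comp (scalarAdams r))
    (fun x => MvPolynomial.X (x.1, r * x.2))

/-- The plethysm `f[g]`: for fixed `g` it is an algebra homomorphism in `f` (which fixes the
coefficients of `f`) that sends `p_r` to `p_r[g]`. -/
def plethysm {l : ℕ} (f : Sym1) (g : MultiSym l) : MultiSym l :=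
  MvPolynomial.aeval (fun x : Fin 1 × ℕ+ => adams x.2 g) f

/-- The complete homogeneous symmetric function `h_k = ∑ z_mu⁻¹ p_mu` over the partitions `mu`
of `k`. -/
def complete (k : ℕ) : Sym1 :=
  ∑ mu : k.Partition, MvPolynomial.C ((zNum mu : Kt)⁻¹) * (mu.parts.map (pow 0)).prod

/-- `h_m` for an integer index `m`, with `h_m = 0` for `m < 0`. -/
def completeInt (m : ℤ) : Sym1 := if 0 ≤ m then complete m.toNat else 0

/-- The Schur function `s_lam = det (h_{lam_i - i + j})`. -/
def schur {n : ℕ} (lam : n.Partition) : Sym1 :=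
  Matrix.det (Matrix.of fun i j : Fin (rows lam).length =>
    completeInt (((rows lam).get i : ℤ) - (i : ℤ) + (j : ℤ)))

/-- The multi-Schur function: the product of the `s_{lam^(j)}[X^(j)]`. -/
def multiSchur {l n : ℕ} (lam : MultiPartition l n) : MultiSym l :=
  ∏ j : Fin l, plethysm (schur (lam.2 j)) (alphabet j)

/-! ## Macdonald symmetric functions

The parameters `q`, `t` of the Macdonald functions are elements of `ℂ(t)`; they are used
only at powers of the indeterminate. -/

/-- The exponent of the monomial `p_lam` in the power sums. -/
def powExponent {n : ℕ} (lam : n.Partition) : (Fin 1 × ℕ+) →₀ ℕ :=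
  Multiset.toFinsupp (lam.parts.map fun r => ((0 : Fin 1), r.toPNat'))

/-- The scalar product on symmetric functions of degree `n` with
`⟨p_lam, p_mu⟩ = δ z_lam ∏ (1 - q ^ lam_i) / (1 - t ^ lam_i)`. -/
def macInner (n : ℕ) (q t : Kt) (f g : Sym1) : Kt :=
  ∑ lam : n.Partition, f.coeff (powExponent lam) * g.coeff (powExponent lam) *
    ((zNum lam : Kt) * (lam.parts.map fun r => (1 - q ^ r) / (1 - t ^ r)).prod)

/-- Evaluation in `N` variables: `p_r ↦ x_1 ^ r + ... + x_N ^ r`. -/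
def evalVars (N : ℕ) : Sym1 →ₐ[Kt] MvPolynomial (Fin N) Kt :=
  MvPolynomial.aeval fun x => MvPolynomial.psum (Fin N) Kt (x.2 : ℕ)

/-- `P` is the family `P_lam(x; q, t)`, `lam` a partition of `n`, of Macdonald symmetric
functions: homogeneous of degree `n`, equal to the monomial symmetric function `m_lam` plus a
combination of the `m_mu` with `mu` strictly below `lam` in dominance order, and pairwise
orthogonal.  (In degree `n` a symmetric function is determined by its value in `n` variables.) -/
structure IsMacdonaldFamily (n : ℕ) (q t : Kt) (P : n.Partition → Sym1) : Prop where
  homogeneous : ∀ lam,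
    (P lam).IsWeightedHomogeneous (fun x : Fin 1 × ℕ+ => (x.2 : ℕ)) n
  triangular : ∀ lam, ∃ u : n.Partition → Kt,
    (∀ mu, u mu ≠ 0 → Dominated mu lam ∧ mu ≠ lam) ∧
    evalVars n (P lam) = MvPolynomial.msymm (Fin n) Kt lam +
      ∑ mu : n.Partition, u mu • MvPolynomial.msymm (Fin n) Kt mu
  orthogonal : ∀ lam mu, lam ≠ mu → macInner n q t (P lam) (P mu) = 0

open Classical in
/-- The Macdonald symmetric function `P_lam(x; q, t)`. -/
def macdonaldP {n : ℕ} (q t : Kt) (lam : n.Partition) : Sym1 :=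
  if h : ∃ P : n.Partition → Sym1, IsMacdonaldFamily n q t P then h.choose lam else 0

/-- The integral form `J_lam(x; q, t) = ∏ (1 - q ^ a(s) t ^ (l(s) + 1)) P_lam(x; q, t)`. -/
def macdonaldJ {n : ℕ} (q t : Kt) (lam : n.Partition) : Sym1 :=
  (∏ s : Cell lam, (1 - q ^ arm s * t ^ (leg s + 1))) • macdonaldP q t lam

/-- The transformed function
`H_lam(x; q, t) = t ^ b(lam) J_lam(x; q, t⁻¹)[X / (1 - t⁻¹)]`, where `t` is a (positive or
negative) power of the indeterminate. -/
def macdonaldH {n : ℕ} (q t : Kt) (lam : n.Partition) : Sym1 :=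
  t ^ bInv lam • plethysm (macdonaldJ q t⁻¹ lam) ((1 - t⁻¹)⁻¹ • alphabet (0 : Fin 1))

/-- `G_lam(x; u, u) = u ^ b(lam) H_lam(x; u, u⁻¹)`. -/
def typeAG {n : ℕ} (u : Kt) (lam : n.Partition) : Sym1 :=
  u ^ bInv lam • macdonaldH u u⁻¹ lam

/-! ## The wreath `t,t`-Kostka--Macdonald coefficients -/

/-- `Z^(p) = ∑ t ^ (i - p mod l) X^(i)`; the difference in `Fin l` is taken modulo `l`. -/
def zAlphabet {l : ℕ} (p : Fin l) : MultiSym l :=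
  ∑ i : Fin l, (tt ^ ((i - p : Fin l) : ℕ)) • alphabet i

/-- `G_lam(x; t, t)`: the product of the `G_{lam^(j)}(x; t ^ l, t ^ l)[Z^(j)]`. -/
def multiG {l n : ℕ} (lam : MultiPartition l n) : MultiSym l :=
  ∏ j : Fin l, plethysm (typeAG (tt ^ l) (lam.2 j)) (zAlphabet j)

/-- `K mu lam` are the `t,t`-Kostka--Macdonald coefficients: the coefficients in the expansion
of `G_lam(x; t, t)` in multi-Schur functions. -/
def IsKostkaMacdonald {l n : ℕ} (K : MultiPartition l n → MultiPartition l n → Kt) : Prop :=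
  ∀ lam, multiG lam = ∑ mu : MultiPartition l n, K mu lam • multiSchur mu

/-! ## The wreath product and its irreducible representations -/

/-- The wreath product `C_l ≀ S_n`, as the semidirect product of `C_l ^ n` with the symmetric
group, where `(σ • a) i = a (σ⁻¹ i)`. -/
abbrev Wreath (l n : ℕ) : Type :=
  (Fin n → Multiplicative (ZMod l)) ⋊[mulAutArrow] Equiv.Perm (Fin n)

/-- The colour `a_i ∈ ℤ/l` of `w = (a, σ)` at `i`. -/
def colour {l n : ℕ} (w : Wreath l n) (i : Fin n) : ZMod l := (w.left i).toAdd

/-- The element with trivial colours given by a permutation. -/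
def permElt {l n : ℕ} (σ : Equiv.Perm (Fin n)) : Wreath l n := SemidirectProduct.inr σ

/-- The element of the base group `C_l ^ n` with the given colours. -/
def baseElt {l n : ℕ} (a : Fin n → ZMod l) : Wreath l n :=
  SemidirectProduct.inl fun i => Multiplicative.ofAdd (a i)

open Classical in
/-- The multiset of the lengths of those cycles of the permutation part of `w` (fixed points
included) whose colours sum to `j`. -/
def cycleParts {l n : ℕ} (w : Wreath l n) (j : ZMod l) : Multiset ℕ :=
  ((Finset.univ : Finset (Quotient (Equiv.Perm.SameCycle.setoid w.right))).filter
    fun o => ∑ i : Fin n with Quotient.mk (Equiv.Perm.SameCycle.setoid w.right) i = o,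
      colour w i = j).val.map
    fun o => Finset.card {i : Fin n | Quotient.mk (Equiv.Perm.SameCycle.setoid w.right) i = o}

/-- `w` lies in the conjugacy class with cycle type `rho`. -/
def HasCycleType {l n : ℕ} (w : Wreath l n) (rho : MultiPartition l n) : Prop :=
  ∀ j : Fin l, (rho.2 j).parts = cycleParts w ((j : ℕ) : ZMod l)

/-- The boxes of the Young diagram of a multipartition: `⟨j, i, c⟩` is the box in row `i` and
column `c` of the component `j`. -/
abbrev MultiCell {l n : ℕ} (lam : MultiPartition l n) : Type := Σ j : Fin l, Cell (lam.2 j)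

lemma card_cell {n : ℕ} (lam : n.Partition) : Fintype.card (Cell lam) = n := by
  simp only [Fintype.card_sigma, Fintype.card_fin]
  have h1 : ∑ i : Fin (rows lam).length, (rows lam).get i = (rows lam).sum := by
    rw [← List.sum_ofFn, List.ofFn_get]
  rw [h1]
  have h2 : ((rows lam : List ℕ) : Multiset ℕ) = lam.parts := Multiset.sort_eq _ _
  rw [← Multiset.sum_coe, h2, lam.parts_sum]

lemma card_multiCell {l n : ℕ} (lam : MultiPartition l n) :
    Fintype.card (MultiCell lam) = n := by
  rw [Fintype.card_sigma]
  simp only [card_cell]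
  exact (Finset.mem_piAntidiag.1 lam.1.2).1

/-- A filling of the boxes of `lam` with the `n` letters, each used once. -/
def tableau {l n : ℕ} (lam : MultiPartition l n) : MultiCell lam ≃ Fin n :=
  Fintype.equivFinOfCardEq (card_multiCell lam)

/-- The component in which a letter stands. -/
def compOf {l n : ℕ} (lam : MultiPartition l n) (k : Fin n) : ℕ := ((tableau lam).symm k).1

/-- The row (in its component) in which a letter stands. -/
def rowOf {l n : ℕ} (lam : MultiPartition l n) (k : Fin n) : ℕ := ((tableau lam).symm k).2.1

/-- The column (in its component) in which a letter stands. -/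
def colOf {l n : ℕ} (lam : MultiPartition l n) (k : Fin n) : ℕ := ((tableau lam).symm k).2.2

/-- The permutations that preserve every row of every component. -/
def rowPerms {l n : ℕ} (lam : MultiPartition l n) : Finset (Equiv.Perm (Fin n)) :=
  {σ | ∀ k, compOf lam (σ k) = compOf lam k ∧ rowOf lam (σ k) = rowOf lam k}

/-- The permutations that preserve every column of every component. -/
def colPerms {l n : ℕ} (lam : MultiPartition l n) : Finset (Equiv.Perm (Fin n)) :=
  {σ | ∀ k, compOf lam (σ k) = compOf lam k ∧ colOf lam (σ k) = colOf lam k}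

/-- The Young symmetrizer of `lam`: the product of the Young symmetrizers of the components. -/
def youngSymmetrizer {l n : ℕ} (lam : MultiPartition l n) : MonoidAlgebra ℂ (Wreath l n) :=
  (∑ σ ∈ rowPerms lam, MonoidAlgebra.of ℂ (Wreath l n) (permElt σ)) *
    ∑ τ ∈ colPerms lam, ((Equiv.Perm.sign τ : ℤ) : ℂ) •
      MonoidAlgebra.of ℂ (Wreath l n) (permElt τ)

/-- The sum `∑ γ(a)⁻¹ a` over `a ∈ C_l ^ n` for the character `γ` of `C_l ^ n` under which the
generator of the `k`-th factor acts by `ζ ^ j`, where `j` is the component of the letter `k`. -/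
def colourSymmetrizer {l n : ℕ} [NeZero l] (ζ : ℂ) (lam : MultiPartition l n) :
    MonoidAlgebra ℂ (Wreath l n) :=
  ∑ a : Fin n → ZMod l, (∏ k : Fin n, (ζ ^ (compOf lam k * (a k).val))⁻¹) •
    MonoidAlgebra.of ℂ (Wreath l n) (baseElt a)

/-- The irreducible `C_l ≀ S_n`-module attached to `lam`, as a left ideal of the group algebra.
The two symmetrizers lie in the group algebra of the subgroup `∏ C_l ≀ S_{n_j}`,
`n_j = |lam^(j)|`, that preserves the components.  There they generate the outer tensor product
of the modules `S^{lam^(j)} ⊗ γ_j`, with `S^{lam^(j)}` the Specht module of `S_{n_j}` and `γ_j`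
the character of `C_l ^ {n_j}` whose value on the generator of each factor is `ζ ^ j`.  So this
left ideal is the module induced from that tensor product. -/
def irrModule {l n : ℕ} [NeZero l] (ζ : ℂ) (lam : MultiPartition l n) :
    Ideal (MonoidAlgebra ℂ (Wreath l n)) :=
  Ideal.span {colourSymmetrizer ζ lam * youngSymmetrizer lam}

/-- The irreducible representation attached to `lam`. -/
def irrRep {l n : ℕ} [NeZero l] (ζ : ℂ) (lam : MultiPartition l n) :
    Representation ℂ (Wreath l n) (irrModule ζ lam) :=
  (Algebra.lsmul ℂ ℂ (irrModule ζ lam)).toMonoidHom.comp (MonoidAlgebra.of ℂ (Wreath l n))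

/-- The irreducible character `χ^lam`. -/
def irrChar {l n : ℕ} [NeZero l] (ζ : ℂ) (lam : MultiPartition l n) (w : Wreath l n) : ℂ :=
  (irrRep ζ lam).character w

/-! ## The reflection representation, coinvariants and fake degrees -/

lemma colour_mul {l n : ℕ} (w v : Wreath l n) (i : Fin n) :
    colour (w * v) i = colour w i + colour v (w.right⁻¹ i) := rfl

lemma colour_one {l n : ℕ} (i : Fin n) : colour (1 : Wreath l n) i = 0 := rfl

lemma perm_inv_apply {n : ℕ} (σ : Equiv.Perm (Fin n)) (i : Fin n) : σ⁻¹ (σ i) = i :=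
  σ.symm_apply_apply i

section Coinvariants

variable {l n : ℕ} [NeZero l] {ζ : ℂ}

lemma zeta_pow_val_add (hζ : IsPrimitiveRoot ζ l) (a b : ZMod l) :
    ζ ^ (a + b).val = ζ ^ a.val * ζ ^ b.val := by
  rw [ZMod.val_add, ← pow_add]
  conv_rhs => rw [← Nat.mod_add_div (a.val + b.val) l, pow_add, pow_mul, hζ.pow_eq_one, one_pow,
    mul_one]

/-- The action of `C_l ≀ S_n` on `h = ℂ^n` by monomial matrices: `w = (a, σ)` sends the basis
vector `e_i` to `ζ ^ (-a_{σ i}) e_{σ i}`; on the coordinate functions it is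
`x_i ↦ ζ ^ a_{σ i} x_{σ i}`. -/
def reflRep (hζ : IsPrimitiveRoot ζ l) : Representation ℂ (Wreath l n) (Fin n → ℂ) where
  toFun w :=
    { toFun := fun v i => (ζ ^ (colour w i).val)⁻¹ * v (w.right⁻¹ i)
      map_add' := fun u v => by funext i; simp [mul_add]
      map_smul' := fun c v => by funext i; simp [mul_left_comm] }
  map_one' := by
    refine LinearMap.ext fun v => funext fun i => ?_
    simp [colour_one]
  map_mul' w v := by
    refine LinearMap.ext fun u => funext fun i => ?_
    simp only [LinearMap.coe_mk, AddHom.coe_mk, colour_mul, zeta_pow_val_add hζ,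
      Module.End.mul_apply, SemidirectProduct.mul_right, mul_inv_rev, Equiv.Perm.mul_apply]
    ring

/-- The algebra endomorphism `x_i ↦ ζ ^ a_{σ i} x_{σ i}` of `ℂ[h]`, for `w = (a, σ)`. -/
def polyHom {l n : ℕ} (ζ : ℂ) (w : Wreath l n) :
    MvPolynomial (Fin n) ℂ →ₐ[ℂ] MvPolynomial (Fin n) ℂ :=
  MvPolynomial.aeval fun i : Fin n =>
    MvPolynomial.C (ζ ^ (colour w (w.right i)).val) * MvPolynomial.X (w.right i)

lemma polyHom_X {l n : ℕ} (ζ : ℂ) (w : Wreath l n) (i : Fin n) :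
    polyHom ζ w (MvPolynomial.X i) =
      MvPolynomial.C (ζ ^ (colour w (w.right i)).val) * MvPolynomial.X (w.right i) := by
  rw [polyHom, MvPolynomial.aeval_X]

lemma polyHom_C {l n : ℕ} (ζ : ℂ) (w : Wreath l n) (c : ℂ) :
    polyHom ζ w (MvPolynomial.C c) = MvPolynomial.C c := by
  rw [polyHom, MvPolynomial.aeval_C, MvPolynomial.algebraMap_eq]

/-- The induced action on the polynomial functions `ℂ[h]`, by algebra automorphisms. -/
def polyRep (hζ : IsPrimitiveRoot ζ l) :
    Representation ℂ (Wreath l n) (MvPolynomial (Fin n) ℂ) where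
  toFun w := (polyHom ζ w).toLinearMap
  map_one' := by
    have : polyHom ζ (1 : Wreath l n) = AlgHom.id ℂ _ := by
      apply MvPolynomial.algHom_ext
      intro i
      rw [polyHom_X, colour_one, ZMod.val_zero, pow_zero, MvPolynomial.C_1, one_mul]
      rfl
    rw [this]
    rfl
  map_mul' w v := by
    have : polyHom ζ (w * v) = (polyHom ζ w).comp (polyHom ζ v) := by
      apply MvPolynomial.algHom_ext
      intro i
      rw [AlgHom.comp_apply, polyHom_X, polyHom_X, map_mul, polyHom_C, polyHom_X, colour_mul,
        zeta_pow_val_add hζ, SemidirectProduct.mul_right, Equiv.Perm.mul_apply,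
        perm_inv_apply, MvPolynomial.C_mul]
      ring
    rw [this]
    rfl

lemma polyRep_apply (hζ : IsPrimitiveRoot ζ l) (w : Wreath l n) (f : MvPolynomial (Fin n) ℂ) :
    polyRep hζ w f = polyHom ζ w f := rfl

lemma reflRep_apply (hζ : IsPrimitiveRoot ζ l) (w : Wreath l n) (v : Fin n → ℂ) (i : Fin n) :
    reflRep hζ w v i = (ζ ^ (colour w i).val)⁻¹ * v (w.right⁻¹ i) := rfl

/-- The action on `ℂ[h]` is the one by transport: `(w f)(w v) = f(v)`. -/
lemma eval_polyRep (hζ : IsPrimitiveRoot ζ l) (w : Wreath l n) (f : MvPolynomial (Fin n) ℂ)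
    (v : Fin n → ℂ) :
    MvPolynomial.eval (reflRep hζ w v) (polyRep hζ w f) = MvPolynomial.eval v f := by
  have hne : ζ ≠ 0 := hζ.ne_zero (NeZero.ne l)
  induction f using MvPolynomial.induction_on with
  | C a => rw [polyRep_apply, polyHom_C, MvPolynomial.eval_C, MvPolynomial.eval_C]
  | add p q hp hq => simp only [map_add, hp, hq]
  | mul_X p i hp =>
    rw [polyRep_apply] at hp ⊢
    rw [map_mul, map_mul, hp, polyHom_X, map_mul, map_mul, MvPolynomial.eval_C,
      MvPolynomial.eval_X, MvPolynomial.eval_X, reflRep_apply, perm_inv_apply,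
      mul_inv_cancel_left₀ (pow_ne_zero _ hne)]

lemma polyRep_mul (hζ : IsPrimitiveRoot ζ l) (w : Wreath l n) (f g : MvPolynomial (Fin n) ℂ) :
    polyRep hζ w (f * g) = polyRep hζ w f * polyRep hζ w g := by
  rw [polyRep_apply, polyRep_apply, polyRep_apply, map_mul]

/-- The ideal of `ℂ[h]` generated by the invariants without constant term. -/
def invIdeal (hζ : IsPrimitiveRoot ζ l) : Ideal (MvPolynomial (Fin n) ℂ) :=
  Ideal.span {f | (∀ w : Wreath l n, polyRep hζ w f = f) ∧ MvPolynomial.constantCoeff f = 0}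

lemma invIdeal_stable (hζ : IsPrimitiveRoot ζ l) (w : Wreath l n) :
    (invIdeal hζ).restrictScalars ℂ ≤
      ((invIdeal (n := n) hζ).restrictScalars ℂ).comap (polyRep hζ w) := by
  intro f hf
  rw [Submodule.restrictScalars_mem] at hf
  rw [Submodule.mem_comap, Submodule.restrictScalars_mem]
  unfold invIdeal at hf
  induction hf using Submodule.span_induction with
  | mem x hx => rw [hx.1 w]; exact Ideal.subset_span hx
  | zero => rw [map_zero]; exact Ideal.zero_mem _
  | add x y _ _ hx hy => rw [map_add]; exact Ideal.add_mem _ hx hy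
  | smul a x _ hx => rw [smul_eq_mul, polyRep_mul]; exact Ideal.mul_mem_left _ _ hx

/-- The representation on the coinvariants `ℂ[h]_W`. -/
def coinvRep (hζ : IsPrimitiveRoot ζ l) : Representation ℂ (Wreath l n)
    (MvPolynomial (Fin n) ℂ ⧸ (invIdeal (n := n) hζ).restrictScalars ℂ) :=
  (polyRep hζ).quotient _ (invIdeal_stable hζ)

lemma polyRep_homogeneous (hζ : IsPrimitiveRoot ζ l) (w : Wreath l n) (d : ℕ)
    (f : MvPolynomial (Fin n) ℂ) (hf : f ∈ MvPolynomial.homogeneousSubmodule (Fin n) ℂ d) :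
    polyRep hζ w f ∈ MvPolynomial.homogeneousSubmodule (Fin n) ℂ d := by
  have := MvPolynomial.IsHomogeneous.aeval (n := 1) hf
    (fun i : Fin n => MvPolynomial.C (ζ ^ (colour w (w.right i)).val) *
      (MvPolynomial.X (w.right i) : MvPolynomial (Fin n) ℂ))
    (fun i => MvPolynomial.isHomogeneous_C_mul_X _ _)
  rw [one_mul] at this
  exact this

/-- The degree `d` part of the coinvariants. -/
def coinvPiece (hζ : IsPrimitiveRoot ζ l) (d : ℕ) :
    Subrepresentation (coinvRep (n := n) hζ) where
  toSubmodule := (MvPolynomial.homogeneousSubmodule (Fin n) ℂ d).map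
    ((invIdeal (n := n) hζ).restrictScalars ℂ).mkQ
  apply_mem_toSubmodule := by
    rintro w _ ⟨f, hf, rfl⟩
    exact ⟨polyRep hζ w f, polyRep_homogeneous hζ w d f hf, rfl⟩

/-- The multiplicity of the irreducible module of `mu` in the degree `d` part of the
coinvariants, as the dimension of the space of equivariant linear maps. -/
def coinvMult (hζ : IsPrimitiveRoot ζ l) (mu : MultiPartition l n) (d : ℕ) : ℕ :=
  Module.finrank ℂ ((irrRep ζ mu).IntertwiningMap (coinvPiece (n := n) hζ d).toRepresentation)

/-- The fake degree `f_mu(t) = ∑ [ℂ[h]_W in degree d : mu] t ^ d`. -/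
def fakeDegree (hζ : IsPrimitiveRoot ζ l) (mu : MultiPartition l n) : Kt :=
  ∑ᶠ d : ℕ, (coinvMult hζ mu d : Kt) * tt ^ d

end Coinvariants

end WreathKM

end

set_option linter.unusedSectionVars false

noncomputable section

namespace WreathKM

/-! ## The Hall form on a polynomial ring in power sums -/

section HallForm

open MvPolynomial

variable {σ : Type*} {k : Type*} [Field k]

/-! Multisymmetric functions with the Hall form `hallForm` carry the characters of W through the
Frobenius map. An element w is sent to `cyclePow ζ w`, the product over its cycles, of length r and
colour s, of the linear forms ∑_j ζ^{js} p_r[X^(j)]; pairing it with `multiSchur lam` gives χ^lam(w)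
(`hallForm_cyclePow_multiSchur`). The multi-Schur functions are orthonormal and span, so the
Kostka–Macdonald coefficients are Hall pairings (`isKostkaMacdonald_iff`), which gives existence and
uniqueness.

At equal parameters the Macdonald functions are Schur functions and the factor in J is the hook
polynomial. Hence `multiG lam` is a product of hook polynomials times the image of `multiSchur lam`
under the substitution X^(p) ↦ Z^(p)/(1 - t^l) (`multiG_eq`). The linear form of a cycle is an
eigenvector of the adjoint of this substitution: the sum ∑_i ζ^{is} t^{r(i-p mod l)} is ζ^{ps} times
a geometric sum with value (1 - t^{lr})/(1 - ζ^s t^r). So pairing with `cyclePow ζ w` only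
multiplies by ∏ (1 - ζ^s t^r)⁻¹ (`hallForm_cyclePow_zSub`), and (i) is the defining expansion paired
with `cyclePow ζ w`.

For (ii), `multiSchur mu` is itself ∑_w e(w) `cyclePow ζ w`, where e is the idempotent generating
V_mu. The same eigenvalues give K_{mu,1} = ∏_{k=1}^n (1 - t^{lk}) · ∑_w e(w) ∏ (1 - ζ^s t^r)⁻¹,
where the sum is the Hilbert series of e·ℂ[h] by Molien's trace computation. The prefactor turns it
into the Hilbert series of e·ℂ[h]_W, the fake degree, because ℂ[h] is free over the invariants.
Freeness is used only as an identity of dimensions (`imageDim_eq`): the Nakayama bounds for e and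
for 1 - e, together with the spanning of the coinvariants by standard monomials, add up to the
dimension of ℂ[h] in each degree, so every bound is attained.

The representation theory rests on Young symmetrizers, whereas `schur` is a Jacobi–Trudi
determinant. `schur_eq_cellSchur` identifies the two: the determinant is triangular in both
directions for the lexicographic order, against the orthonormal functions `cellSchur` and against
monomials, which leaves one term. -/

lemma derivation_prod {R ι A M : Type*} [CommRing R] [CommRing A] [Algebra R A] [AddCommGroup M]
    [Module A M] [Module R M] [DecidableEq ι] (D : Derivation R A M) (s : Finset ι) (f : ι → A) :
    D (∏ i ∈ s, f i) = ∑ i ∈ s, (∏ j ∈ s.erase i, f j) • D (f i) := by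
  induction s using Finset.induction_on with
  | empty => simp
  | insert a s ha ih =>
    rw [Finset.prod_insert ha, D.leibniz, ih, Finset.sum_insert ha, Finset.erase_insert ha,
      Finset.smul_sum, add_comm]
    congr 1
    refine Finset.sum_congr rfl fun i hi => ?_
    have hia : i ≠ a := fun h => ha (h ▸ hi)
    rw [Finset.erase_insert_of_ne hia.symm, Finset.prod_insert (by simp [ha]), mul_smul]

/-- The norm `∏ r(x) ^ m(x) * m(x)!` of a monomial in variables of weights `r(x)`. -/
def hallNorm (r : σ → k) (m : σ →₀ ℕ) : k := m.prod fun x i => r x ^ i * (i.factorial : k)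

/-- The bilinear form for which the monomials are orthogonal with norms `hallNorm`. -/
def hall (r : σ → k) : MvPolynomial σ k →ₗ[k] MvPolynomial σ k →ₗ[k] k :=
  (basisMonomials σ k).constr k fun m => hallNorm r m • lcoeff k m

lemma hall_monomial (r : σ → k) (m : σ →₀ ℕ) (a : k) (g : MvPolynomial σ k) :
    hall r (monomial m a) g = a * hallNorm r m * coeff m g := by
  have h : (monomial m a : MvPolynomial σ k) = a • basisMonomials σ k m := by
    rw [coe_basisMonomials, smul_monomial, smul_eq_mul, mul_one]
  rw [h, map_smul, hall, Module.Basis.constr_basis]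
  simp [mul_assoc]

lemma hall_comm (r : σ → k) (f g : MvPolynomial σ k) : hall r f g = hall r g f := by
  classical
  induction f using MvPolynomial.induction_on' with
  | add p q hp hq => simp [hp, hq]
  | monomial m a =>
    induction g using MvPolynomial.induction_on' with
    | add p q hp hq => simp only [map_add, hp, hq, LinearMap.add_apply]
    | monomial m' a' =>
      rw [hall_monomial, hall_monomial, coeff_monomial, coeff_monomial]
      by_cases h : m = m'
      · subst h; simp; ring
      · rw [if_neg (Ne.symm h), if_neg h]; simp

lemma hall_one (r : σ → k) (g : MvPolynomial σ k) : hall r 1 g = constantCoeff g := by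
  have h : (1 : MvPolynomial σ k) = monomial 0 1 := rfl
  rw [h, hall_monomial]
  simp [hallNorm, constantCoeff_eq]

lemma hallNorm_add_single (r : σ → k) (m : σ →₀ ℕ) (x : σ) :
    hallNorm r (m + Finsupp.single x 1) = r x * (m x + 1) * hallNorm r m := by
  classical
  have key : ∀ m' : σ →₀ ℕ, hallNorm r m' =
      r x ^ m' x * (m' x).factorial * (m'.erase x).prod fun x i => r x ^ i * (i.factorial : k) := by
    intro m'
    rw [hallNorm, ← Finsupp.mul_prod_erase' m' x _ (by simp)]
  rw [key, key m]
  have he : (m + Finsupp.single x 1).erase x = m.erase x := by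
    ext y; by_cases h : y = x
    · subst h; simp
    · simp [Finsupp.erase_ne h]
  rw [he]
  simp [Nat.factorial_succ, pow_succ]
  ring

lemma hallNorm_ne_zero [CharZero k] {r : σ → k} (hr : ∀ x, r x ≠ 0) (m : σ →₀ ℕ) :
    hallNorm r m ≠ 0 :=
  Finset.prod_ne_zero_iff.2 fun x _ =>
    mul_ne_zero (pow_ne_zero _ (hr x)) (Nat.cast_ne_zero.2 (Nat.factorial_ne_zero _))

/-- Raising the exponent of x by one multiplies the norm by r x (m x + 1), and the derivative
supplies the factor m x + 1. -/
lemma hall_X_mul (r : σ → k) (x : σ) (f g : MvPolynomial σ k) :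
    hall r (X x * f) g = hall r f (r x • pderiv x g) := by
  induction f using MvPolynomial.induction_on' with
  | add p q hp hq => simp only [mul_add, map_add, hp, hq, LinearMap.add_apply]
  | monomial m a =>
    have h : (X x * monomial m a : MvPolynomial σ k) = monomial (m + Finsupp.single x 1) a := by
      rw [X, monomial_mul, one_mul, add_comm]
    rw [h, hall_monomial, hall_monomial, hallNorm_add_single, coeff_smul, coeff_pderiv, smul_eq_mul]
    ring

/-- The linear form with the coefficients `v`. -/
def linForm (v : σ →₀ k) : MvPolynomial σ k := v.sum fun x a => a • X x

/-- The derivation adjoint to multiplication by `linForm v`. -/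
def linDeriv (r : σ → k) (v : σ →₀ k) : Derivation k (MvPolynomial σ k) (MvPolynomial σ k) :=
  v.sum fun x a => (a * r x) • pderiv x

lemma linDeriv_apply (r : σ → k) (v : σ →₀ k) (g : MvPolynomial σ k) :
    linDeriv r v g = v.sum fun x a => (a * r x) • pderiv x g := by
  rw [linDeriv, Finsupp.sum, Finsupp.sum, ← Derivation.coeFnAddMonoidHom_apply, map_sum,
    Finset.sum_apply]
  rfl

lemma hall_linForm_mul (r : σ → k) (v : σ →₀ k) (f g : MvPolynomial σ k) :
    hall r (linForm v * f) g = hall r f (linDeriv r v g) := by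
  rw [linDeriv_apply, linForm, Finsupp.sum, Finsupp.sum, Finset.sum_mul, map_sum, map_sum,
    LinearMap.sum_apply]
  refine Finset.sum_congr rfl fun x _ => ?_
  rw [smul_mul_assoc, map_smul, LinearMap.smul_apply, hall_X_mul, mul_smul]
  simp only [map_smul]

lemma linDeriv_X (r : σ → k) (v : σ →₀ k) (y : σ) : linDeriv r v (X y) = C (v y * r y) := by
  classical
  rw [linDeriv_apply, Finsupp.sum]
  have : ∀ x ∈ v.support, (v x * r x) • pderiv x (X y : MvPolynomial σ k) =
      if x = y then C (v y * r y) else 0 := by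
    intro x _
    split_ifs with h
    · subst h; rw [pderiv_X_self, smul_eq_C_mul, mul_one]
    · rw [pderiv_X_of_ne (Ne.symm h), smul_zero]
  rw [Finset.sum_congr rfl this, Finset.sum_ite_eq']
  split_ifs with h
  · rfl
  · rw [Finsupp.notMem_support_iff.1 h, zero_mul, C_0]

/-- A substitution that intertwines derivations up to scalars scales the pairings. -/
lemma hall_prod_linForm_aeval (r : σ → k) {ι : Type*} (s : Finset ι) (v : ι → σ →₀ k) (q : ι → k)
    (Θ : σ → MvPolynomial σ k) (h0 : ∀ x, constantCoeff (Θ x) = 0)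
    (h : ∀ i ∈ s, ∀ x, linDeriv r (v i) (Θ x) = C (q i * (v i x * r x)))
    (F : MvPolynomial σ k) :
    hall r (∏ i ∈ s, linForm (v i)) (aeval Θ F) =
      (∏ i ∈ s, q i) * hall r (∏ i ∈ s, linForm (v i)) F := by
  classical
  induction s using Finset.induction_on generalizing F with
  | empty =>
    -- The empty product pairs through the constant coefficient, which the substitution preserves
    -- because no `Θ x` has a constant term.
    simp only [Finset.prod_empty, hall_one, one_mul]
    induction F using MvPolynomial.induction_on with
    | C a => simp
    | add p q hp hq => rw [map_add, map_add, map_add, hp, hq]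
    | mul_X p x hp => simp [h0]
  | insert a s ha ih =>
    rw [Finset.prod_insert ha, Finset.prod_insert ha, hall_linForm_mul, hall_linForm_mul]
    -- Both sides are derivations along the substitution, so it suffices to compare them on
    -- variables, where `h` applies.
    have hD : ∀ G : MvPolynomial σ k, linDeriv r (v a) (aeval Θ G) =
        q a • aeval Θ (linDeriv r (v a) G) := by
      intro G
      induction G using MvPolynomial.induction_on with
      | C b => simp [algebraMap_eq]
      | add p q hp hq => simp only [map_add, hp, hq, smul_add]
      | mul_X p x hp =>
        rw [map_mul, aeval_X, Derivation.leibniz, Derivation.leibniz, hp,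
          h a (Finset.mem_insert_self _ _), linDeriv_X, map_add]
        simp only [smul_eq_mul, map_mul, aeval_X, aeval_C, algebraMap_eq, smul_eq_C_mul]
        ring
    rw [hD, map_smul, ih (fun i hi => h i (Finset.mem_insert_of_mem hi)), smul_eq_mul, mul_assoc]

open Classical in
-- Sorts the bijections by the image of `none`; this is the expansion of a permanent along one row.
lemma sum_equiv_option {C O A : Type*} [Fintype C] [Fintype O] [hi : Fintype (Option C ≃ O)]
    [hj : ∀ o : O, Fintype (C ≃ {y : O // y ≠ o})] [AddCommMonoid A] (F : (Option C ≃ O) → A) :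
    ∑ β : Option C ≃ O, F β =
      ∑ o : O, ∑ β : C ≃ {y : O // y ≠ o}, F ((Equiv.optionSubtype o).symm β).1 := by
  rw [← Equiv.sum_comp (Equiv.sigmaFiberEquiv fun β : Option C ≃ O => β none), Fintype.sum_sigma]
  refine Finset.sum_congr rfl fun o _ => ?_
  rw [← Equiv.sum_comp (Equiv.optionSubtype o).symm]
  rfl

open Classical in
-- Induction on the number of linear forms, with `O` free to shrink by one point at each step.
lemma hall_prod_linForm_prod_X_aux (r : σ → k) {C : Type*} [hC : Fintype C] :
    ∀ {O : Type} [Fintype O] [Fintype (C ≃ O)] (v : C → σ →₀ k) (y : O → σ),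
    hall r (∏ c, linForm (v c)) (∏ o, X (y o)) =
      ∑ β : C ≃ O, ∏ c, (v c (y (β c)) * r (y (β c))) := by
  refine Fintype.induction_empty_option (P := fun C hC => ∀ {O : Type} [Fintype O]
      [Fintype (C ≃ O)] (v : C → σ →₀ k) (y : O → σ),
      hall r (∏ c, linForm (v c)) (∏ o, X (y o)) =
      ∑ β : C ≃ O, ∏ c, (v c (y (β c)) * r (y (β c)))) ?_ ?_ ?_ C
  · intro A B _ e ih O _ _ v y
    let _ := Fintype.ofEquiv B e.symm
    have := ih (fun a => v (e a)) y
    rw [← Equiv.prod_comp e (fun c => linForm (v c))]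
    convert this using 1
    rw [← Equiv.sum_comp (Equiv.equivCongr e (Equiv.refl O))]
    refine Finset.sum_congr rfl fun β _ => ?_
    rw [← Equiv.prod_comp e]
    simp
  · intro O _ _ v y
    simp only [Finset.univ_eq_empty, Finset.prod_empty, hall_one, map_prod, constantCoeff_X,
      Finset.prod_const, Finset.sum_const, nsmul_eq_mul, mul_one, Finset.card_univ]
    -- For empty `O` there is exactly one bijection and the product is 1; otherwise there is none
    -- and a product of variables has no constant term.
    rcases isEmpty_or_nonempty O with hO | hO
    · have : Unique (PEmpty ≃ O) := ⟨⟨Equiv.equivOfIsEmpty _ _⟩, fun _ => by ext x; exact x.elim⟩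
      rw [Fintype.card_eq_zero, pow_zero, Fintype.card_unique, Nat.cast_one]
    · have : IsEmpty (PEmpty ≃ O) := ⟨fun e => (e.symm hO.some).elim⟩
      rw [zero_pow Fintype.card_ne_zero, Fintype.card_eq_zero, Nat.cast_zero]
  · intro A _ ih O _ _ v y
    -- Moved across the form, the factor of `none` becomes a derivation and contracts with one
    -- variable at a time.
    rw [Fintype.prod_option, hall_linForm_mul, derivation_prod, map_sum]
    rw [sum_equiv_option]
    refine Finset.sum_congr rfl fun o _ => ?_
    have hprod : ∏ j ∈ Finset.univ.erase o, (X (y j) : MvPolynomial σ k) =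
        ∏ j : {z : O // z ≠ o}, X (y j) := by
      rw [← Finset.prod_subtype (Finset.univ.erase o) (p := fun z => z ≠ o) (by simp)
        (fun j => (X (y j) : MvPolynomial σ k))]
    rw [hprod, linDeriv_X, smul_eq_mul, mul_comm, ← smul_eq_C_mul, map_smul, ih, smul_eq_mul,
      Finset.mul_sum]
    refine Finset.sum_congr (by congr!) fun β _ => ?_
    rw [Fintype.prod_option]
    simp

/-- The pairing of a product of linear forms with a product of variables is a permanent. -/
lemma hall_prod_linForm_prod_X (r : σ → k) {C : Type*} [Fintype C] [DecidableEq C]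
    {O : Type} [Fintype O] [DecidableEq O] (v : C → σ →₀ k) (y : O → σ) :
    hall r (∏ c, linForm (v c)) (∏ o, X (y o)) =
      ∑ β : C ≃ O, ∏ c, (v c (y (β c)) * r (y (β c))) := by
  rw [hall_prod_linForm_prod_X_aux]

end HallForm

/-! ## Orbits of permutations and intertwining bijections -/

section Orbits

open Equiv

/-- The set of cycles (fixed points included) of a permutation. -/
abbrev Orb {α : Type} (σ : Perm α) : Type := Quotient (Perm.SameCycle.setoid σ)

/-- The cycle of a point. -/
abbrev orbMk {α : Type} (σ : Perm α) (x : α) : Orb σ := Quotient.mk (Perm.SameCycle.setoid σ) x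

variable {α β : Type}

lemma orbMk_eq_iff {σ : Perm α} {x y : α} : orbMk σ x = orbMk σ y ↔ σ.SameCycle x y :=
  Quotient.eq (r := Perm.SameCycle.setoid σ)

lemma orbMk_out {σ : Perm α} (o : Orb σ) : orbMk σ o.out = o := Quotient.out_eq o

lemma orbMk_apply (σ : Perm α) (x : α) : orbMk σ (σ x) = orbMk σ x :=
  orbMk_eq_iff.2 (Perm.sameCycle_apply_left.2 (Perm.SameCycle.refl _ _))

lemma orbMk_zpow_apply (σ : Perm α) (i : ℤ) (x : α) : orbMk σ ((σ ^ i) x) = orbMk σ x :=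
  orbMk_eq_iff.2 (Perm.sameCycle_zpow_left.2 (Perm.SameCycle.refl _ _))

lemma intertwiner_zpow {σ : Perm α} {π : Perm β} {g : α → β} (hg : ∀ x, g (σ x) = π (g x))
    (i : ℤ) (x : α) : g ((σ ^ i) x) = (π ^ i) (g x) := by
  have h : ∀ (n : ℕ) (x : α), g ((σ ^ n) x) = (π ^ n) (g x) := by
    intro n
    induction n with
    | zero => simp
    | succ n ih => intro x; rw [pow_succ', pow_succ', Perm.mul_apply, Perm.mul_apply, hg, ih]
  cases i with
  | ofNat n => exact h n x
  | negSucc n =>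
    rw [zpow_negSucc, zpow_negSucc, Perm.eq_inv_iff_eq, ← h, ← Perm.mul_apply, mul_inv_cancel, Perm.one_apply]

lemma intertwiner_orbMk_eq_iff {σ : Perm α} {π : Perm β} {g : α ≃ β}
    (hg : ∀ x, g (σ x) = π (g x)) (x y : α) :
    orbMk π (g x) = orbMk π (g y) ↔ orbMk σ x = orbMk σ y := by
  rw [orbMk_eq_iff, orbMk_eq_iff]
  refine exists_congr fun i => ?_
  rw [← intertwiner_zpow hg, g.injective.eq_iff]

/-- An invariant function is constant along cycles, so its value can be read off at the chosen
representative. -/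
lemma apply_orbMk_out {γ A : Type} {f : γ → A} {ρ : Perm γ} (hf : ∀ x, f (ρ x) = f x) (x : γ) :
    f (orbMk ρ x).out = f x := by
  obtain ⟨i, hi⟩ := orbMk_eq_iff.1 (orbMk_out (orbMk ρ x))
  have := intertwiner_zpow (σ := ρ) (π := (1 : Perm A)) (g := f) (by simpa using hf) i
    (orbMk ρ x).out
  rw [hi] at this
  simpa using this.symm

/-- The bijection of cycles induced by an intertwining bijection. -/
def orbEquiv {σ : Perm α} {π : Perm β} (g : α ≃ β) (hg : ∀ x, g (σ x) = π (g x)) :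
    Orb σ ≃ Orb π :=
  Quotient.congr g fun x y => by
    have := intertwiner_orbMk_eq_iff hg x y
    rw [orbMk_eq_iff, orbMk_eq_iff] at this
    exact this.symm

lemma orbEquiv_mk {σ : Perm α} {π : Perm β} (g : α ≃ β) (hg : ∀ x, g (σ x) = π (g x)) (x : α) :
    orbEquiv g hg (orbMk σ x) = orbMk π (g x) := rfl

variable [Fintype α]

open Classical in
/-- The length of a cycle. -/
def orbSize {σ : Perm α} (o : Orb σ) : ℕ := Finset.card {x : α | orbMk σ x = o}

lemma orbSize_pos {σ : Perm α} (o : Orb σ) : 0 < orbSize o := by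
  classical
  exact Finset.card_pos.2 ⟨o.out, by simp⟩

variable [DecidableEq α] [Fintype β] [DecidableEq β]

/-- The minimal period of a point is the size of its orbit under the powers of `σ`, and this orbit
is the cycle. -/
lemma zpow_apply_eq_iff (σ : Perm α) (x : α) (i : ℤ) :
    (σ ^ i) x = x ↔ (orbSize (orbMk σ x) : ℤ) ∣ i := by
  classical
  have h1 := MulAction.zpow_smul_eq_iff_minimalPeriod_dvd (a := σ) (b := x) (n := i)
  rw [Perm.smul_def] at h1
  rw [h1, MulAction.minimalPeriod_eq_card]
  have h2 : Fintype.card (MulAction.orbit (Subgroup.zpowers σ) x) = orbSize (orbMk σ x) := by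
    rw [orbSize, Fintype.card_subtype]
    congr 1
    ext y
    simp only [Finset.mem_filter, Finset.mem_univ, true_and]
    rw [orbMk_eq_iff, Perm.sameCycle_comm, MulAction.mem_orbit_iff]
    constructor
    · rintro ⟨⟨_, i, rfl⟩, h⟩
      exact ⟨i, h⟩
    · rintro ⟨i, h⟩
      exact ⟨⟨_, i, rfl⟩, h⟩
  rw [h2]

lemma zpow_apply_eq_zpow_apply_iff (σ : Perm α) (x : α) (i j : ℤ) :
    (σ ^ i) x = (σ ^ j) x ↔ (orbSize (orbMk σ x) : ℤ) ∣ i - j := by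
  rw [← zpow_apply_eq_iff, zpow_sub, ← (zpow_mul_comm σ (-j) i |> fun h => by
    simpa [zpow_neg] using h : (σ ^ j)⁻¹ * σ ^ i = σ ^ i * (σ ^ j)⁻¹), Perm.mul_apply,
    Perm.inv_eq_iff_eq]

/-- The bijections that intertwine two permutations. -/
def intertwiners (σ : Perm α) (π : Perm β) : Finset (α ≃ β) := {g | ∀ x, g (σ x) = π (g x)}

lemma mem_intertwiners {σ : Perm α} {π : Perm β} {g : α ≃ β} :
    g ∈ intertwiners σ π ↔ ∀ x, g (σ x) = π (g x) := by
  simp [intertwiners]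

lemma orbSize_orbEquiv {σ : Perm α} {π : Perm β} (g : α ≃ β) (hg : ∀ x, g (σ x) = π (g x))
    (o : Orb σ) : orbSize (orbEquiv g hg o) = orbSize o := by
  classical
  refine (Finset.card_equiv g fun x => ?_).symm
  simp only [Finset.mem_filter, Finset.mem_univ, true_and]
  rw [← orbEquiv_mk g hg, (orbEquiv g hg).injective.eq_iff]

open Classical in
/-- The number of intertwining bijections that induce a given bijection of cycles. -/
lemma card_intertwiners_fiber {σ : Perm α} {π : Perm β} (b : Orb σ ≃ Orb π) :
    (Finset.card {g ∈ intertwiners σ π | ∀ x, orbMk π (g x) = b (orbMk σ x)}) =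
      ∏ c : Orb σ, if orbSize (b c) = orbSize c then orbSize c else 0 := by
  -- Intertwiners preserve cycle lengths, so the fibre is empty unless `b` does.
  by_cases hs : ∀ c, orbSize (b c) = orbSize c
  swap
  · push Not at hs
    obtain ⟨c, hc⟩ := hs
    rw [Finset.prod_eq_zero (Finset.mem_univ c) (if_neg hc), Finset.card_eq_zero,
      Finset.filter_eq_empty_iff]
    intro g hg h
    apply hc
    rw [mem_intertwiners] at hg
    rw [← orbSize_orbEquiv g hg c, ← orbMk_out c, ← h, orbEquiv_mk]
  have hprod : (∏ c : Orb σ, if orbSize (b c) = orbSize c then orbSize c else 0) =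
      Fintype.card (∀ c : Orb σ, {y : β // orbMk π y = b c}) := by
    rw [Fintype.card_pi]
    refine Finset.prod_congr rfl fun c _ => ?_
    rw [if_pos (hs c), Fintype.card_subtype, ← hs c, orbSize]
  rw [hprod, ← Fintype.card_coe]
  have hidx : ∀ x : α, ∃ i : ℤ, (σ ^ i) (orbMk σ x).out = x := fun x =>
    orbMk_eq_iff.1 (orbMk_out (orbMk σ x))
  choose idx hidx using hidx
  -- An intertwiner over `b` is determined by the images of the cycle representatives, and each
  -- image may be any point of the cycle `b c`.
  refine Fintype.card_of_bijective (f := fun g c =>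
    ⟨g.1 c.out, by
      have h := (Finset.mem_filter.1 g.2).2 c.out
      rwa [orbMk_out] at h⟩) ⟨?_, ?_⟩
  · rintro ⟨g, hg⟩ ⟨g', hg'⟩ h
    rw [Finset.mem_filter, mem_intertwiners] at hg hg'
    refine Subtype.ext (Equiv.ext fun x => ?_)
    have h1 : g (orbMk σ x).out = g' (orbMk σ x).out :=
      congrArg Subtype.val (congrFun h (orbMk σ x))
    change g x = g' x
    rw [← hidx x, intertwiner_zpow hg.1, intertwiner_zpow hg'.1, h1]
  · intro f
    -- The chosen images are propagated along the cycles. The result does not depend on the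
    -- exponents `idx`, since matched cycles have equal length.
    let g : α → β := fun x => (π ^ idx x) (f (orbMk σ x)).1
    have hsize : ∀ c, orbSize (orbMk π (f c).1) = orbSize c := fun c => by rw [(f c).2, hs]
    have hg : ∀ (c : Orb σ) (i : ℤ), g ((σ ^ i) c.out) = (π ^ i) (f c).1 := by
      intro c i
      have hc : orbMk σ ((σ ^ i) c.out) = c := by rw [orbMk_zpow_apply, orbMk_out]
      have h := hidx ((σ ^ i) c.out)
      simp only [g]
      rw [hc] at h ⊢
      rw [zpow_apply_eq_zpow_apply_iff, orbMk_out] at h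
      rw [zpow_apply_eq_zpow_apply_iff, hsize]
      exact h
    have hmk : ∀ x, orbMk π (g x) = b (orbMk σ x) := fun x => by
      simp only [g]
      rw [orbMk_zpow_apply, (f _).2]
    have hinj : Function.Injective g := by
      intro x y hxy
      have h1 : orbMk σ x = orbMk σ y := b.injective (by rw [← hmk, ← hmk, hxy])
      simp only [g] at hxy
      rw [h1, zpow_apply_eq_zpow_apply_iff, hsize] at hxy
      rw [← hidx x, ← hidx y, h1, zpow_apply_eq_zpow_apply_iff, orbMk_out]
      exact hxy
    have hsurj : Function.Surjective g := by
      intro z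
      obtain ⟨c, hc⟩ := b.surjective (orbMk π z)
      obtain ⟨i, hi⟩ := orbMk_eq_iff.1 ((f c).2.trans hc)
      exact ⟨(σ ^ i) c.out, by rw [hg, hi]⟩
    refine ⟨⟨Equiv.ofBijective g ⟨hinj, hsurj⟩, ?_⟩, ?_⟩
    · rw [Finset.mem_filter, mem_intertwiners]
      refine ⟨fun x => ?_, hmk⟩
      change g (σ x) = π (g x)
      conv_lhs => rw [← hidx x, ← Perm.mul_apply, ← zpow_one_add, hg, zpow_one_add,
        Perm.mul_apply]
    · funext c
      refine Subtype.ext ?_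
      have := hg c 0
      rw [zpow_zero, zpow_zero, Perm.one_apply, Perm.one_apply] at this
      exact this

open Classical in
/-- Sums over intertwining bijections as sums over bijections of cycles. -/
lemma sum_intertwiners {k : Type*} [CommRing k] (σ : Perm α) (π : Perm β)
    (φ : Orb σ → Orb π → k) :
    ∑ g ∈ intertwiners σ π, ∏ c : Orb σ, φ c (orbMk π (g c.out)) =
      ∑ b : Orb σ ≃ Orb π, ∏ c : Orb σ,
        if orbSize (b c) = orbSize c then (orbSize c : k) * φ c (b c) else 0 := by
  have h1 : ∀ b : Orb σ ≃ Orb π, (∏ c : Orb σ,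
      if orbSize (b c) = orbSize c then (orbSize c : k) * φ c (b c) else 0) =
      ∑ g ∈ intertwiners σ π with ∀ x, orbMk π (g x) = b (orbMk σ x),
        ∏ c : Orb σ, φ c (orbMk π (g c.out)) := by
    intro b
    rw [Finset.sum_congr rfl (g := fun _ => ∏ c : Orb σ, φ c (b c)), Finset.sum_const,
      card_intertwiners_fiber, nsmul_eq_mul, Nat.cast_prod, ← Finset.prod_mul_distrib]
    · refine Finset.prod_congr rfl fun c _ => ?_
      split_ifs <;> simp
    · intro g hg
      refine Finset.prod_congr rfl fun c _ => ?_
      rw [(Finset.mem_filter.1 hg).2, orbMk_out]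
  rw [Finset.sum_congr rfl fun b _ => h1 b]
  simp only [Finset.sum_filter]
  rw [Finset.sum_comm]
  refine Finset.sum_congr rfl fun g hg => ?_
  rw [mem_intertwiners] at hg
  -- Each intertwiner lies over exactly one bijection of cycles, the one it induces.
  rw [Finset.sum_eq_single (orbEquiv g hg)]
  · rw [if_pos fun x => (orbEquiv_mk g hg x).symm]
  · intro b _ hb
    rw [if_neg]
    intro h
    refine hb (Equiv.ext fun c => ?_)
    rw [← orbMk_out c, ← h, orbEquiv_mk]
  · simp

end Orbits

/-! ## Power sums attached to permutations -/

section PowerSums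

open MvPolynomial Equiv

variable {α β : Type} [Fintype α] [DecidableEq α] [Fintype β] [DecidableEq β] {l : ℕ}

/-- The weights of the variables for the Hall form on multisymmetric functions. -/
def powWeight (l : ℕ) : Fin l × ℕ+ → Kt := fun x => ((x.2 : ℕ) : Kt)

/-- The Hall form on multisymmetric functions. -/
abbrev hallForm (l : ℕ) : MultiSym l →ₗ[Kt] MultiSym l →ₗ[Kt] Kt := hall (powWeight l)

open Classical in
/-- The product of the power sums `p_r[X^(j)]` over the cycles of a permutation, where `r` is
the length of the cycle and `j` the component in which it lies. -/
def permPow (comp : α → Fin l) (π : Perm α) : MultiSym l :=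
  ∏ o : Orb π, X (comp o.out, (orbSize o).toPNat')

/-- The coefficients of `∑ ψ_j p_r[X^(j)]`. -/
def orbForm (ψ : Fin l → Kt) (r : ℕ) : Fin l × ℕ+ →₀ Kt :=
  ∑ j : Fin l, Finsupp.single (j, r.toPNat') (ψ j)

lemma orbForm_apply (ψ : Fin l → Kt) (r : ℕ) (x : Fin l × ℕ+) :
    orbForm ψ r x = if x.2 = r.toPNat' then ψ x.1 else 0 := by
  classical
  rw [orbForm, Finsupp.finsetSum_apply]
  simp only [Finsupp.single_apply]
  rcases x with ⟨i, s⟩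
  simp only [Prod.mk.injEq]
  by_cases h : r.toPNat' = s
  · simp [h]
  · simp [h, Ne.symm h]

lemma linForm_orbForm (ψ : Fin l → Kt) (r : ℕ) :
    linForm (orbForm ψ r) = ∑ j : Fin l, ψ j • (X (j, r.toPNat') : MultiSym l) := by
  classical
  rw [linForm, orbForm, ← Finsupp.sum_finsetSum_index (by simp) (by simp [add_smul])]
  exact Finset.sum_congr rfl fun j _ => Finsupp.sum_single_index (by simp)

lemma toPNat'_inj {a b : ℕ} (ha : 0 < a) (hb : 0 < b) : a.toPNat' = b.toPNat' ↔ a = b := by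
  constructor
  · intro h
    have := congrArg PNat.val h
    rwa [Nat.toPNat'_coe, Nat.toPNat'_coe, if_pos ha, if_pos hb] at this
  · rintro rfl; rfl

open Classical in
/-- The Hall form pairs power sums of permutations by counting intertwining bijections. -/
lemma hallForm_permPow (σ : Perm α) (ψ : Orb σ → Fin l → Kt) (comp : β → Fin l) (π : Perm β) :
    hallForm l (∏ c : Orb σ, linForm (orbForm (ψ c) (orbSize c))) (permPow comp π) =
      ∑ g ∈ intertwiners σ π, ∏ c : Orb σ, ψ c (comp (orbMk π (g c.out)).out) := by
  rw [hallForm, permPow, hall_prod_linForm_prod_X,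
    sum_intertwiners σ π (fun c o => ψ c (comp o.out))]
  -- The weight r of p_r in the Hall form equals the number of ways to match two cycles of length r.
  refine Finset.sum_congr rfl fun b _ => Finset.prod_congr rfl fun c _ => ?_
  rw [orbForm_apply]
  simp only [toPNat'_inj (orbSize_pos (b c)) (orbSize_pos c)]
  split_ifs with h
  · rw [powWeight, mul_comm]
    simp only [Nat.toPNat'_coe, h, if_pos (orbSize_pos c)]
  · rw [zero_mul]

open Classical in
-- The case of `hallForm_permPow` in which each form is a single power sum. The condition on
-- components is imposed there at one point per cycle, which suffices because components are
-- constant along cycles.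
lemma hallForm_permPow_permPow (comp : α → Fin l) (comp' : β → Fin l) (σ : Perm α) (π : Perm β)
    (hσ : ∀ x, comp (σ x) = comp x) (hπ : ∀ x, comp' (π x) = comp' x) :
    hallForm l (permPow comp σ) (permPow comp' π) =
      ∑ g : α ≃ β, if (∀ x, comp' (g x) = comp x) ∧ ∀ x, g (σ x) = π (g x) then 1 else 0 := by
  have h1 : permPow comp σ = ∏ c : Orb σ,
      linForm (orbForm (fun j => if j = comp c.out then 1 else 0) (orbSize c)) := by
    refine Finset.prod_congr rfl fun c _ => ?_
    rw [linForm_orbForm]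
    simp
  rw [h1, hallForm_permPow, intertwiners, Finset.sum_filter]
  refine Finset.sum_congr rfl fun g _ => ?_
  by_cases hg : ∀ x, g (σ x) = π (g x)
  · rw [if_pos hg]
    simp only [apply_orbMk_out hπ]
    rw [Finset.prod_ite_zero]
    rw [Finset.prod_const_one]
    congr 1
    simp only [hg, implies_true, and_true, Finset.mem_univ, true_implies, eq_iff_iff]
    constructor
    · intro h x
      obtain ⟨i, hi⟩ := orbMk_eq_iff.1 (orbMk_out (orbMk σ x))
      have h2 := h (orbMk σ x)
      rw [apply_orbMk_out hσ] at h2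
      rw [← h2, ← apply_orbMk_out hπ, ← apply_orbMk_out hπ (g (Quotient.out _)),
        (intertwiner_orbMk_eq_iff hg _ _).2 (orbMk_out (orbMk σ x)).symm]
    · intro h c
      exact h _
  · rw [if_neg hg, if_neg fun h => hg h.2]

end PowerSums

/-! ## Young symmetrizers of abstract tableaux -/

section GroupAlgebra

variable {G : Type*} [Fintype G]

lemma eq_sum_single (x : MonoidAlgebra ℂ G) :
    x = ∑ g : G, MonoidAlgebra.single g (x.coeff g) := by
  classical
  ext g
  rw [MonoidAlgebra.coeff_sum, Finsupp.finsetSum_apply]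
  simp [MonoidAlgebra.coeff_single, Finsupp.single_apply]

lemma coeff_mul_eq_sum [Group G] (x y : MonoidAlgebra ℂ G) (h : G) :
    (x * y).coeff h = ∑ g : G, x.coeff (h * g⁻¹) * y.coeff g := by
  conv_lhs => rw [eq_sum_single y, Finset.mul_sum, MonoidAlgebra.coeff_sum,
    Finsupp.finsetSum_apply]
  exact Finset.sum_congr rfl fun g _ => MonoidAlgebra.coeff_mul_single_apply _ _ _ _

lemma trace_eq_sum_coeff (f : MonoidAlgebra ℂ G →ₗ[ℂ] MonoidAlgebra ℂ G) :
    LinearMap.trace ℂ _ f = ∑ g : G, (f (MonoidAlgebra.single g 1)).coeff g := by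
  classical
  rw [LinearMap.trace_eq_matrix_trace ℂ (MonoidAlgebra.basis G ℂ), Matrix.trace]
  refine Finset.sum_congr rfl fun g _ => ?_
  rw [Matrix.diag_apply, LinearMap.toMatrix_apply, MonoidAlgebra.basis_apply]
  rfl

end GroupAlgebra

section Tableau

open Equiv

variable {α : Type} [Fintype α] [DecidableEq α] {A A' ι : Type}

open Classical in
/-- The permutations that preserve a function. -/
def fixers (f : α → A) : Finset (Perm α) := {σ | ∀ x, f (σ x) = f x}

lemma mem_fixers {f : α → A} {σ : Perm α} : σ ∈ fixers f ↔ ∀ x, f (σ x) = f x := by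
  simp [fixers]

lemma one_mem_fixers (f : α → A) : 1 ∈ fixers f := mem_fixers.2 fun _ => rfl

lemma mul_mem_fixers {f : α → A} {σ τ : Perm α} (hσ : σ ∈ fixers f) (hτ : τ ∈ fixers f) :
    σ * τ ∈ fixers f :=
  mem_fixers.2 fun x => by rw [Perm.mul_apply, mem_fixers.1 hσ, mem_fixers.1 hτ]

lemma inv_mem_fixers {f : α → A} {σ : Perm α} (hσ : σ ∈ fixers f) : σ⁻¹ ∈ fixers f :=
  mem_fixers.2 fun x => by
    rw [← mem_fixers.1 hσ (σ⁻¹ x), ← Perm.mul_apply, mul_inv_cancel, Perm.one_apply]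

lemma swap_mem_fixers {f : α → A} {a b : α} (h : f a = f b) : swap a b ∈ fixers f :=
  mem_fixers.2 fun x => by
    rcases eq_or_ne x a with rfl | ha
    · rw [swap_apply_left, h]
    · rcases eq_or_ne x b with rfl | hb
      · rw [swap_apply_right, h]
      · rw [swap_apply_of_ne_of_ne ha hb]

lemma sum_fixers_mul_left {M : Type*} [AddCommMonoid M] {f : α → A} {σ : Perm α}
    (hσ : σ ∈ fixers f) (F : Perm α → M) :
    ∑ x ∈ fixers f, F (σ * x) = ∑ x ∈ fixers f, F x :=
  Finset.sum_bij (fun x _ => σ * x) (fun _ hx => mul_mem_fixers hσ hx)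
    (fun _ _ _ _ h => mul_left_cancel h)
    (fun y hy => ⟨σ⁻¹ * y, mul_mem_fixers (inv_mem_fixers hσ) hy, by simp⟩) fun _ _ => rfl

lemma sum_fixers_mul_right {M : Type*} [AddCommMonoid M] {f : α → A} {σ : Perm α}
    (hσ : σ ∈ fixers f) (F : Perm α → M) :
    ∑ x ∈ fixers f, F (x * σ) = ∑ x ∈ fixers f, F x :=
  Finset.sum_bij (fun x _ => x * σ) (fun _ hx => mul_mem_fixers hx hσ)
    (fun _ _ _ _ h => mul_right_cancel h)
    (fun y hy => ⟨y * σ⁻¹, mul_mem_fixers hy (inv_mem_fixers hσ), by simp⟩) fun _ _ => rfl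

lemma sum_fixers_inv {M : Type*} [AddCommMonoid M] {f : α → A} (F : Perm α → M) :
    ∑ x ∈ fixers f, F x⁻¹ = ∑ x ∈ fixers f, F x :=
  Finset.sum_bij (fun x _ => x⁻¹) (fun _ hx => inv_mem_fixers hx)
    (fun _ _ _ _ h => inv_injective h) (fun y hy => ⟨y⁻¹, inv_mem_fixers hy, by simp⟩)
    fun _ _ => rfl

/-- The sign of a permutation as a complex number. -/
def csign (σ : Perm α) : ℂ := ((Perm.sign σ : ℤ) : ℂ)

lemma csign_mul (σ τ : Perm α) : csign (σ * τ) = csign σ * csign τ := by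
  simp [csign]

lemma csign_mul_self (σ : Perm α) : csign σ * csign σ = 1 := by
  rw [← csign_mul, csign, Perm.sign_mul, Int.units_mul_self]; simp

lemma csign_inv (σ : Perm α) : csign σ⁻¹ = csign σ := by simp [csign]

lemma csign_one : csign (1 : Perm α) = 1 := by simp [csign]

lemma csign_swap {a b : α} (h : a ≠ b) : csign (swap a b) = -1 := by
  simp [csign, Perm.sign_swap h]

/-- The Young symmetrizer of a filling with given rows and columns. -/
def youngElt (row : α → A) (col : α → A') : MonoidAlgebra ℂ (Perm α) :=
  ∑ σ ∈ fixers row, ∑ τ ∈ fixers col, MonoidAlgebra.single (σ * τ) (csign τ)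

variable (row : α → A) (col : α → A')

lemma youngElt_coeff (x : Perm α) : (youngElt row col).coeff x =
    ∑ σ ∈ fixers row, ∑ τ ∈ fixers col, if σ * τ = x then csign τ else 0 := by
  classical
  simp only [youngElt, MonoidAlgebra.coeff_sum, Finsupp.finsetSum_apply,
    MonoidAlgebra.coeff_single, Finsupp.single_apply]

variable {row col}

lemma youngElt_coeff_mul_left {σ : Perm α} (hσ : σ ∈ fixers row) (x : Perm α) :
    (youngElt row col).coeff (σ * x) = (youngElt row col).coeff x := by
  rw [youngElt_coeff, youngElt_coeff, ← sum_fixers_mul_left hσ]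
  simp only [mul_assoc, mul_right_inj]

lemma youngElt_coeff_mul_right {τ : Perm α} (hτ : τ ∈ fixers col) (x : Perm α) :
    (youngElt row col).coeff (x * τ) = csign τ * (youngElt row col).coeff x := by
  rw [youngElt_coeff, youngElt_coeff, Finset.mul_sum]
  refine Finset.sum_congr rfl fun σ _ => ?_
  rw [← sum_fixers_mul_right hτ, Finset.mul_sum]
  refine Finset.sum_congr rfl fun τ' _ => ?_
  simp only [← mul_assoc, mul_left_inj, csign_mul, mul_ite, mul_zero]
  congr 1
  ring

lemma single_mul_youngElt {σ : Perm α} (hσ : σ ∈ fixers row) :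
    MonoidAlgebra.single σ 1 * youngElt row col = youngElt row col := by
  ext x
  rw [MonoidAlgebra.coeff_single_mul_apply, one_mul,
    youngElt_coeff_mul_left (inv_mem_fixers hσ)]

lemma youngElt_mul_single {τ : Perm α} (hτ : τ ∈ fixers col) :
    youngElt row col * MonoidAlgebra.single τ 1 = csign τ • youngElt row col := by
  ext x
  rw [MonoidAlgebra.coeff_mul_single_apply, mul_one, MonoidAlgebra.coeff_smul_apply,
    youngElt_coeff_mul_right (inv_mem_fixers hτ), csign_inv, smul_eq_mul]

/-- A permutation preserving both rows and columns is trivial, so 1 factors as a row times a column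
permutation in one way only. -/
lemma youngElt_coeff_one (hinj : ∀ x y, row x = row y → col x = col y → x = y) :
    (youngElt row col).coeff 1 = 1 := by
  rw [youngElt_coeff, Finset.sum_eq_single 1, Finset.sum_eq_single 1]
  · rw [one_mul, if_pos rfl, csign_one]
  · intro τ _ h
    rw [one_mul, if_neg h]
  · exact fun h => (h (one_mem_fixers _)).elim
  · intro σ hσ hne
    refine Finset.sum_eq_zero fun τ hτ => if_neg fun h => hne (Equiv.ext fun x => ?_)
    have h1 : σ = τ⁻¹ := eq_inv_of_mul_eq_one_left h
    refine hinj _ _ (mem_fixers.1 hσ x) ?_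
    rw [h1]
    exact mem_fixers.1 (inv_mem_fixers hτ) x
  · exact fun h => (h (one_mem_fixers _)).elim

/-- The elements of the group algebra supported on the permutations that preserve `comp`. -/
def compSupported (comp : α → ι) (x : MonoidAlgebra ℂ (Perm α)) : Prop :=
  ∀ g, x.coeff g ≠ 0 → ∀ a, comp (g a) = comp a

lemma compSupported.mul {comp : α → ι} {x y : MonoidAlgebra ℂ (Perm α)}
    (hx : compSupported comp x) (hy : compSupported comp y) : compSupported comp (x * y) := by
  intro g hg a
  rw [coeff_mul_eq_sum] at hg
  obtain ⟨h, _, hh⟩ := Finset.exists_ne_zero_of_sum_ne_zero hg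
  have h1 := hx _ (left_ne_zero_of_mul hh) (h a)
  rwa [hy _ (right_ne_zero_of_mul hh) a, ← Perm.mul_apply, inv_mul_cancel_right] at h1

lemma compSupported_single {comp : α → ι} {g : Perm α} (hg : ∀ a, comp (g a) = comp a) (c : ℂ) :
    compSupported comp (MonoidAlgebra.single g c) := by
  classical
  intro h hh
  rw [MonoidAlgebra.coeff_single, Finsupp.single_apply] at hh
  split_ifs at hh with h1
  · exact h1 ▸ hg
  · exact (hh rfl).elim

/-- A filling whose Young symmetrizer is primitive: rows and columns refine the components, they
separate the boxes, and every permutation that preserves the components is a product of a row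
and a column permutation or moves two boxes of one column into one row. -/
structure IsTableau (comp : α → ι) (row : α → A) (col : α → A') : Prop where
  row_comp : ∀ x y, row x = row y → comp x = comp y
  col_comp : ∀ x y, col x = col y → comp x = comp y
  inj : ∀ x y, row x = row y → col x = col y → x = y
  factor : ∀ g : Perm α, (∀ x, comp (g x) = comp x) →
    (∃ σ ∈ fixers row, ∃ τ ∈ fixers col, g = σ * τ) ∨
      ∃ a b, a ≠ b ∧ col a = col b ∧ row (g a) = row (g b)

/-- The constant `c` with `E * E = c • E` for a Young symmetrizer `E`. -/
def youngConst (row : α → A) (col : α → A') : ℂ := (youngElt row col * youngElt row col).coeff 1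

namespace IsTableau

variable {comp : α → ι}

lemma compSupported_youngElt (ht : IsTableau comp row col) : compSupported comp (youngElt row col) := by
  intro g hg a
  rw [youngElt_coeff] at hg
  obtain ⟨σ, hσ, h1⟩ := Finset.exists_ne_zero_of_sum_ne_zero hg
  obtain ⟨τ, hτ, h2⟩ := Finset.exists_ne_zero_of_sum_ne_zero h1
  have h3 : σ * τ = g := by
    by_contra h; rw [if_neg h] at h2; exact h2 rfl
  rw [← h3, Perm.mul_apply, ht.row_comp _ _ (mem_fixers.1 hσ _),
    ht.col_comp _ _ (mem_fixers.1 hτ _)]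

/-- Von Neumann's lemma. The two equivariances fix all coefficients on products of a row and a
column permutation in terms of the one at 1; on any other permutation preserving the components,
`factor` provides a transposition that forces the coefficient to be its own negative. -/
lemma eq_smul_youngElt (ht : IsTableau comp row col) {z : MonoidAlgebra ℂ (Perm α)} (hz : compSupported comp z)
    (hl : ∀ σ ∈ fixers row, ∀ x, z.coeff (σ * x) = z.coeff x)
    (hr : ∀ τ ∈ fixers col, ∀ x, z.coeff (x * τ) = csign τ * z.coeff x) :
    z = z.coeff 1 • youngElt row col := by
  have key : ∀ y : MonoidAlgebra ℂ (Perm α),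
      (∀ σ ∈ fixers row, ∀ x, y.coeff (σ * x) = y.coeff x) →
      (∀ τ ∈ fixers col, ∀ x, y.coeff (x * τ) = csign τ * y.coeff x) →
      ∀ (g : Perm α) (a b : α), a ≠ b → col a = col b → row (g a) = row (g b) →
        y.coeff g = 0 := by
    intro y hl hr g a b hab hc hrow
    have h1 := hl _ (swap_mem_fixers hrow) g
    -- A row transposition on the left of `g` is a column transposition on its right, so invariance
    -- and sign give y(g) = -y(g).
    have h2 : swap (g a) (g b) * g = g * swap a b := by
      rw [swap_apply_apply]; simp
    rw [h2, hr _ (swap_mem_fixers hc), csign_swap hab] at h1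
    linear_combination (-1 / 2 : ℂ) * h1
  ext g
  rw [MonoidAlgebra.coeff_smul_apply, smul_eq_mul]
  by_cases hg : ∀ x, comp (g x) = comp x
  · rcases ht.factor g hg with ⟨σ, hσ, τ, hτ, rfl⟩ | ⟨a, b, hab, hc, hrow⟩
    · rw [hl σ hσ, youngElt_coeff_mul_left hσ]
      have h1 := hr τ hτ 1
      have h2 := youngElt_coeff_mul_right (row := row) hτ 1
      rw [one_mul] at h1 h2
      rw [h1, h2, youngElt_coeff_one ht.inj]
      ring
    · rw [key z hl hr g a b hab hc hrow,
        key _ (fun σ hσ x => youngElt_coeff_mul_left hσ x)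
          (fun τ hτ x => youngElt_coeff_mul_right hτ x) g a b hab hc hrow, mul_zero]
  · have h1 : z.coeff g = 0 := by by_contra h; exact hg (hz g h)
    have h2 : (youngElt row col).coeff g = 0 := by
      by_contra h; exact hg (ht.compSupported_youngElt g h)
    rw [h1, h2, mul_zero]

/-- The left factor gives row invariance and the right factor gives the sign under columns, so
`eq_smul_youngElt` applies. -/
lemma youngElt_mul_mul (ht : IsTableau comp row col) {y : MonoidAlgebra ℂ (Perm α)} (hy : compSupported comp y) :
    youngElt row col * y * youngElt row col =
      (youngElt row col * y * youngElt row col).coeff 1 • youngElt row col := by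
  refine ht.eq_smul_youngElt ((ht.compSupported_youngElt.mul hy).mul ht.compSupported_youngElt)
    (fun σ hσ x => ?_) fun τ hτ x => ?_
  · have h := congrArg (fun z => (z * y * youngElt row col).coeff (σ * x))
      (single_mul_youngElt (col := col) hσ)
    simp only [mul_assoc] at h ⊢
    rw [MonoidAlgebra.coeff_single_mul_mul, one_mul] at h
    exact h.symm
  · have h := congrArg (fun z => (youngElt row col * y * z).coeff (x * τ))
      (youngElt_mul_single (row := row) hτ)
    simp only [← mul_assoc] at h
    rw [MonoidAlgebra.coeff_mul_single_mul, mul_one, mul_smul_comm,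
      MonoidAlgebra.coeff_smul_apply, smul_eq_mul] at h
    rw [h, ← mul_assoc, csign_mul_self, one_mul]

lemma youngElt_mul_self (ht : IsTableau comp row col) :
    youngElt row col * youngElt row col = youngConst row col • youngElt row col := by
  have h := ht.youngElt_mul_mul (y := 1) (compSupported_single (fun _ => rfl) 1)
  rwa [mul_one] at h

/-- If the constant vanished, right multiplication by the symmetrizer would be nilpotent, with trace
0; but its coefficient at 1 is 1, so the trace is the order of the group. -/
lemma youngConst_ne_zero (ht : IsTableau comp row col) : youngConst row col ≠ 0 := by
  intro h0
  have hE : youngElt row col * youngElt row col = 0 := by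
    rw [ht.youngElt_mul_self, h0, zero_smul]
  have hnil : IsNilpotent (LinearMap.mulRight ℂ (youngElt row col)) :=
    ⟨2, by rw [LinearMap.pow_mulRight, sq, hE, LinearMap.mulRight_zero_eq_zero]⟩
  have h1 := (LinearMap.isNilpotent_trace_of_isNilpotent hnil).eq_zero
  rw [trace_eq_sum_coeff] at h1
  simp only [LinearMap.mulRight_apply, MonoidAlgebra.coeff_single_mul_apply, inv_mul_cancel,
    youngElt_coeff_one ht.inj, Finset.sum_const, Finset.card_univ, nsmul_eq_mul,
    mul_one] at h1
  exact Fintype.card_ne_zero (Nat.cast_eq_zero.1 h1)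

open Classical in
-- The sum is the Hall norm of the symmetrizer E. Since E g⁻¹ E is a multiple of E, the term of g
-- equals the coefficient at 1 of E · E(g⁻¹)g⁻¹ · E; summing over g gives E³ = c² E.
lemma sum_conj_mul_coeff_one (ht : IsTableau comp row col) :
    (∑ g : Perm α, if ∀ x, comp (g x) = comp x then
      (MonoidAlgebra.single g 1 * youngElt row col * MonoidAlgebra.single g⁻¹ 1 *
        youngElt row col).coeff 1 else 0) = youngConst row col ^ 2 := by
  have h1 : ∀ g : Perm α, (if ∀ x, comp (g x) = comp x then
      (MonoidAlgebra.single g 1 * youngElt row col * MonoidAlgebra.single g⁻¹ 1 *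
        youngElt row col).coeff 1 else 0) =
      (youngElt row col * MonoidAlgebra.single g⁻¹ ((youngElt row col).coeff g⁻¹) *
        youngElt row col).coeff 1 := by
    intro g
    have hs : MonoidAlgebra.single g⁻¹ ((youngElt row col).coeff g⁻¹) =
        (youngElt row col).coeff g⁻¹ • MonoidAlgebra.single g⁻¹ (1 : ℂ) := by simp
    rw [hs, mul_smul_comm, smul_mul_assoc, MonoidAlgebra.coeff_smul_apply, smul_eq_mul]
    split_ifs with hg
    · have hg' : ∀ x, comp (g⁻¹ x) = comp x := fun x => by
        rw [← hg (g⁻¹ x), ← Perm.mul_apply, mul_inv_cancel, Perm.one_apply]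
      rw [mul_assoc, mul_assoc, MonoidAlgebra.coeff_single_mul_apply, one_mul, mul_one,
        ← mul_assoc, ht.youngElt_mul_mul (compSupported_single hg' 1),
        MonoidAlgebra.coeff_smul_apply, MonoidAlgebra.coeff_smul_apply, youngElt_coeff_one ht.inj,
        smul_eq_mul, smul_eq_mul, mul_one, mul_comm]
    · have : (youngElt row col).coeff g⁻¹ = 0 := by
        by_contra h
        refine hg fun x => ?_
        have := ht.compSupported_youngElt _ h (g x)
        rw [← Perm.mul_apply, inv_mul_cancel, Perm.one_apply] at this
        exact this.symm
      rw [this, zero_mul]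
  have hinv : ∑ g : Perm α, MonoidAlgebra.single g⁻¹ ((youngElt row col).coeff g⁻¹) =
      youngElt row col := by
    conv_rhs => rw [eq_sum_single (youngElt row col)]
    exact Fintype.sum_equiv (Equiv.inv (Perm α)) _ _ fun _ => rfl
  rw [Finset.sum_congr rfl fun g _ => h1 g,
    ← Finsupp.finsetSum_apply, ← MonoidAlgebra.coeff_sum, ← Finset.sum_mul, ← Finset.mul_sum,
    hinv,
    ht.youngElt_mul_self, smul_mul_assoc, ht.youngElt_mul_self, MonoidAlgebra.coeff_smul_apply,
    MonoidAlgebra.coeff_smul_apply, youngElt_coeff_one ht.inj, smul_eq_mul, smul_eq_mul, mul_one,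
    sq]

end IsTableau

/-- Young symmetrizers multiply to zero if two boxes of one column lie in one row. -/
lemma youngElt_mul_youngElt_eq_zero {B B' : Type} {row : α → A} {col : α → A'} {row' : α → B}
    {col' : α → B'} {a b : α} (hab : a ≠ b) (hc : col a = col b) (hr : row' a = row' b) :
    youngElt row col * youngElt row' col' = 0 := by
  have h1 : youngElt row col * MonoidAlgebra.single (swap a b) 1 * youngElt row' col' =
      youngElt row col * youngElt row' col' := by
    rw [mul_assoc, single_mul_youngElt (swap_mem_fixers hr)]
  rw [youngElt_mul_single (swap_mem_fixers hc), csign_swap hab, neg_one_smul, neg_mul] at h1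
  ext x
  have h2 := congrArg (fun z => z.coeff x) h1
  simp only [MonoidAlgebra.coeff_neg, Finsupp.neg_apply] at h2
  simp only [MonoidAlgebra.coeff_zero, Finsupp.zero_apply]
  linear_combination (-1 / 2 : ℂ) * h2

end Tableau

/-! ## Symmetric functions of abstract tableaux -/

section TabSym

open Equiv

variable {α β : Type} [Fintype α] [DecidableEq α] [Fintype β] [DecidableEq β] {l : ℕ}
  {A A' B B' : Type}

lemma permPow_eq_of_intertwine {σ : Perm α} {π : Perm β} {comp : α → Fin l} {comp' : β → Fin l}
    (g : α ≃ β) (hg : ∀ x, g (σ x) = π (g x)) (hc : ∀ x, comp' (g x) = comp x)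
    (hπ : ∀ x, comp' (π x) = comp' x) : permPow comp σ = permPow comp' π := by
  classical
  refine Fintype.prod_equiv (orbEquiv g hg) _ _ fun o => ?_
  rw [orbSize_orbEquiv]
  congr 2
  rw [← hc o.out, ← apply_orbMk_out hπ (g o.out), ← orbEquiv_mk g hg, orbMk_out]

lemma permPow_inv {comp : α → Fin l} {π : Perm α} (hπ : ∀ x, comp (π x) = comp x) :
    permPow comp π⁻¹ = permPow comp π := by
  classical
  let e : Orb π⁻¹ ≃ Orb π := Quotient.congr (Equiv.refl α) fun x y => Perm.sameCycle_inv
  have he : ∀ x, e (orbMk π⁻¹ x) = orbMk π x := fun x => rfl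
  refine Fintype.prod_equiv e _ _ fun o => ?_
  have h1 : orbSize (e o) = orbSize o := by
    refine (Finset.card_equiv (Equiv.refl α) fun x => ?_).symm
    simp only [Finset.mem_filter, Finset.mem_univ, true_and, Equiv.refl_apply]
    rw [← he, e.injective.eq_iff]
  rw [h1]
  congr 2
  rw [← apply_orbMk_out hπ o.out, ← he, orbMk_out]

/-- The symmetric function `∑ E_π p_π` attached to a Young symmetrizer `E`. -/
def tabSym (comp : α → Fin l) (row : α → A) (col : α → A') : MultiSym l :=
  ∑ π : Perm α, (RatFunc.C ((youngElt row col).coeff π) : Kt) • permPow comp π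

/-- The normalized symmetric function of a tableau. -/
def tabSchur (comp : α → Fin l) (row : α → A) (col : α → A') : MultiSym l :=
  (RatFunc.C (youngConst row col) : Kt)⁻¹ • tabSym comp row col

lemma youngElt_comp_equiv (g : α ≃ β) (row : α → A) (col : α → A') (π : Perm α) :
    (youngElt (row ∘ g.symm) (col ∘ g.symm)).coeff (g.permCongr π) =
      (youngElt row col).coeff π := by
  classical
  rw [youngElt_coeff, youngElt_coeff]
  have hf : ∀ {C : Type} (f : α → C) (σ : Perm α),
      σ ∈ fixers f ↔ g.permCongr σ ∈ fixers (f ∘ g.symm) := by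
    intro C f σ
    rw [mem_fixers, mem_fixers]
    refine ⟨fun h x => by simp [h], fun h x => by simpa using h (g x)⟩
  have hsum : ∀ {C M : Type} [AddCommMonoid M] (f : α → C) (F : Perm β → M),
      ∑ σ ∈ fixers (f ∘ g.symm), F σ = ∑ σ ∈ fixers f, F (g.permCongr σ) := by
    intro C M _ f F
    exact (Finset.sum_equiv g.permCongr (fun σ => hf f σ) fun _ _ => rfl).symm
  rw [hsum]
  refine Finset.sum_congr rfl fun σ _ => ?_
  rw [hsum]
  refine Finset.sum_congr rfl fun τ _ => ?_
  have h1 : g.permCongr σ * g.permCongr τ = g.permCongr (σ * τ) := by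
    ext x; simp
  simp only [h1, g.permCongr.injective.eq_iff, csign, Perm.sign_permCongr]

lemma youngConst_comp_equiv (g : α ≃ β) (row : α → A) (col : α → A') :
    youngConst (row ∘ g.symm) (col ∘ g.symm) = youngConst row col := by
  rw [youngConst, youngConst, coeff_mul_eq_sum, coeff_mul_eq_sum,
    ← Equiv.sum_comp g.permCongr]
  refine Finset.sum_congr rfl fun π _ => ?_
  have h1 : 1 * (g.permCongr π)⁻¹ = g.permCongr (1 * π⁻¹) := by
    rw [one_mul, one_mul]; ext x; simp [Perm.inv_def]; rfl
  rw [h1, youngElt_comp_equiv, youngElt_comp_equiv]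

lemma tabSym_comp_equiv (g : α ≃ β) {comp : α → Fin l} {row : α → A} {col : α → A'}
    (ht : compSupported comp (youngElt row col)) :
    tabSym (comp ∘ g.symm) (row ∘ g.symm) (col ∘ g.symm) = tabSym comp row col := by
  rw [tabSym, tabSym, ← Equiv.sum_comp g.permCongr]
  refine Finset.sum_congr rfl fun π _ => ?_
  rw [youngElt_comp_equiv]
  by_cases h : (youngElt row col).coeff π = 0
  · rw [h, map_zero, zero_smul, zero_smul]
  · rw [permPow_eq_of_intertwine (σ := π) (π := g.permCongr π) (comp' := comp ∘ g.symm) g]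
    · intro x; simp
    · intro x; simp
    · intro x
      have := ht π h (g.symm x)
      simpa using this

lemma tabSchur_comp_equiv (g : α ≃ β) {comp : α → Fin l} {row : α → A} {col : α → A'}
    (ht : compSupported comp (youngElt row col)) :
    tabSchur (comp ∘ g.symm) (row ∘ g.symm) (col ∘ g.symm) = tabSchur comp row col := by
  rw [tabSchur, tabSchur, tabSym_comp_equiv g ht, youngConst_comp_equiv]

open Classical in
/-- The Hall pairing of the symmetric functions of two tableaux on the same boxes. -/
lemma hallForm_tabSym {comp comp' : α → Fin l} {row : α → A} {col : α → A'} {row' : α → B}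
    {col' : α → B'} (ht : compSupported comp (youngElt row col))
    (ht' : compSupported comp' (youngElt row' col')) :
    hallForm l (tabSym comp row col) (tabSym comp' row' col') =
      RatFunc.C (∑ g : Perm α, if ∀ x, comp' (g x) = comp x then
        (MonoidAlgebra.single g 1 * youngElt row col * MonoidAlgebra.single g⁻¹ 1 *
          youngElt row' col').coeff 1 else 0) := by
  have h1 : ∀ g : Perm α, (MonoidAlgebra.single g 1 * youngElt row col *
      MonoidAlgebra.single g⁻¹ 1 * youngElt row' col').coeff 1 =
      ∑ π' : Perm α, (youngElt row col).coeff (g⁻¹ * π'⁻¹ * g) * (youngElt row' col').coeff π' := by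
    intro g
    rw [coeff_mul_eq_sum]
    refine Finset.sum_congr rfl fun π' _ => ?_
    rw [MonoidAlgebra.coeff_mul_single_apply, MonoidAlgebra.coeff_single_mul_apply, one_mul,
      one_mul, mul_one, inv_inv, mul_assoc]
  have h2 : ∀ π π' : Perm α, (RatFunc.C ((youngElt row col).coeff π) : Kt) *
      (RatFunc.C ((youngElt row' col').coeff π') *
        hallForm l (permPow comp π) (permPow comp' π')) =
      RatFunc.C (∑ g : Perm α, if ∀ x, comp' (g x) = comp x then
        (if π = g⁻¹ * π'⁻¹ * g then
          (youngElt row col).coeff π * (youngElt row' col').coeff π' else 0) else 0) := by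
    intro π π'
    by_cases hπ : (youngElt row col).coeff π = 0
    · simp [hπ]
    by_cases hπ' : (youngElt row' col').coeff π' = 0
    · simp [hπ']
    have hinv : ∀ x, comp' (π'⁻¹ x) = comp' x := fun x => by
      rw [← ht' π' hπ' (π'⁻¹ x), ← Perm.mul_apply, mul_inv_cancel, Perm.one_apply]
    -- Inverting π' does not change its power sum, and it turns the count of conjugations into the
    -- coefficient at 1 of a product.
    rw [← permPow_inv (ht' π' hπ'), hallForm_permPow_permPow _ _ _ _ (ht π hπ) hinv, map_sum,
      Finset.mul_sum, Finset.mul_sum]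
    refine Finset.sum_congr rfl fun g _ => ?_
    have h3 : (∀ x, g (π x) = π'⁻¹ (g x)) ↔ π = g⁻¹ * π'⁻¹ * g := by
      rw [mul_assoc, eq_inv_mul_iff_mul_eq]
      exact ⟨fun h => Equiv.ext h, fun h x => congrArg (fun f : Perm α => f x) h⟩
    simp only [h3]
    by_cases h4 : ∀ x, comp' (g x) = comp x
    · rw [if_pos h4]
      by_cases h5 : π = g⁻¹ * π'⁻¹ * g
      · rw [if_pos ⟨h4, h5⟩, if_pos h5, map_mul, mul_one]
      · rw [if_neg fun h => h5 h.2, if_neg h5, map_zero, mul_zero, mul_zero]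
    · rw [if_neg h4, if_neg fun h => h4 h.1, map_zero, mul_zero, mul_zero]
  have h5 : hallForm l (tabSym comp row col) (tabSym comp' row' col') =
      ∑ π : Perm α, ∑ π' : Perm α, (RatFunc.C ((youngElt row col).coeff π) : Kt) *
      (RatFunc.C ((youngElt row' col').coeff π') *
        hallForm l (permPow comp π) (permPow comp' π')) := by
    rw [tabSym, LinearMap.map_sum₂]
    refine Finset.sum_congr rfl fun π _ => ?_
    rw [LinearMap.map_smul₂, tabSym, map_sum, smul_eq_mul, Finset.mul_sum]
    refine Finset.sum_congr rfl fun π' _ => ?_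
    rw [map_smul, smul_eq_mul]
  rw [h5]
  simp only [h2, ← map_sum]
  congr 1
  rw [Finset.sum_comm]
  simp only [h1]
  have h6 : ∀ π' : Perm α, ∑ π : Perm α, ∑ g : Perm α, (if ∀ x, comp' (g x) = comp x then
        (if π = g⁻¹ * π'⁻¹ * g then
          (youngElt row col).coeff π * (youngElt row' col').coeff π' else 0) else 0) =
      ∑ g : Perm α, if ∀ x, comp' (g x) = comp x then
        (youngElt row col).coeff (g⁻¹ * π'⁻¹ * g) * (youngElt row' col').coeff π' else 0 := by
    intro π'
    rw [Finset.sum_comm]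
    refine Finset.sum_congr rfl fun g _ => ?_
    split_ifs with h
    · rw [Finset.sum_ite_eq' Finset.univ (g⁻¹ * π'⁻¹ * g), if_pos (Finset.mem_univ _)]
    · exact Finset.sum_const_zero
  rw [Finset.sum_congr rfl fun π' _ => h6 π', Finset.sum_comm]
  refine Finset.sum_congr rfl fun g _ => ?_
  split_ifs with h
  · rfl
  · exact Finset.sum_const_zero

/-- The norm of the unnormalized function is c² by `sum_conj_mul_coeff_one`, and the normalization
divides by c twice. -/
lemma IsTableau.hallForm_tabSchur_self {comp : α → Fin l} {row : α → A} {col : α → A'}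
    (ht : IsTableau comp row col) :
    hallForm l (tabSchur comp row col) (tabSchur comp row col) = 1 := by
  have h0 : (RatFunc.C (youngConst row col) : Kt) ≠ 0 := by
    rw [Ne, map_eq_zero]; exact ht.youngConst_ne_zero
  rw [tabSchur, map_smul, map_smul, LinearMap.smul_apply,
    hallForm_tabSym ht.compSupported_youngElt ht.compSupported_youngElt,
    show (∑ g : Perm α, _) = _ from (by convert ht.sum_conj_mul_coeff_one), map_pow, smul_eq_mul,
    smul_eq_mul]
  field_simp

/-- Conjugating by `g` moves the first tableau, and the hypothesis puts two boxes of one of its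
columns into one row of the second, so every product of symmetrizers in the pairing vanishes. -/
lemma hallForm_tabSchur_eq_zero {comp comp' : α → Fin l} {row : α → A} {col : α → A'}
    {row' : α → B} {col' : α → B'} (ht : IsTableau comp row col) (ht' : IsTableau comp' row' col')
    (h : ∀ g : Perm α, (∀ x, comp' (g x) = comp x) →
      ∃ a b, a ≠ b ∧ col a = col b ∧ row' (g a) = row' (g b)) :
    hallForm l (tabSchur comp row col) (tabSchur comp' row' col') = 0 := by
  classical
  rw [tabSchur, tabSchur, map_smul, map_smul, LinearMap.smul_apply,
    hallForm_tabSym ht.compSupported_youngElt ht'.compSupported_youngElt, Finset.sum_eq_zero,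
    map_zero, smul_zero, smul_zero]
  intro g _
  split_ifs with hg
  swap
  · rfl
  obtain ⟨a, b, hab, hc, hr⟩ := h g hg
  have h1 : MonoidAlgebra.single g 1 * youngElt row col * MonoidAlgebra.single g⁻¹ 1 =
      youngElt (row ∘ g.symm) (col ∘ g.symm) := by
    ext x
    rw [MonoidAlgebra.coeff_mul_single_apply, MonoidAlgebra.coeff_single_mul_apply, one_mul,
      mul_one, ← youngElt_comp_equiv g row col]
    congr 1
    ext y
    simp [Perm.inv_def]
  rw [h1, youngElt_mul_youngElt_eq_zero (a := g a) (b := g b) (by simpa using hab) (by simpa)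
    (by simpa)]
  rfl

end TabSym

/-! ## Boxes of Young diagrams -/

section Cells

open Equiv

variable {n : ℕ}

lemma rows_pairwise (lam : n.Partition) : (rows lam).Pairwise (· ≥ ·) :=
  Multiset.pairwise_sort _ _

lemma coe_rows (lam : n.Partition) : ((rows lam : List ℕ) : Multiset ℕ) = lam.parts :=
  Multiset.sort_eq _ _

/-- In a weakly decreasing list the entries exceeding `j` form an initial segment. -/
lemma getD_lt_iff_countP (j : ℕ) : ∀ (L : List ℕ), L.Pairwise (· ≥ ·) → ∀ i : ℕ,
    j < L.getD i 0 ↔ i < L.countP (fun r => j < r)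
  | [], _, i => by simp
  | a :: L, h, i => by
    rw [List.pairwise_cons] at h
    have ih := getD_lt_iff_countP j L h.2
    by_cases ha : j < a
    · rw [List.countP_cons_of_pos (by simpa using ha)]
      cases i with
      | zero => simpa using ha
      | succ i => rw [List.getD_cons_succ, ih i]; omega
    · have h0 : L.countP (fun r => j < r) = 0 := by
        rw [List.countP_eq_zero]
        intro b hb
        have := h.1 b hb
        simp only [decide_eq_true_eq]
        omega
      rw [List.countP_cons_of_neg (by simpa using ha), h0]
      cases i with
      | zero => simpa using ha
      | succ i => rw [List.getD_cons_succ, ih i, h0]; omega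

lemma lt_row_iff {lam : n.Partition} {i j : ℕ} : j < row lam i ↔ i < col lam j := by
  rw [row, getD_lt_iff_countP j _ (rows_pairwise lam), col, ← coe_rows, Multiset.filter_coe,
    Multiset.coe_card, List.countP_eq_length_filter]

/-- The row of a box. -/
def cellRow {lam : n.Partition} (s : Cell lam) : ℕ := s.1

/-- The column of a box. -/
def cellCol {lam : n.Partition} (s : Cell lam) : ℕ := s.2

lemma row_of_lt {lam : n.Partition} (i : Fin (rows lam).length) :
    row lam i = (rows lam).get i := by
  rw [row, List.getD_eq_getElem _ _ i.2]; rfl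

lemma cellCol_lt {lam : n.Partition} (s : Cell lam) : cellCol s < row lam (cellRow s) := by
  rw [cellRow, row_of_lt]; exact s.2.2

lemma cellRow_lt {lam : n.Partition} (s : Cell lam) : cellRow s < col lam (cellCol s) :=
  lt_row_iff.1 (cellCol_lt s)

lemma cell_ext {lam : n.Partition} {s s' : Cell lam} (h1 : cellRow s = cellRow s')
    (h2 : cellCol s = cellCol s') : s = s' := by
  obtain ⟨i, j⟩ := s
  obtain ⟨i', j'⟩ := s'
  obtain rfl : i = i' := Fin.ext h1
  obtain rfl : j = j' := Fin.ext h2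
  rfl

lemma exists_cell {lam : n.Partition} {i j : ℕ} (h : j < row lam i) :
    ∃ s : Cell lam, cellRow s = i ∧ cellCol s = j := by
  have hi : i < (rows lam).length := by
    by_contra hi
    rw [row, List.getD_eq_default _ _ (not_lt.1 hi)] at h
    exact absurd h (Nat.not_lt_zero _)
  refine ⟨⟨⟨i, hi⟩, ⟨j, ?_⟩⟩, rfl, rfl⟩
  have := row_of_lt (lam := lam) ⟨i, hi⟩
  rwa [← this]

lemma card_cellRow_eq (lam : n.Partition) (i : ℕ) :
    Finset.card {s : Cell lam | cellRow s = i} = row lam i := by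
  rw [← Finset.card_range (row lam i)]
  refine Finset.card_bij (fun s _ => cellCol s) ?_ ?_ ?_
  · intro s hs
    rw [Finset.mem_filter] at hs
    rw [Finset.mem_range, ← hs.2]
    exact cellCol_lt s
  · intro s hs s' hs' h
    rw [Finset.mem_filter] at hs hs'
    exact cell_ext (hs.2.trans hs'.2.symm) h
  · intro j hj
    obtain ⟨s, h1, h2⟩ := exists_cell (Finset.mem_range.1 hj)
    exact ⟨s, by simp [h1], h2⟩

lemma card_column_cellRow_lt (lam : n.Partition) (j k : ℕ) :
    Finset.card {s : Cell lam | cellCol s = j ∧ cellRow s < k} = min k (col lam j) := by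
  rw [← Finset.card_range (min k (col lam j))]
  refine Finset.card_bij (fun s _ => cellRow s) ?_ ?_ ?_
  · intro s hs
    rw [Finset.mem_filter] at hs
    rw [Finset.mem_range, lt_min_iff, ← hs.2.1]
    exact ⟨hs.2.2, cellRow_lt s⟩
  · intro s hs s' hs' h
    rw [Finset.mem_filter] at hs hs'
    exact cell_ext h (hs.2.1.trans hs'.2.1.symm)
  · intro i hi
    rw [Finset.mem_range, lt_min_iff] at hi
    obtain ⟨s, h1, h2⟩ := exists_cell (lt_row_iff.2 hi.2)
    exact ⟨s, by simp [h1, h2, hi.1], h1⟩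

lemma sum_take_rows (lam : n.Partition) (k : ℕ) :
    ((rows lam).take k).sum = ∑ i ∈ Finset.range k, row lam i := by
  have h : ∀ (L : List ℕ) (k : ℕ), (L.take k).sum = ∑ i ∈ Finset.range k, L.getD i 0 := by
    intro L
    induction L with
    | nil => simp
    | cons a L ih =>
      intro k
      cases k with
      | zero => simp
      | succ k =>
        rw [List.take_succ_cons, List.sum_cons, ih, Finset.sum_range_succ', add_comm]
        simp
  exact h _ _

lemma card_cellRow_lt (lam : n.Partition) (k : ℕ) :
    Finset.card {s : Cell lam | cellRow s < k} = ((rows lam).take k).sum := by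
  rw [sum_take_rows, Finset.card_eq_sum_card_fiberwise (f := cellRow) (t := Finset.range k)]
  · refine Finset.sum_congr rfl fun i hi => ?_
    rw [← card_cellRow_eq, Finset.filter_filter]
    congr 1
    ext s
    simp only [Finset.mem_filter, Finset.mem_univ, true_and, and_iff_right_iff_imp]
    rintro rfl
    exact Finset.mem_range.1 hi
  · intro s hs
    simpa using hs

/-- A function on the boxes that is injective on columns. -/
def ColInjective {A : Type} {lam : n.Partition} (f : Cell lam → A) : Prop :=
  ∀ s s', cellCol s = cellCol s' → f s = f s' → s = s'

/-- Injectivity on the column bounds the count both by the number k of available values and by the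
height of the column, and the row function attains the minimum of the two. -/
lemma card_column_lt_le {lam : n.Partition} {f : Cell lam → ℕ} (hf : ColInjective f) (j k : ℕ) :
    Finset.card {s : Cell lam | cellCol s = j ∧ f s < k} ≤
      Finset.card {s : Cell lam | cellCol s = j ∧ cellRow s < k} := by
  rw [card_column_cellRow_lt, le_min_iff]
  constructor
  · rw [← Finset.card_range k]
    refine Finset.card_le_card_of_injOn f (fun s hs => by
      simpa using ((Finset.mem_filter.1 hs).2).2) ?_
    intro s hs s' hs' h
    exact hf s s' ((Finset.mem_filter.1 hs).2.1.trans (Finset.mem_filter.1 hs').2.1.symm) h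
  · rw [← Finset.card_range (col lam j)]
    refine Finset.card_le_card_of_injOn cellRow (fun s hs => ?_) ?_
    · rw [Finset.coe_range, Set.mem_Iio, ← (Finset.mem_filter.1 hs).2.1]
      exact cellRow_lt s
    · intro s hs s' hs' h
      exact cell_ext h ((Finset.mem_filter.1 hs).2.1.trans (Finset.mem_filter.1 hs').2.1.symm)

lemma card_lt_eq_sum {lam : n.Partition} (f : Cell lam → ℕ) (k : ℕ) :
    Finset.card {s : Cell lam | f s < k} = ∑ j ∈ Finset.univ.image (cellCol (lam := lam)),
      Finset.card {s : Cell lam | cellCol s = j ∧ f s < k} := by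
  rw [Finset.card_eq_sum_card_fiberwise (f := cellCol)
    (t := Finset.univ.image (cellCol (lam := lam)))]
  · refine Finset.sum_congr rfl fun j _ => ?_
    rw [Finset.filter_filter]
    congr 1
    ext s
    simp [and_comm]
  · intro s _
    simp

/-- Sum of the bounds over the columns. All dominance statements below come from this inequality. -/
lemma card_lt_le {lam : n.Partition} {f : Cell lam → ℕ} (hf : ColInjective f) (k : ℕ) :
    Finset.card {s : Cell lam | f s < k} ≤ ((rows lam).take k).sum := by
  rw [← card_cellRow_lt, card_lt_eq_sum, card_lt_eq_sum]
  exact Finset.sum_le_sum fun j _ => card_column_lt_le hf j k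

/-- Equality of the totals forces equality in each column. Taking k to be the height of the column
of `s`, every box of that column has a value below k. -/
lemma lt_col_of_card_eq {lam : n.Partition} {f : Cell lam → ℕ} (hf : ColInjective f)
    (h : ∀ k, Finset.card {s : Cell lam | f s < k} = ((rows lam).take k).sum) (s : Cell lam) :
    f s < col lam (cellCol s) := by
  have h1 := h (col lam (cellCol s))
  rw [← card_cellRow_lt, card_lt_eq_sum, card_lt_eq_sum,
    Finset.sum_eq_sum_iff_of_le fun j _ => card_column_lt_le hf j _] at h1
  have h2 := h1 (cellCol s) (by simp)
  have h3 : Finset.filter (fun s' : Cell lam => cellCol s' = cellCol s ∧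
      cellRow s' < col lam (cellCol s)) Finset.univ =
      Finset.filter (fun s' : Cell lam => cellCol s' = cellCol s) Finset.univ := by
    ext s'
    simp only [Finset.mem_filter, Finset.mem_univ, true_and, and_iff_left_iff_imp]
    intro hs
    rw [← hs]
    exact cellRow_lt s'
  rw [h3] at h2
  have h4 : Finset.filter (fun s' : Cell lam => cellCol s' = cellCol s ∧
      f s' < col lam (cellCol s)) Finset.univ =
      Finset.filter (fun s' : Cell lam => cellCol s' = cellCol s) Finset.univ :=
    Finset.eq_of_subset_of_card_le (fun s' hs' => by
      simp only [Finset.mem_filter, Finset.mem_univ, true_and] at hs' ⊢; exact hs'.1) h2.ge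
  have h5 : s ∈ Finset.filter (fun s' : Cell lam => cellCol s' = cellCol s) Finset.univ := by simp
  rw [← h4] at h5
  exact (Finset.mem_filter.1 h5).2.2

/-- By the previous bound, the box in row `f s` of the column of `s` exists; sending `s` to it is
injective, hence a column permutation. -/
lemma exists_fixers_of_card_eq {lam : n.Partition} {f : Cell lam → ℕ} (hf : ColInjective f)
    (h : ∀ k, Finset.card {s : Cell lam | f s < k} = ((rows lam).take k).sum) :
    ∃ τ ∈ fixers (cellCol (lam := lam)), ∀ s, cellRow (τ s) = f s := by
  have h1 : ∀ s : Cell lam, ∃ s' : Cell lam, cellRow s' = f s ∧ cellCol s' = cellCol s := fun s =>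
    exists_cell (lt_row_iff.2 (lt_col_of_card_eq hf h s))
  choose τ h2 h3 using h1
  have hinj : Function.Injective τ := by
    intro s s' hs
    refine hf s s' ?_ ?_
    · rw [← h3, ← h3 s', hs]
    · rw [← h2, ← h2 s', hs]
  exact ⟨Equiv.ofBijective τ (Finite.injective_iff_bijective.1 hinj), mem_fixers.2 h3, h2⟩

lemma card_comp_equiv_lt {lam : n.Partition} {β : Type} [Fintype β] (g : β ≃ Cell lam) (k : ℕ) :
    Finset.card {s : β | cellRow (g s) < k} = ((rows lam).take k).sum := by
  rw [← card_cellRow_lt]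
  exact Finset.card_equiv g fun s => by simp

/-- The boxes of a Young diagram form a tableau. -/
lemma isTableau_cell (lam : n.Partition) :
    IsTableau (fun _ : Cell lam => (0 : Fin 1)) cellRow cellCol where
  row_comp _ _ _ := rfl
  col_comp _ _ _ := rfl
  inj _ _ h1 h2 := cell_ext h1 h2
  factor g _ := by
    -- If `g` separates the rows within each column, its row function is that of a column
    -- permutation τ, and g τ⁻¹ preserves rows.
    by_cases hf : ColInjective (fun s => cellRow (g s))
    · left
      obtain ⟨τ, hτ, h1⟩ := exists_fixers_of_card_eq hf fun k => card_comp_equiv_lt g k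
      refine ⟨g * τ⁻¹, mem_fixers.2 fun s => ?_, τ, hτ, by simp⟩
      have h2 := h1 (τ⁻¹ s)
      rw [← Perm.mul_apply, mul_inv_cancel, Perm.one_apply] at h2
      rw [Perm.mul_apply, h2]
    · right
      simp only [ColInjective, not_forall] at hf
      obtain ⟨s, s', h1, h2, h3⟩ := hf
      exact ⟨s, s', h3, h1, h2⟩

lemma dominated_iff {lam mu : n.Partition} : Dominated lam mu ↔
    ∀ k, ∑ i ∈ Finset.range k, row lam i ≤ ∑ i ∈ Finset.range k, row mu i := by
  simp only [Dominated, sum_take_rows]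

lemma partition_ext_row {lam mu : n.Partition} (h : ∀ i, row lam i = row mu i) : lam = mu := by
  have hlen : ∀ (nu : n.Partition) (i : ℕ), i < (rows nu).length ↔ 0 < row nu i := by
    intro nu i
    constructor
    · intro hi
      have := row_of_lt (lam := nu) ⟨i, hi⟩
      rw [show row nu i = (rows nu).get ⟨i, hi⟩ from this]
      refine nu.parts_pos ?_
      rw [← coe_rows]
      exact List.get_mem _ _
    · intro hi
      obtain ⟨s, h1, _⟩ := exists_cell hi
      rw [← h1]; exact s.1.2
  have hl : (rows lam).length = (rows mu).length := by
    refine le_antisymm ?_ ?_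
    · by_contra hlt
      have := (hlen lam _).1 (not_le.1 hlt)
      rw [h, ← hlen] at this
      exact lt_irrefl _ this
    · by_contra hlt
      have := (hlen mu _).1 (not_le.1 hlt)
      rw [← h, ← hlen] at this
      exact lt_irrefl _ this
  have hr : rows lam = rows mu := by
    refine List.ext_getElem hl fun i h1 h2 => ?_
    have e1 := row_of_lt (lam := lam) ⟨i, h1⟩
    have e2 := row_of_lt (lam := mu) ⟨i, h2⟩
    simp only [List.get_eq_getElem] at e1 e2
    rw [← e1, ← e2, h]
  refine Nat.Partition.ext ?_
  rw [← coe_rows, ← coe_rows, hr]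

lemma Dominated.antisymm {lam mu : n.Partition} (h1 : Dominated lam mu) (h2 : Dominated mu lam) :
    lam = mu := by
  rw [dominated_iff] at h1 h2
  refine partition_ext_row fun i => ?_
  have e1 := le_antisymm (h1 i) (h2 i)
  have e2 := le_antisymm (h1 (i + 1)) (h2 (i + 1))
  rw [Finset.sum_range_succ, Finset.sum_range_succ] at e2
  omega

/-- Pigeonhole: without such a pair, the rows of the images would be injective on columns, and
`card_lt_le` would give dominance. -/
lemma exists_same_column_of_not_dominated {m : ℕ} {lam : n.Partition} {mu : m.Partition}
    (h : ¬ ∀ k : ℕ, ((rows mu).take k).sum ≤ ((rows lam).take k).sum) (g : Cell lam ≃ Cell mu) :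
    ∃ a b : Cell lam, a ≠ b ∧ cellCol a = cellCol b ∧ cellRow (g a) = cellRow (g b) := by
  by_contra hcon
  push Not at hcon
  refine h fun k => ?_
  rw [← card_comp_equiv_lt g k]
  refine card_lt_le (fun a b hc hr => ?_) k
  by_contra hab
  exact hcon a b hab hc hr

end Cells

/-! ### Transport of tableaux along bijections -/

section TransportTableau

open Equiv

variable {α β : Type} [Fintype α] [DecidableEq α] [Fintype β] [DecidableEq β] {A A' ι : Type}

lemma mem_fixers_permCongr (g : α ≃ β) (f : α → A) (σ : Perm α) :
    g.permCongr σ ∈ fixers (f ∘ g.symm) ↔ σ ∈ fixers f := by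
  rw [mem_fixers, mem_fixers]
  exact ⟨fun h x => by simpa using h (g x), fun h x => by simp [h]⟩

lemma IsTableau.comp_equiv {comp : α → ι} {row : α → A} {col : α → A'}
    (ht : IsTableau comp row col) (g : α ≃ β) :
    IsTableau (comp ∘ g.symm) (row ∘ g.symm) (col ∘ g.symm) where
  row_comp _ _ h := ht.row_comp _ _ h
  col_comp _ _ h := ht.col_comp _ _ h
  inj _ _ h1 h2 := g.symm.injective (ht.inj _ _ h1 h2)
  factor x hx := by
    rcases ht.factor (g.symm.permCongr x) (fun a => by simpa using hx (g a)) with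
      ⟨σ, hσ, τ, hτ, h⟩ | ⟨a, b, hab, hc, hr⟩
    · refine Or.inl ⟨g.permCongr σ, (mem_fixers_permCongr g row σ).2 hσ, g.permCongr τ,
        (mem_fixers_permCongr g col τ).2 hτ, ?_⟩
      ext y
      have := congrArg (fun f : Perm α => f (g.symm y)) h
      simp only [permCongr_apply, symm_symm, apply_symm_apply, Perm.mul_apply] at this
      simp [← this]
    · exact Or.inr ⟨g a, g b, by simpa using hab, by simpa using hc, by simpa using hr⟩

end TransportTableau

/-! ### Orthonormality of the symmetric functions of Young diagrams -/

section TypeA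

variable {n : ℕ}

/-- The symmetric function of the Young symmetrizer of a partition. -/
def cellSchur (lam : n.Partition) : Sym1 :=
  tabSchur (fun _ : Cell lam => (0 : Fin 1)) cellRow cellCol

lemma hallForm_cellSchur_self (lam : n.Partition) :
    hallForm 1 (cellSchur lam) (cellSchur lam) = 1 :=
  (isTableau_cell lam).hallForm_tabSchur_self

lemma hallForm_cellSchur_of_not_dominated {lam mu : n.Partition} (h : ¬ Dominated mu lam) :
    hallForm 1 (cellSchur lam) (cellSchur mu) = 0 := by
  let e : Cell mu ≃ Cell lam := Fintype.equivOfCardEq (by rw [card_cell, card_cell])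
  rw [cellSchur, cellSchur,
    ← tabSchur_comp_equiv e (isTableau_cell mu).compSupported_youngElt]
  refine hallForm_tabSchur_eq_zero (isTableau_cell lam) ((isTableau_cell mu).comp_equiv e)
    fun g _ => ?_
  exact exists_same_column_of_not_dominated h (g.trans e.symm)

/-- Dominance is antisymmetric, so for distinct partitions it fails in one direction, and the form
is symmetric. -/
lemma hallForm_cellSchur (lam mu : n.Partition) :
    hallForm 1 (cellSchur lam) (cellSchur mu) = if lam = mu then 1 else 0 := by
  split_ifs with h
  · rw [← h, hallForm_cellSchur_self]
  · by_cases h1 : Dominated mu lam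
    · rw [hallForm, hall_comm]
      exact hallForm_cellSchur_of_not_dominated fun h2 => h (h2.antisymm h1)
    · exact hallForm_cellSchur_of_not_dominated h1

end TypeA

/-! ## Symmetric functions of tableaux in finitely many variables -/

section Evaluation

open Equiv MvPolynomial

variable {α : Type} [Fintype α] {A A' : Type}

/-- The exponent of the monomial `∏ X (f x)`. -/
def content {N : ℕ} (f : α → Fin N) : Fin N →₀ ℕ := ∑ x, Finsupp.single (f x) 1

lemma content_apply {N : ℕ} (f : α → Fin N) (i : Fin N) :
    content f i = Finset.card {x | f x = i} := by
  rw [content, Finsupp.finsetSum_apply, Finset.card_filter]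
  simp [Finsupp.single_apply]

lemma prod_X_eq_monomial {N : ℕ} (f : α → Fin N) :
    ∏ x, (X (f x) : MvPolynomial (Fin N) Kt) = monomial (content f) 1 := by
  rw [content, monomial_sum_one]; rfl

variable [DecidableEq α]

open Classical in
-- Expanding the product of power sums chooses one variable for each cycle, that is, a function
-- constant on cycles.
lemma evalVars_permPow (N : ℕ) (π : Perm α) :
    evalVars N (permPow (fun _ : α => (0 : Fin 1)) π) =
      ∑ f : α → Fin N, if π ∈ fixers f then monomial (content f) 1 else 0 := by
  have h1 : ∀ o : Orb π, evalVars N (X ((0 : Fin 1), (orbSize o).toPNat')) =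
      ∑ i : Fin N, X i ^ orbSize o := by
    intro o
    rw [evalVars, aeval_X, psum]
    simp only [Nat.toPNat'_coe, if_pos (orbSize_pos o)]
  rw [permPow, map_prod, Finset.prod_congr rfl fun o _ => h1 o, Finset.prod_univ_sum,
    Fintype.piFinset_univ, ← Finset.sum_filter]
  refine Finset.sum_bij (fun F _ x => F (orbMk π x)) ?_ ?_ ?_ ?_
  · intro F _
    rw [Finset.mem_filter, mem_fixers]
    exact ⟨Finset.mem_univ _, fun x => by rw [orbMk_apply]⟩
  · intro F _ F' _ h
    funext o
    have := congrFun h o.out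
    simpa only [orbMk_out] using this
  · intro f hf
    rw [Finset.mem_filter, mem_fixers] at hf
    refine ⟨fun o => f o.out, Finset.mem_univ _, ?_⟩
    funext x
    exact apply_orbMk_out hf.2 x
  · intro F _
    rw [← prod_X_eq_monomial, ← Finset.prod_fiberwise Finset.univ (fun x => orbMk π x)]
    refine Finset.prod_congr rfl fun o _ => ?_
    rw [Finset.prod_congr rfl (g := fun _ => (X (F o) : MvPolynomial (Fin N) Kt)),
      Finset.prod_const, orbSize]
    intro x hx
    rw [(Finset.mem_filter.1 hx).2]

open Classical in
/-- The coefficients of the symmetric function of a tableau in finitely many variables. -/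
lemma coeff_evalVars_tabSym (N : ℕ) (row : α → A) (col : α → A') (a : Fin N →₀ ℕ) :
    coeff a (evalVars N (tabSym (fun _ => (0 : Fin 1)) row col)) =
      RatFunc.C (∑ f : α → Fin N, if content f = a then
        ∑ π ∈ fixers f, (youngElt row col).coeff π else 0) := by
  rw [tabSym, map_sum, coeff_sum]
  have h1 : ∀ π : Perm α, coeff a (evalVars N ((RatFunc.C ((youngElt row col).coeff π) : Kt) •
      permPow (fun _ => (0 : Fin 1)) π)) = RatFunc.C (∑ f : α → Fin N,
        if content f = a then (if π ∈ fixers f then (youngElt row col).coeff π else 0) else 0) := by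
    intro π
    rw [map_smul, coeff_smul, evalVars_permPow, coeff_sum, smul_eq_mul, Finset.mul_sum, map_sum]
    refine Finset.sum_congr rfl fun f _ => ?_
    by_cases h : π ∈ fixers f
    · rw [if_pos h, coeff_monomial, if_pos h]
      split_ifs <;> simp
    · rw [if_neg h, if_neg h]
      simp
  rw [Finset.sum_congr rfl fun π _ => h1 π, ← map_sum, Finset.sum_comm]
  congr 1
  refine Finset.sum_congr rfl fun f _ => ?_
  split_ifs
  · rw [Finset.sum_ite_mem, Finset.univ_inter]
  · exact Finset.sum_const_zero

/-- Right multiplication by the transposition of `a` and `b` permutes the stabilizer of `f` and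
negates every coefficient. -/
lemma sum_fixers_youngElt_eq_zero {B : Type} {row : α → A} {col : α → A'} {f : α → B} {a b : α}
    (hab : a ≠ b) (hc : col a = col b) (hf : f a = f b) :
    ∑ π ∈ fixers f, (youngElt row col).coeff π = 0 := by
  have h := sum_fixers_mul_right (swap_mem_fixers hf) fun π => (youngElt row col).coeff π
  simp only [youngElt_coeff_mul_right (swap_mem_fixers hc), csign_swap hab, neg_one_mul,
    Finset.sum_neg_distrib] at h
  linear_combination (-1 / 2 : ℂ) * h

/-- Conjugation by τ carries the stabilizer of `row ∘ τ` to the row group. The result is one summand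
of `youngConst_eq_sum`. -/
lemma sum_fixers_comp_youngElt {row : α → A} {col : α → A'} {τ : Perm α} (hτ : τ ∈ fixers col) :
    ∑ π ∈ fixers (row ∘ τ), (youngElt row col).coeff π =
      ∑ ρ ∈ fixers row, csign τ * (youngElt row col).coeff (τ⁻¹ * ρ) := by
  refine (Finset.sum_bij (fun ρ _ => τ⁻¹ * ρ * τ) ?_ ?_ ?_ ?_).symm
  · intro ρ hρ
    rw [mem_fixers] at hρ ⊢
    intro x
    have := hρ (τ x)
    simpa [Perm.mul_apply] using this
  · intro ρ _ ρ' _ h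
    exact mul_left_cancel (mul_right_cancel h)
  · intro π hπ
    rw [mem_fixers] at hπ
    refine ⟨τ * π * τ⁻¹, mem_fixers.2 fun x => ?_, by group⟩
    have := hπ (τ⁻¹ x)
    simpa [Perm.mul_apply] using this
  · intro ρ _
    rw [youngElt_coeff_mul_right hτ]

lemma youngConst_eq_sum (row : α → A) (col : α → A') :
    youngConst row col = ∑ τ ∈ fixers col, ∑ ρ ∈ fixers row,
      csign τ * (youngElt row col).coeff (τ⁻¹ * ρ) := by
  rw [youngConst, coeff_mul_eq_sum]
  have h1 : ∀ g : Perm α, (youngElt row col).coeff (1 * g⁻¹) * (youngElt row col).coeff g =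
      ∑ σ ∈ fixers row, ∑ τ ∈ fixers col,
        if σ * τ = g then csign τ * (youngElt row col).coeff (τ⁻¹ * σ⁻¹) else 0 := by
    intro g
    conv_lhs => rw [youngElt_coeff row col g]
    rw [Finset.mul_sum]
    refine Finset.sum_congr rfl fun σ _ => ?_
    rw [Finset.mul_sum]
    refine Finset.sum_congr rfl fun τ _ => ?_
    split_ifs with h
    · rw [← h, one_mul, mul_inv_rev, mul_comm]
    · rw [mul_zero]
  rw [Finset.sum_congr rfl fun g _ => h1 g, Finset.sum_comm]
  have h2 : ∀ σ ∈ fixers row, (∑ g : Perm α, ∑ τ ∈ fixers col,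
        if σ * τ = g then csign τ * (youngElt row col).coeff (τ⁻¹ * σ⁻¹) else 0) =
      ∑ τ ∈ fixers col, csign τ * (youngElt row col).coeff (τ⁻¹ * σ⁻¹) := by
    intro σ _
    rw [Finset.sum_comm]
    refine Finset.sum_congr rfl fun τ _ => ?_
    rw [Finset.sum_ite_eq, if_pos (Finset.mem_univ _)]
  rw [Finset.sum_congr rfl h2, Finset.sum_comm]
  refine Finset.sum_congr rfl fun τ _ => ?_
  exact sum_fixers_inv fun ρ => csign τ * (youngElt row col).coeff (τ⁻¹ * ρ)

end Evaluation

/-! ### Leading monomials of the symmetric functions of Young diagrams -/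

section CellSchur

open MvPolynomial Equiv

variable {n : ℕ}

/-- The exponent `x^lam` in `n` variables. -/
def rowExp (lam : n.Partition) : Fin n →₀ ℕ := Finsupp.equivFunOnFinite.symm fun i => row lam i

lemma rowExp_apply (lam : n.Partition) (i : Fin n) : rowExp lam i = row lam i := rfl

/-- The indices below `k`. -/
def below (N k : ℕ) : Finset (Fin N) := Finset.univ.filter fun i => (i : ℕ) < k

lemma mem_below {N k : ℕ} {i : Fin N} : i ∈ below N k ↔ (i : ℕ) < k := by simp [below]

lemma sum_content_lt {α : Type} [Fintype α] {N : ℕ} (f : α → Fin N) (k : ℕ) :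
    ∑ i ∈ below N k, content f i = Finset.card {x | (f x : ℕ) < k} := by
  rw [Finset.card_eq_sum_card_fiberwise (f := f)
    (t := below N k)]
  · refine Finset.sum_congr rfl fun i hi => ?_
    rw [mem_below] at hi
    rw [content_apply, Finset.filter_filter]
    congr 1
    ext x
    simp only [Finset.mem_filter, Finset.mem_univ, true_and] at hi ⊢
    constructor
    · rintro rfl; exact ⟨hi, rfl⟩
    · exact fun h => h.2
  · intro x hx
    simpa [below] using hx

/-- Only fillings that are injective on columns contribute, by `sum_fixers_youngElt_eq_zero`, and
these satisfy `card_lt_le`. -/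
lemma coeff_evalVars_cellSchur_le {N : ℕ} {lam : n.Partition} {a : Fin N →₀ ℕ}
    (h : coeff a (evalVars N (cellSchur lam)) ≠ 0) (k : ℕ) :
    ∑ i ∈ below N k, a i ≤ ((rows lam).take k).sum := by
  classical
  rw [cellSchur, tabSchur, map_smul, coeff_smul, coeff_evalVars_tabSym, smul_eq_mul] at h
  have h1 := right_ne_zero_of_mul h
  rw [Ne, map_eq_zero] at h1
  obtain ⟨f, _, hf⟩ := Finset.exists_ne_zero_of_sum_ne_zero h1
  split_ifs at hf with hc
  · rw [← hc, sum_content_lt]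
    refine card_lt_le (f := fun s => (f s : ℕ)) (fun s s' h2 h3 => ?_) k
    by_contra hne
    exact hf (sum_fixers_youngElt_eq_zero hne h2 (Fin.ext h3))
  · exact (hf rfl).elim

lemma sum_filter_lt_eq_range {N : ℕ} (F : ℕ → ℕ) {k : ℕ} :
    ∑ i ∈ below N k, F i = ∑ i ∈ Finset.range (min k N), F i := by
  refine Finset.sum_bij (fun i _ => (i : ℕ)) ?_ ?_ ?_ ?_
  · intro i hi
    rw [Finset.mem_range, lt_min_iff]
    exact ⟨mem_below.1 hi, i.2⟩
  · exact fun i _ j _ h => Fin.ext h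
  · intro i hi
    rw [Finset.mem_range, lt_min_iff] at hi
    exact ⟨⟨i, hi.2⟩, mem_below.2 hi.1, rfl⟩
  · exact fun _ _ => rfl

lemma cellRow_lt_size {lam : n.Partition} (s : Cell lam) : cellRow s < n := by
  have h := card_cell lam
  have h2 : (rows lam).length ≤ Fintype.card (Cell lam) := by
    refine (Fintype.card_fin (rows lam).length).symm.trans_le ?_
    refine Fintype.card_le_of_injective (fun i => (⟨i, ⟨0, ?_⟩⟩ : Cell lam)) ?_
    · refine lam.parts_pos ?_
      rw [← coe_rows]
      exact List.get_mem _ _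
    · intro i j hij
      exact congrArg Sigma.fst hij
  exact s.1.2.trans_le (h2.trans h.le)

lemma row_eq_zero_of_le {lam : n.Partition} {i : ℕ} (hi : n ≤ i) : row lam i = 0 := by
  by_contra h
  obtain ⟨s, h1, _⟩ := exists_cell (Nat.pos_of_ne_zero h)
  have := cellRow_lt_size s
  omega

lemma sum_range_min_row (lam : n.Partition) (k : ℕ) :
    ∑ i ∈ Finset.range (min k n), row lam i = ∑ i ∈ Finset.range k, row lam i := by
  refine Finset.sum_subset (fun i hi => ?_) fun i hi hi' => row_eq_zero_of_le ?_
  · rw [Finset.mem_range, lt_min_iff] at hi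
    exact Finset.mem_range.2 hi.1
  · rw [Finset.mem_range] at hi
    rw [Finset.mem_range, lt_min_iff] at hi'
    omega

lemma sum_rowExp_lt (lam : n.Partition) (k : ℕ) :
    ∑ i ∈ below n k, rowExp lam i = ((rows lam).take k).sum := by
  simp only [rowExp_apply]
  rw [sum_filter_lt_eq_range (fun i => row lam i), sum_take_rows, sum_range_min_row]

lemma dominated_of_coeff_ne_zero {lam mu : n.Partition}
    (h : coeff (rowExp mu) (evalVars n (cellSchur lam)) ≠ 0) : Dominated mu lam := fun k => by
  rw [← sum_rowExp_lt]
  exact coeff_evalVars_cellSchur_le h k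

/-- The fillings of content lam that contribute attain equality in `card_lt_le`, so they are the row
function composed with column permutations. Their total contribution is `youngConst`, which the
normalization cancels. -/
lemma coeff_rowExp_evalVars_cellSchur (lam : n.Partition) :
    coeff (rowExp lam) (evalVars n (cellSchur lam)) = 1 := by
  classical
  have h0 : (RatFunc.C (youngConst (cellRow (lam := lam)) cellCol) : Kt) ≠ 0 := by
    rw [Ne, map_eq_zero]; exact (isTableau_cell lam).youngConst_ne_zero
  rw [cellSchur, tabSchur, map_smul, coeff_smul, coeff_evalVars_tabSym, smul_eq_mul,
    inv_mul_eq_one₀ h0, youngConst_eq_sum]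
  congr 1
  rw [← Finset.sum_filter]
  let rowF : Cell lam → Fin n := fun s => ⟨cellRow s, cellRow_lt_size s⟩
  have hfix : ∀ τ : Perm (Cell lam), fixers (rowF ∘ τ) = fixers (cellRow ∘ τ) := by
    intro τ
    ext σ
    simp [mem_fixers, rowF, Fin.ext_iff]
  refine Finset.sum_bij_ne_zero (fun τ _ _ => rowF ∘ τ) ?_ ?_ ?_ ?_
  · intro τ _ _
    rw [Finset.mem_filter]
    refine ⟨Finset.mem_univ _, ?_⟩
    ext i
    rw [content_apply, rowExp_apply, ← card_cellRow_eq]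
    exact Finset.card_equiv τ fun s => by simp [rowF, Fin.ext_iff]
  · intro τ hτ _ τ' hτ' _ h
    refine Equiv.ext fun s => cell_ext ?_ ?_
    · exact congrArg (fun i : Fin n => (i : ℕ)) (congrFun h s)
    · rw [mem_fixers.1 hτ, mem_fixers.1 hτ']
  · intro f hf hne
    rw [Finset.mem_filter] at hf
    have hinj : ColInjective (fun s => (f s : ℕ)) := by
      intro s s' h2 h3
      by_contra hne'
      exact hne (sum_fixers_youngElt_eq_zero hne' h2 (Fin.ext h3))
    obtain ⟨τ, hτ, h⟩ := exists_fixers_of_card_eq hinj fun k => by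
      rw [← sum_content_lt, hf.2, sum_rowExp_lt]
    have hfτ : rowF ∘ τ = f := by
      funext s
      exact Fin.ext (h s)
    refine ⟨τ, hτ, ?_, hfτ⟩
    rw [← hfτ, hfix, sum_fixers_comp_youngElt hτ] at hne
    exact hne
  · intro τ hτ _
    rw [hfix, sum_fixers_comp_youngElt hτ]

end CellSchur

/-! ## Complete homogeneous symmetric functions -/

section Complete

open MvPolynomial

/-- The degree of the power sums. -/
abbrev powDeg (l : ℕ) : Fin l × ℕ+ → ℕ := fun x => (x.2 : ℕ)

lemma powWeight_ne_zero {l : ℕ} (x : Fin l × ℕ+) : powWeight l x ≠ 0 := by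
  rw [powWeight, Nat.cast_ne_zero]; exact x.2.ne_zero

variable {n : ℕ}

lemma toMultiset_powExponent (mu : n.Partition) :
    Finsupp.toMultiset (powExponent mu) = mu.parts.map fun r => ((0 : Fin 1), r.toPNat') := by
  rw [powExponent, Multiset.toFinsupp_toMultiset]

lemma map_toMultiset_powExponent (mu : n.Partition) :
    (Finsupp.toMultiset (powExponent mu)).map (fun x => (x.2 : ℕ)) = mu.parts := by
  rw [toMultiset_powExponent, Multiset.map_map]
  conv_rhs => rw [← Multiset.map_id mu.parts]
  refine Multiset.map_congr rfl fun r hr => ?_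
  simp only [Function.comp, Nat.toPNat'_coe, if_pos (mu.parts_pos hr), id]

lemma powExponent_injective : Function.Injective (powExponent (n := n)) := fun mu nu h =>
  Nat.Partition.ext (by rw [← map_toMultiset_powExponent, h, map_toMultiset_powExponent])

lemma weight_eq_sum_toMultiset {σ : Type*} (w : σ → ℕ) (m : σ →₀ ℕ) :
    Finsupp.weight w m = ((Finsupp.toMultiset m).map w).sum := by
  classical
  induction m using Finsupp.induction_linear with
  | zero => simp
  | add f g hf hg => simp [hf, hg]
  | single a b =>
    rw [Finsupp.weight_single, Finsupp.toMultiset_single, Multiset.map_nsmul, Multiset.sum_nsmul,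
      Multiset.map_singleton, Multiset.sum_singleton]

lemma weight_powExponent (mu : n.Partition) :
    Finsupp.weight (powDeg 1) (powExponent mu) = n := by
  rw [weight_eq_sum_toMultiset, map_toMultiset_powExponent, mu.parts_sum]

lemma exists_powExponent_eq {m : Fin 1 × ℕ+ →₀ ℕ} (h : Finsupp.weight (powDeg 1) m = n) :
    ∃ mu : n.Partition, powExponent mu = m := by
  refine ⟨⟨(Finsupp.toMultiset m).map (fun x => (x.2 : ℕ)), ?_, ?_⟩, ?_⟩
  · intro i hi
    obtain ⟨x, _, rfl⟩ := Multiset.mem_map.1 hi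
    exact x.2.pos
  · rw [← weight_eq_sum_toMultiset, h]
  · apply Function.LeftInverse.injective Finsupp.toMultiset_toFinsupp
    rw [toMultiset_powExponent, Multiset.map_map]
    conv_rhs => rw [← Multiset.map_id (Finsupp.toMultiset m)]
    refine Multiset.map_congr rfl fun x _ => ?_
    exact Prod.ext (Subsingleton.elim _ _) (PNat.coe_toPNat' x.2)

lemma powExponent_apply (mu : n.Partition) (r : ℕ+) :
    powExponent mu (0, r) = mu.parts.count (r : ℕ) := by
  have h := congrArg (Multiset.count (r : ℕ)) (map_toMultiset_powExponent mu)
  rw [← h]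
  have hinj : Function.Injective (fun x : Fin 1 × ℕ+ => (x.2 : ℕ)) := fun x y hxy =>
    Prod.ext (Subsingleton.elim _ _) (PNat.coe_injective hxy)
  have h2 := Multiset.count_map_eq_count' (fun x : Fin 1 × ℕ+ => (x.2 : ℕ))
    (Finsupp.toMultiset (powExponent mu)) hinj (0, r)
  rw [Finsupp.count_toMultiset] at h2
  exact h2.symm

lemma hallNorm_powExponent (mu : n.Partition) :
    hallNorm (powWeight 1) (powExponent mu) = (zNum mu : Kt) := by
  rw [hallNorm, Finsupp.prod, zNum, Nat.cast_prod]
  refine Finset.prod_bij (fun x _ => (x.2 : ℕ)) ?_ ?_ ?_ ?_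
  · rintro ⟨i, r⟩ hx
    obtain rfl : i = 0 := Subsingleton.elim _ _
    rw [Finsupp.mem_support_iff, powExponent_apply] at hx
    exact Multiset.mem_toFinset.2 (Multiset.count_ne_zero.1 hx)
  · intro x _ y _ hxy
    exact Prod.ext (Subsingleton.elim _ _) (PNat.coe_injective hxy)
  · intro r hr
    have hr' := Multiset.mem_toFinset.1 hr
    have h : (r.toPNat' : ℕ) = r := by rw [Nat.toPNat'_coe, if_pos (mu.parts_pos hr')]
    refine ⟨((0 : Fin 1), r.toPNat'), ?_, h⟩
    rw [Finsupp.mem_support_iff, powExponent_apply, h]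
    exact Multiset.count_ne_zero.2 hr'
  · rintro ⟨i, r⟩ _
    obtain rfl : i = 0 := Subsingleton.elim _ _
    rw [powExponent_apply, powWeight]
    push_cast
    rfl

lemma prod_map_pow (mu : n.Partition) :
    (mu.parts.map (pow (0 : Fin 1))).prod = monomial (powExponent mu) 1 := by
  have h : ∀ s : Multiset (Fin 1 × ℕ+),
      (s.map fun x => (X x : Sym1)).prod = monomial (Multiset.toFinsupp s) 1 := by
    intro s
    induction s using Multiset.induction_on with
    | empty => simp
    | cons a s ih =>
      rw [Multiset.map_cons, Multiset.prod_cons, ih, X, monomial_mul, one_mul,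
        ← Multiset.singleton_add, map_add, Multiset.toFinsupp_singleton]
  rw [powExponent, ← h, Multiset.map_map]
  rfl

lemma complete_eq (k : ℕ) : complete k =
    ∑ mu : k.Partition, monomial (powExponent mu) (hallNorm (powWeight 1) (powExponent mu))⁻¹ := by
  refine Finset.sum_congr rfl fun mu _ => ?_
  rw [prod_map_pow, C_mul_monomial, mul_one, hallNorm_powExponent]

lemma coeff_complete (k : ℕ) (m : Fin 1 × ℕ+ →₀ ℕ) : coeff m (complete k) =
    if Finsupp.weight (powDeg 1) m = k then (hallNorm (powWeight 1) m)⁻¹ else 0 := by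
  rw [complete_eq, coeff_sum]
  simp only [coeff_monomial]
  split_ifs with h
  · obtain ⟨mu, rfl⟩ := exists_powExponent_eq h
    rw [Finset.sum_eq_single mu]
    · rw [if_pos rfl]
    · intro nu _ hne
      exact if_neg fun h => hne (powExponent_injective h)
    · simp
  · refine Finset.sum_eq_zero fun mu _ => if_neg fun h1 => h ?_
    rw [← h1, weight_powExponent]

lemma isWeightedHomogeneous_complete (k : ℕ) :
    (complete k).IsWeightedHomogeneous (powDeg 1) k := by
  intro m hm
  rw [coeff_complete] at hm
  by_contra h
  exact hm (if_neg h)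

lemma complete_zero : complete 0 = 1 := by
  ext m
  rw [coeff_complete, coeff_one]
  have h0 : Finsupp.weight (powDeg 1) m = 0 ↔ 0 = m := by
    constructor
    · intro h
      by_contra hne
      obtain ⟨x, hx⟩ := Finsupp.ne_iff.1 (Ne.symm hne)
      have h1 := Finsupp.le_weight (powDeg 1) (s := x) x.2.ne_zero m
      rw [h] at h1
      exact hx (Nat.le_zero.1 h1)
    · rintro rfl; simp
  simp only [h0]
  split_ifs with h
  · subst h; simp [hallNorm]
  · rfl

lemma completeInt_natCast (k : ℕ) : completeInt (k : ℤ) = complete k := by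
  simp [completeInt]

lemma completeInt_of_neg {m : ℤ} (h : m < 0) : completeInt m = 0 := if_neg (not_le.2 h)

/-- The coefficients of `complete` are the inverse norms, and the factor by which one more power of
x changes the norm is the one produced by the weighted derivative. -/
lemma pderiv_complete (k : ℕ) (x : Fin 1 × ℕ+) :
    powWeight 1 x • pderiv x (complete k) = completeInt ((k : ℤ) - (x.2 : ℕ)) := by
  ext m
  rw [coeff_smul, coeff_pderiv, coeff_complete, smul_eq_mul, hallNorm_add_single, map_add,
    Finsupp.weight_single, one_smul]
  by_cases h : (x.2 : ℕ) ≤ k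
  · rw [← Nat.cast_sub h, completeInt_natCast, coeff_complete]
    have h1 : Finsupp.weight (powDeg 1) m + powDeg 1 x = k ↔
        Finsupp.weight (powDeg 1) m = k - (x.2 : ℕ) := by
      change _ + (x.2 : ℕ) = k ↔ _
      omega
    simp only [h1]
    split_ifs
    · have h2 := powWeight_ne_zero x
      have h3 : ((m x : Kt) + 1) ≠ 0 := Nat.cast_add_one_ne_zero _
      have h4 := hallNorm_ne_zero (k := Kt) powWeight_ne_zero m
      field_simp
    · simp
  · rw [completeInt_of_neg (by omega), if_neg, zero_mul, mul_zero, coeff_zero]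
    change ¬ (_ + (x.2 : ℕ) = k)
    omega

lemma pderiv_completeInt (m : ℤ) (x : Fin 1 × ℕ+) :
    powWeight 1 x • pderiv x (completeInt m) = completeInt (m - (x.2 : ℕ)) := by
  rcases lt_or_ge m 0 with h | h
  · rw [completeInt_of_neg h, completeInt_of_neg (by have := x.2.pos; omega), map_zero, smul_zero]
  · obtain ⟨k, rfl⟩ := Int.eq_ofNat_of_zero_le h
    rw [completeInt_natCast, pderiv_complete]

/-- The coefficient of `x^α` for an integer vector `α`, zero if an entry is negative. -/
def intCoeff {N : ℕ} (α : Fin N → ℤ) (P : MvPolynomial (Fin N) Kt) : Kt :=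
  if ∀ i, 0 ≤ α i then coeff (Finsupp.equivFunOnFinite.symm fun i => (α i).toNat) P else 0

lemma intCoeff_add {N : ℕ} (α : Fin N → ℤ) (P Q : MvPolynomial (Fin N) Kt) :
    intCoeff α (P + Q) = intCoeff α P + intCoeff α Q := by
  rw [intCoeff, intCoeff, intCoeff]; split_ifs <;> simp

lemma intCoeff_sum {N : ℕ} {ι : Type*} (s : Finset ι) (α : Fin N → ℤ)
    (P : ι → MvPolynomial (Fin N) Kt) :
    intCoeff α (∑ i ∈ s, P i) = ∑ i ∈ s, intCoeff α (P i) := by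
  simp only [intCoeff, coeff_sum]
  split_ifs <;> simp

lemma intCoeff_X_pow_mul {N : ℕ} (α : Fin N → ℤ) (i : Fin N) (r : ℕ)
    (P : MvPolynomial (Fin N) Kt) :
    intCoeff α (X i ^ r * P) = intCoeff (Function.update α i (α i - r)) P := by
  rw [intCoeff, intCoeff, X_pow_eq_monomial, coeff_monomial_mul']
  by_cases h : ∀ j, 0 ≤ Function.update α i (α i - r) j
  · have h1 : (r : ℤ) ≤ α i := by have := h i; rw [Function.update_self] at this; omega
    have h2 : ∀ j, 0 ≤ α j := by
      intro j
      rcases eq_or_ne j i with rfl | hj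
      · omega
      · have := h j; rwa [Function.update_of_ne hj] at this
    rw [if_pos h, if_pos h2, if_pos, one_mul]
    · congr 1
      ext j
      rcases eq_or_ne j i with rfl | hj
      · simp
      · simp [hj]
    · rw [Finsupp.single_le_iff]
      simp only [Finsupp.equivFunOnFinite_symm_apply_apply]
      omega
  · rw [if_neg h]
    split_ifs with h2 h3
    · exfalso
      apply h
      intro j
      rw [Finsupp.single_le_iff] at h3
      simp only [Finsupp.equivFunOnFinite_symm_apply_apply] at h3
      rcases eq_or_ne j i with rfl | hj
      · rw [Function.update_self]; have := h2 j; omega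
      · rw [Function.update_of_ne hj]; exact h2 j
    · rfl
    · rfl

/-- Products of complete symmetric functions are dual to monomials. -/
lemma hallForm_prod_completeInt {N : ℕ} (f : Sym1) (α : Fin N → ℤ) :
    hallForm 1 f (∏ i, completeInt (α i)) = intCoeff α (evalVars N f) := by
  induction f using MvPolynomial.induction_on generalizing α with
  | C a =>
    have h1 : (C a : Sym1) = a • 1 := by rw [smul_eq_C_mul, mul_one]
    rw [h1, map_smul, LinearMap.smul_apply, hallForm, hall_one, map_prod, map_smul, map_one,
      intCoeff]
    have h2 : ∀ m : ℤ, constantCoeff (completeInt m) = if m = 0 then 1 else 0 := by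
      intro m
      rcases lt_or_ge m 0 with h | h
      · rw [completeInt_of_neg h, map_zero, if_neg h.ne]
      · obtain ⟨k, rfl⟩ := Int.eq_ofNat_of_zero_le h
        rw [completeInt_natCast, constantCoeff_eq, coeff_complete]
        simp [hallNorm, eq_comm]
    simp only [h2]
    rw [Finset.prod_ite_zero, Finset.prod_const_one, coeff_smul, coeff_one, smul_eq_mul,
      smul_eq_mul]
    by_cases h3 : ∀ i ∈ Finset.univ, α i = 0
    · rw [if_pos h3, if_pos fun i => (h3 i (Finset.mem_univ i)).ge, if_pos]
      ext i
      simp [h3]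
    · rw [if_neg h3, mul_zero]
      split_ifs with h4 h5
      · exfalso
        refine h3 fun i _ => ?_
        have := congrArg (fun v => v i) h5
        simp only [Finsupp.coe_zero, Pi.zero_apply,
          Finsupp.equivFunOnFinite_symm_apply_apply] at this
        have := h4 i
        omega
      · rw [mul_zero]
      · rfl
  | add p q hp hq => rw [map_add, map_add, LinearMap.add_apply, hp, hq, intCoeff_add]
  | mul_X p x hp =>
    -- The adjoint of multiplication by p_r lowers one index by r, as does extracting a coefficient
    -- after multiplication by x_i^r.
    have h1 : powWeight 1 x • pderiv x (∏ i, completeInt (α i)) =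
        ∑ i, ∏ j, completeInt (Function.update α i (α i - (x.2 : ℕ)) j) := by
      rw [derivation_prod, Finset.smul_sum]
      refine Finset.sum_congr rfl fun i _ => ?_
      rw [smul_eq_mul, ← mul_smul_comm, pderiv_completeInt,
        ← Finset.mul_prod_erase Finset.univ _ (Finset.mem_univ i), Function.update_self, mul_comm]
      congr 1
      refine Finset.prod_congr rfl fun j hj => ?_
      rw [Function.update_of_ne (Finset.ne_of_mem_erase hj)]
    rw [mul_comm p, hallForm, hall_X_mul, h1, map_sum, map_mul]
    have h2 : evalVars N (X x) = ∑ i, X i ^ (x.2 : ℕ) := by rw [evalVars, aeval_X, psum]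
    rw [h2, Finset.sum_mul, intCoeff_sum]
    refine Finset.sum_congr rfl fun i _ => ?_
    rw [intCoeff_X_pow_mul, ← hp]

/-- Euler's formula for the grading: p_mu is an eigenvector of ∑ p_r · r∂/∂p_r with eigenvalue the
size of mu, and r∂/∂p_r lowers the index of `complete` by r. -/
lemma nsmul_complete (k : ℕ) :
    (k : Kt) • complete k = ∑ r ∈ Finset.Icc 1 k, pow (0 : Fin 1) r * complete (k - r) := by
  have h1 : ∀ r ∈ Finset.Icc 1 k, pow (0 : Fin 1) r * complete (k - r) =
      (r : Kt) • (X ((0 : Fin 1), r.toPNat') * pderiv ((0 : Fin 1), r.toPNat') (complete k)) := by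
    intro r hr
    rw [Finset.mem_Icc] at hr
    have h := pderiv_complete k ((0 : Fin 1), r.toPNat')
    simp only [powWeight, Nat.toPNat'_coe, if_pos (show 0 < r by omega)] at h
    rw [← Nat.cast_sub hr.2, completeInt_natCast] at h
    rw [← h, mul_smul_comm, pow]
  rw [Finset.sum_congr rfl h1, complete_eq]
  simp only [map_sum, Finset.mul_sum, Finset.smul_sum]
  rw [Finset.sum_comm]
  refine Finset.sum_congr rfl fun mu _ => ?_
  simp only [X_mul_pderiv_monomial]
  have h2 : ∀ r ∈ Finset.Icc 1 k, (r : Kt) • (powExponent mu ((0 : Fin 1), r.toPNat') •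
      monomial (powExponent mu) (hallNorm (powWeight 1) (powExponent mu))⁻¹) =
      ((r * mu.parts.count r : ℕ) : Kt) •
        monomial (powExponent mu) (hallNorm (powWeight 1) (powExponent mu))⁻¹ := by
    intro r hr
    rw [Finset.mem_Icc] at hr
    rw [powExponent_apply, Nat.toPNat'_coe, if_pos (show 0 < r by omega), ← Nat.cast_smul_eq_nsmul Kt,
      smul_smul]
    push_cast
    rfl
  rw [Finset.sum_congr rfl h2, ← Finset.sum_smul, ← Nat.cast_sum]
  congr 2
  have h3 : mu.parts.sum = k := mu.parts_sum
  rw [Finset.sum_multiset_count] at h3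
  have hsub : mu.parts.toFinset ⊆ Finset.Icc 1 k := by
    intro r hr
    have hr' := Multiset.mem_toFinset.1 hr
    have := Multiset.le_sum_of_mem hr'
    rw [mu.parts_sum] at this
    exact Finset.mem_Icc.2 ⟨mu.parts_pos hr', this⟩
  refine h3.symm.trans ?_
  rw [← Finset.sum_subset hsub]
  · exact Finset.sum_congr rfl fun r _ => by rw [smul_eq_mul, mul_comm]
  · intro r _ hr
    rw [Multiset.mem_toFinset, ← Multiset.count_eq_zero] at hr
    rw [hr, mul_zero]

end Complete

/-! ## Expansion in orthonormal families, and the lexicographic order on partitions -/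

section Expansion

open MvPolynomial

/-- A family that is orthonormal for the Hall form and as large as the set of monomials of
weight `n` spans the weighted homogeneous part. -/
lemma eq_sum_hallForm_smul {l n : ℕ} {ι : Type*} [Fintype ι] [DecidableEq ι] (v : ι → MultiSym l)
    (hv : ∀ i, (v i).IsWeightedHomogeneous (powDeg l) n)
    (horth : ∀ i j, hallForm l (v i) (v j) = if i = j then 1 else 0)
    (e : ι → (Fin l × ℕ+ →₀ ℕ)) (he : ∀ m, Finsupp.weight (powDeg l) m = n → ∃ i, e i = m)
    {f : MultiSym l} (hf : f.IsWeightedHomogeneous (powDeg l) n) :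
    f = ∑ i, hallForm l (v i) f • v i := by
  classical
  have hli : LinearIndependent Kt v := by
    rw [Fintype.linearIndependent_iff]
    intro g hg i
    have := congrArg (hallForm l (v i)) hg
    simpa [horth] using this
  let U : Submodule Kt (MultiSym l) := Submodule.span Kt (Set.range fun i => monomial (e i) (1 : Kt))
  have hmem : ∀ {p : MultiSym l}, p.IsWeightedHomogeneous (powDeg l) n → p ∈ U := by
    intro p hp
    rw [p.as_sum]
    refine Submodule.sum_mem _ fun m hm => ?_
    obtain ⟨i, hi⟩ := he m (hp (mem_support_iff.1 hm))
    have h1 : (monomial m (coeff m p) : MultiSym l) = coeff m p • monomial (e i) 1 := by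
      rw [hi, smul_monomial, smul_eq_mul, mul_one]
    rw [h1]
    exact U.smul_mem _ (Submodule.subset_span ⟨i, rfl⟩)
  have hspan : Submodule.span Kt (Set.range v) = U := by
    have : FiniteDimensional Kt U := FiniteDimensional.span_of_finite _ (Set.finite_range _)
    -- Orthonormality makes the family independent, and the ambient space is spanned by as many
    -- monomials.
    refine Submodule.eq_of_le_of_finrank_le ?_ ?_
    · rw [Submodule.span_le]
      rintro _ ⟨i, rfl⟩
      exact hmem (hv i)
    · rw [finrank_span_eq_card hli]
      exact finrank_range_le_card _
  have hfm : f ∈ Submodule.span Kt (Set.range v) := hspan ▸ hmem hf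
  obtain ⟨c, hc⟩ := (Submodule.mem_span_range_iff_exists_fun Kt).1 hfm
  conv_lhs => rw [← hc]
  refine Finset.sum_congr rfl fun i _ => ?_
  rw [← hc, map_sum]
  simp [horth]

open Classical in
lemma sum_orbSize {α : Type} [Fintype α] [DecidableEq α] (π : Equiv.Perm α) :
    ∑ o : Orb π, orbSize o = Fintype.card α := by
  have h := Finset.card_eq_sum_card_fiberwise (f := fun x : α => orbMk π x) (s := Finset.univ)
    (t := Finset.univ) (fun _ _ => Finset.mem_coe.2 (Finset.mem_univ _))
  rw [← Finset.card_univ, h]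
  rfl

lemma isWeightedHomogeneous_permPow {l : ℕ} {α : Type} [Fintype α] [DecidableEq α]
    (comp : α → Fin l) (π : Equiv.Perm α) :
    (permPow comp π).IsWeightedHomogeneous (powDeg l) (Fintype.card α) := by
  classical
  rw [← sum_orbSize π, permPow]
  refine IsWeightedHomogeneous.prod _ _ (fun o => orbSize o) fun o _ => ?_
  have h := isWeightedHomogeneous_X Kt (powDeg l) (comp o.out, (orbSize o).toPNat')
  have h2 : powDeg l (comp o.out, (orbSize o).toPNat') = orbSize o := by
    rw [powDeg, Nat.toPNat'_coe, if_pos (orbSize_pos o)]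
  rwa [h2] at h

lemma isWeightedHomogeneous_tabSchur {l : ℕ} {α A A' : Type} [Fintype α] [DecidableEq α]
    (comp : α → Fin l) (row : α → A) (col : α → A') :
    (tabSchur comp row col).IsWeightedHomogeneous (powDeg l) (Fintype.card α) := by
  rw [← mem_weightedHomogeneousSubmodule, tabSchur, tabSym]
  exact Submodule.smul_mem _ _ (Submodule.sum_mem _ fun π _ =>
    Submodule.smul_mem _ _ (isWeightedHomogeneous_permPow comp π))

variable {n : ℕ}

lemma isWeightedHomogeneous_cellSchur (lam : n.Partition) :
    (cellSchur lam).IsWeightedHomogeneous (powDeg 1) n := by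
  have h := isWeightedHomogeneous_tabSchur (fun _ : Cell lam => (0 : Fin 1)) cellRow cellCol
  rwa [card_cell] at h

lemma eq_sum_hallForm_cellSchur {f : Sym1} (hf : f.IsWeightedHomogeneous (powDeg 1) n) :
    f = ∑ mu : n.Partition, hallForm 1 (cellSchur mu) f • cellSchur mu := by
  classical
  exact eq_sum_hallForm_smul _ isWeightedHomogeneous_cellSchur
    (fun i j => by rw [hallForm_cellSchur]) powExponent (fun m hm => exists_powExponent_eq hm) hf

/-- The lexicographic order on exponents. -/
def lexKey {N : ℕ} (a : Fin N →₀ ℕ) : Lex (Fin N →₀ ℕ) := toLex a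

lemma lexKey_injective {N : ℕ} : Function.Injective (lexKey (N := N)) := toLex.injective

lemma lexKey_lt_iff {N : ℕ} {a b : Fin N →₀ ℕ} :
    lexKey a < lexKey b ↔ ∃ i, (∀ j, j < i → a j = b j) ∧ a i < b i := Finsupp.Lex.lt_iff

lemma rowExp_injective : Function.Injective (rowExp (n := n)) := fun lam mu h =>
  partition_ext_row fun i => by
    rcases lt_or_ge i n with hi | hi
    · exact congrArg (fun v => v ⟨i, hi⟩) h
    · rw [row_eq_zero_of_le hi, row_eq_zero_of_le hi]

lemma sum_below_succ {N : ℕ} (i : Fin N) (a : Fin N → ℕ) :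
    ∑ j ∈ below N (i + 1), a j = a i + ∑ j ∈ below N i, a j := by
  have h : below N (i + 1) = insert i (below N i) := by
    ext j
    rw [Finset.mem_insert, mem_below, mem_below, Fin.ext_iff]
    omega
  rw [h, Finset.sum_insert (by simp [mem_below])]

/-- At the first index where the exponents differ, the partial sums differ by the same amount. -/
lemma lexKey_le_of_partial_sums {N : ℕ} {a b : Fin N →₀ ℕ}
    (h : ∀ k, ∑ i ∈ below N k, a i ≤ ∑ i ∈ below N k, b i) : lexKey a ≤ lexKey b := by
  by_contra hlt
  obtain ⟨i, h1, h2⟩ := lexKey_lt_iff.1 (not_le.1 hlt)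
  have h3 := h (i + 1)
  have h4 : ∑ j ∈ below N i, b j = ∑ j ∈ below N i, a j :=
    Finset.sum_congr rfl fun j hj => h1 j (Fin.lt_def.2 (mem_below.1 hj))
  rw [sum_below_succ i fun j => a j, sum_below_succ i fun j => b j, h4] at h3
  omega

lemma Dominated.lexKey_le {lam mu : n.Partition} (h : Dominated lam mu) :
    lexKey (rowExp lam) ≤ lexKey (rowExp mu) :=
  lexKey_le_of_partial_sums fun k => by rw [sum_rowExp_lt, sum_rowExp_lt]; exact h k

/-- A function that is both lower triangular and upper triangular with respect to the family
`cellSchur` belongs to it. -/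
lemma eq_cellSchur {g : Sym1} {lam : n.Partition} (hg : g.IsWeightedHomogeneous (powDeg 1) n)
    (h1 : ∀ mu, hallForm 1 (cellSchur mu) g ≠ 0 → lexKey (rowExp lam) ≤ lexKey (rowExp mu))
    (h2 : ∀ nu, coeff (rowExp nu) (evalVars n g) ≠ 0 → lexKey (rowExp nu) ≤ lexKey (rowExp lam))
    (h3 : coeff (rowExp lam) (evalVars n g) = 1) : g = cellSchur lam := by
  classical
  have hexp := eq_sum_hallForm_cellSchur hg
  have hcoeff : ∀ nu, coeff (rowExp nu) (evalVars n g) = ∑ mu : n.Partition,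
      hallForm 1 (cellSchur mu) g * coeff (rowExp nu) (evalVars n (cellSchur mu)) := by
    intro nu
    conv_lhs => rw [hexp, map_sum, coeff_sum]
    exact Finset.sum_congr rfl fun mu _ => by rw [map_smul, coeff_smul, smul_eq_mul]
  have key : ∀ mu, hallForm 1 (cellSchur mu) g ≠ 0 → lexKey (rowExp mu) ≤ lexKey (rowExp lam) := by
    intro mu hmu
    -- The leading monomial of the largest term of the expansion cannot be cancelled, so it occurs
    -- in `g` and `h2` bounds it.
    obtain ⟨top, htop, hmax⟩ := Finset.exists_max_image
      (Finset.univ.filter fun mu : n.Partition => hallForm 1 (cellSchur mu) g ≠ 0)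
      (fun mu => lexKey (rowExp mu)) ⟨mu, by simpa using hmu⟩
    rw [Finset.mem_filter] at htop
    refine (hmax mu (by simpa using hmu)).trans (h2 top ?_)
    rw [hcoeff, Finset.sum_eq_single top]
    · rw [coeff_rowExp_evalVars_cellSchur, mul_one]; exact htop.2
    · intro nu _ hne
      by_contra h
      obtain ⟨ha, hb⟩ := mul_ne_zero_iff.1 h
      exact hne (rowExp_injective (lexKey_injective
        (le_antisymm (hmax nu (by simpa using ha)) (dominated_of_coeff_ne_zero hb).lexKey_le)))
    · simp
  have hz : ∀ mu, mu ≠ lam → hallForm 1 (cellSchur mu) g = 0 := fun mu hne => by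
    by_contra h
    exact hne (rowExp_injective (lexKey_injective (le_antisymm (key mu h) (h1 mu h))))
  have hone := hcoeff lam
  rw [h3, Finset.sum_eq_single lam (fun mu _ hne => by rw [hz mu hne, zero_mul]) (by simp),
    coeff_rowExp_evalVars_cellSchur, mul_one] at hone
  rw [hexp, Finset.sum_eq_single lam (fun mu _ hne => by rw [hz mu hne, zero_smul]) (by simp),
    ← hone, one_smul]

/-- All points below the least moved point are fixed, hence already taken as values, so that point
can only move up. -/
lemma exists_first_moved {N : ℕ} {σ : Equiv.Perm (Fin N)} (hσ : σ ≠ 1) :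
    ∃ i, (∀ j, j < i → σ j = j) ∧ i < σ i := by
  classical
  have hne : (Finset.univ.filter fun i => σ i ≠ i).Nonempty := by
    by_contra h
    rw [Finset.not_nonempty_iff_eq_empty, Finset.filter_eq_empty_iff] at h
    exact hσ (Equiv.ext fun i => by simpa using h (Finset.mem_univ i))
  obtain ⟨i, hi, hmin⟩ := Finset.exists_min_image _ id hne
  rw [Finset.mem_filter] at hi
  have h1 : ∀ j, j < i → σ j = j := fun j hj => by
    by_contra h
    exact absurd (hmin j (by simpa using h)) (not_le.2 hj)
  refine ⟨i, h1, lt_of_le_of_ne (le_of_not_gt fun h => ?_) (Ne.symm hi.2)⟩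
  exact hi.2 (σ.injective (h1 _ h))

end Expansion

/-! ## The bialternant formula and the equality of the two families of Schur functions -/

section Bialternant

open MvPolynomial

variable {N : ℕ}

/-- The generating series of the complete symmetric polynomials. -/
def completeSeries (N : ℕ) : PowerSeries (MvPolynomial (Fin N) Kt) :=
  PowerSeries.mk fun k => evalVars N (complete k)

/-- The geometric series in one of the variables. -/
def geomSeries (i : Fin N) : PowerSeries (MvPolynomial (Fin N) Kt) :=
  PowerSeries.mk fun k => X i ^ k

/-- The linear factor `1 - x_i T`. -/
def linFactor (i : Fin N) : Polynomial (MvPolynomial (Fin N) Kt) :=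
  1 - Polynomial.C (X i) * Polynomial.X

lemma geomSeries_mul_linFactor (i : Fin N) :
    geomSeries i * (linFactor i : PowerSeries (MvPolynomial (Fin N) Kt)) = 1 := by
  have h : ((linFactor i : Polynomial (MvPolynomial (Fin N) Kt)) :
      PowerSeries (MvPolynomial (Fin N) Kt)) = 1 - PowerSeries.C (X i) * PowerSeries.X := by
    simp [linFactor]
  rw [h]
  ext k : 1
  rw [mul_sub, mul_one, ← mul_assoc, mul_right_comm, map_sub]
  cases k with
  | zero => simp [geomSeries]
  | succ k => simp [geomSeries, PowerSeries.coeff_succ_mul_X, PowerSeries.coeff_one, pow_succ]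

/-- Generating function form of `nsmul_complete`; the series ∑ (1/(1 - x_i T) - 1) generates the
power sums. -/
lemma X_mul_derivative_completeSeries :
    PowerSeries.X * PowerSeries.derivative (MvPolynomial (Fin N) Kt) (completeSeries N) =
      (∑ i : Fin N, (geomSeries i - 1)) * completeSeries N := by
  ext k : 1
  have h1 : ∀ r, PowerSeries.coeff r (∑ i : Fin N, (geomSeries i - 1)) =
      if r = 0 then 0 else psum (Fin N) Kt r := by
    intro r
    rw [map_sum]
    split_ifs with h
    · subst h; simp [geomSeries]
    · rw [psum]
      refine Finset.sum_congr rfl fun i _ => ?_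
      rw [map_sub, PowerSeries.coeff_one, if_neg h, sub_zero, geomSeries, PowerSeries.coeff_mk]
  have h2 := congrArg (evalVars N) (nsmul_complete k)
  rw [map_smul, map_sum] at h2
  have h3 : PowerSeries.coeff k (PowerSeries.X *
      PowerSeries.derivative (MvPolynomial (Fin N) Kt) (completeSeries N)) =
      (k : Kt) • evalVars N (complete k) := by
    cases k with
    | zero => simp
    | succ k =>
      rw [PowerSeries.coeff_succ_X_mul, PowerSeries.coeff_derivative, completeSeries,
        PowerSeries.coeff_mk, smul_eq_C_mul, mul_comm]
      push_cast
      simp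
  rw [h3, h2, PowerSeries.coeff_mul, Finset.Nat.sum_antidiagonal_eq_sum_range_succ_mk,
    Finset.range_eq_Ico, Finset.sum_eq_sum_Ico_succ_bot (Nat.succ_pos k)]
  simp only [h1]
  simp only [if_true]
  rw [zero_mul, zero_add]
  have h4 : Finset.Ico (0 + 1) k.succ = Finset.Icc 1 k := by
    ext r; rw [Finset.mem_Ico, Finset.mem_Icc]; omega
  rw [h4]
  refine Finset.sum_congr rfl fun r hr => ?_
  have hr' : 0 < r := (Finset.mem_Icc.1 hr).1
  rw [if_neg hr'.ne', map_mul, completeSeries, PowerSeries.coeff_mk, pow, evalVars, aeval_X,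
    Nat.toPNat'_coe, if_pos hr']

lemma X_mul_derivative_prod_linFactor :
    PowerSeries.X * PowerSeries.derivative (MvPolynomial (Fin N) Kt)
        (∏ i : Fin N, (linFactor i : PowerSeries (MvPolynomial (Fin N) Kt))) =
      -((∑ i : Fin N, (geomSeries i - 1)) *
        ∏ i : Fin N, (linFactor i : PowerSeries (MvPolynomial (Fin N) Kt))) := by
  rw [derivation_prod, Finset.mul_sum, Finset.sum_mul, ← Finset.sum_neg_distrib]
  refine Finset.sum_congr rfl fun i _ => ?_
  have h1 : PowerSeries.derivative (MvPolynomial (Fin N) Kt)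
      (linFactor i : PowerSeries (MvPolynomial (Fin N) Kt)) = -PowerSeries.C (X i) := by
    rw [PowerSeries.derivative_coe]
    simp [linFactor]
  have h2 : ((linFactor i : Polynomial (MvPolynomial (Fin N) Kt)) :
      PowerSeries (MvPolynomial (Fin N) Kt)) = 1 - PowerSeries.C (X i) * PowerSeries.X := by
    simp [linFactor]
  rw [← Finset.mul_prod_erase Finset.univ _ (Finset.mem_univ i), h1, sub_mul, ← mul_assoc,
    geomSeries_mul_linFactor, one_mul, h2, smul_eq_mul]
  ring

/-- The logarithmic derivatives of the two factors cancel, so the product has derivative 0, and its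
constant term is 1. -/
lemma completeSeries_mul_prod_linFactor :
    completeSeries N * ∏ i : Fin N, (linFactor i : PowerSeries (MvPolynomial (Fin N) Kt)) = 1 := by
  have : IsAddTorsionFree (MvPolynomial (Fin N) Kt) := by infer_instance
  refine PowerSeries.derivative.ext ?_ ?_
  · have hX : (PowerSeries.X : PowerSeries (MvPolynomial (Fin N) Kt)) ≠ 0 := PowerSeries.X_ne_zero
    refine mul_left_cancel₀ hX ?_
    rw [Derivation.leibniz, mul_add, smul_eq_mul, smul_eq_mul, mul_left_comm,
      X_mul_derivative_prod_linFactor, mul_left_comm PowerSeries.X,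
      X_mul_derivative_completeSeries]
    simp only [Derivation.map_one_eq_zero, mul_zero]
    ring
  · rw [map_mul, map_prod, map_one]
    simp [completeSeries, linFactor, complete_zero]

/-- The coefficients of `∏ (1 - x_k T)` over `k ≠ i`, in reverse order. -/
def cofactorCoeff (i q : Fin N) : MvPolynomial (Fin N) Kt :=
  (∏ k ∈ Finset.univ.erase i, linFactor k).coeff (Fin.rev q : ℕ)

/-- Compare coefficients of T^a in 1/(1 - x_i T) = H(T) ∏_{k ≠ i} (1 - x_k T). The last product has
degree below N, hence N summands, and `Fin.rev` aligns them with the exponents N - 1, ..., 0 of the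
alternant. -/
lemma X_pow_eq_sum_complete (i : Fin N) (a : ℕ) :
    (X i ^ a : MvPolynomial (Fin N) Kt) =
      ∑ q : Fin N, evalVars N (completeInt ((a : ℤ) - (Fin.rev q : ℕ))) * cofactorCoeff i q := by
  have h1 : geomSeries i = completeSeries N *
      ((∏ k ∈ Finset.univ.erase i, linFactor k : Polynomial (MvPolynomial (Fin N) Kt)) :
        PowerSeries (MvPolynomial (Fin N) Kt)) := by
    calc geomSeries i = (completeSeries N *
          ∏ i : Fin N, (linFactor i : PowerSeries (MvPolynomial (Fin N) Kt))) * geomSeries i := by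
          rw [completeSeries_mul_prod_linFactor, one_mul]
      _ = _ := by
        rw [← Finset.mul_prod_erase Finset.univ _ (Finset.mem_univ i)]
        have h2 : ((∏ k ∈ Finset.univ.erase i, linFactor k :
            Polynomial (MvPolynomial (Fin N) Kt)) : PowerSeries (MvPolynomial (Fin N) Kt)) =
            ∏ k ∈ Finset.univ.erase i, (linFactor k : PowerSeries (MvPolynomial (Fin N) Kt)) := by
          simp only [← Polynomial.coeToPowerSeries.ringHom_apply, map_prod]
        rw [h2]
        linear_combination (completeSeries N * ∏ k ∈ Finset.univ.erase i,
          (linFactor k : PowerSeries (MvPolynomial (Fin N) Kt))) * geomSeries_mul_linFactor i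
  have hdeg : ∀ j, N ≤ j → (∏ k ∈ Finset.univ.erase i, linFactor k).coeff j = 0 := by
    intro j hj
    refine Polynomial.coeff_eq_zero_of_natDegree_lt (lt_of_le_of_lt ?_ (lt_of_lt_of_le
      (Nat.sub_lt (Fin.pos i) one_pos) hj))
    refine (Polynomial.natDegree_prod_le _ _).trans ?_
    refine (Finset.sum_le_card_nsmul _ _ 1 fun k _ => ?_).trans ?_
    · rw [linFactor]
      refine (Polynomial.natDegree_sub_le _ _).trans ?_
      simp only [Polynomial.natDegree_one, zero_le, sup_of_le_right]
      exact (Polynomial.natDegree_C_mul_le _ _).trans Polynomial.natDegree_X_le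
    · rw [Finset.card_erase_of_mem (Finset.mem_univ i), Finset.card_univ, Fintype.card_fin]
      simp
  have h3 := congrArg (PowerSeries.coeff a) h1
  rw [geomSeries, PowerSeries.coeff_mk, PowerSeries.coeff_mul,
    ← Finset.Nat.sum_antidiagonal_swap, Finset.Nat.sum_antidiagonal_eq_sum_range_succ_mk] at h3
  rw [h3]
  simp only [cofactorCoeff]
  rw [← Equiv.sum_comp Fin.revPerm]
  simp only [Fin.revPerm_apply, Fin.rev_rev]
  have h4 : ∀ j : ℕ, evalVars N (completeInt ((a : ℤ) - (j : ℕ))) *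
      (∏ k ∈ Finset.univ.erase i, linFactor k).coeff j =
      if j ≤ a ∧ j < N then evalVars N (complete (a - j)) *
        (∏ k ∈ Finset.univ.erase i, linFactor k).coeff j else 0 := by
    intro j
    split_ifs with h
    · rw [← Nat.cast_sub h.1, completeInt_natCast]
    · rcases not_and_or.1 h with h | h
      · rw [completeInt_of_neg (by omega), map_zero, zero_mul]
      · rw [hdeg j (not_lt.1 h), mul_zero]
  rw [Fin.sum_univ_eq_sum_range (fun j => evalVars N (completeInt ((a : ℤ) - (j : ℕ))) *
      (∏ k ∈ Finset.univ.erase i, linFactor k).coeff j) N]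
  simp only [h4]
  rw [← Finset.sum_filter]
  have h5 : (Finset.range N).filter (fun j => j ≤ a ∧ j < N) =
      (Finset.range (a + 1)).filter (fun j => j < N) := by
    ext j; simp only [Finset.mem_filter, Finset.mem_range]; omega
  rw [h5, Finset.sum_filter]
  refine Finset.sum_congr rfl fun j _ => ?_
  simp only [Prod.swap, completeSeries, PowerSeries.coeff_mk, Polynomial.coeff_coe]
  split_ifs with h
  · rfl
  · rw [hdeg j (not_lt.1 h), mul_zero]

/-- The alternant `det (x_i ^ α_p)`. -/
def alternant (α : Fin N → ℕ) : MvPolynomial (Fin N) Kt :=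
  Matrix.det (Matrix.of fun p i : Fin N => (X i ^ α p : MvPolynomial (Fin N) Kt))

/-- The Jacobi--Trudi determinant of a vector of row lengths. -/
def jacobiTrudi (r : Fin N → ℕ) : Sym1 :=
  Matrix.det (Matrix.of fun p q : Fin N => completeInt ((r p : ℤ) - (p : ℤ) + (q : ℤ)))

/-- By `X_pow_eq_sum_complete` the matrix of powers is the Jacobi–Trudi matrix times a matrix that
does not depend on `r`. -/
lemma alternant_eq_mul (r : Fin N → ℕ) :
    alternant (fun p => r p + (Fin.rev p : ℕ)) =
      evalVars N (jacobiTrudi r) * Matrix.det (Matrix.of fun q i : Fin N => cofactorCoeff i q) := by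
  rw [alternant, jacobiTrudi, AlgHom.map_det, ← Matrix.det_mul]
  congr 1
  ext1 p i
  rw [Matrix.of_apply, X_pow_eq_sum_complete, Matrix.mul_apply]
  refine Finset.sum_congr rfl fun q _ => ?_
  rw [AlgHom.mapMatrix_apply, Matrix.map_apply, Matrix.of_apply, Matrix.of_apply]
  congr 3
  have h1 := Fin.val_rev p
  have h2 := Fin.val_rev q
  have := p.isLt
  have := q.isLt
  push_cast
  omega

lemma jacobiTrudi_zero : jacobiTrudi (fun _ : Fin N => 0) = 1 := by
  rw [jacobiTrudi, Matrix.det_of_isUpperTriangular]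
  · refine Finset.prod_eq_one fun i _ => ?_
    rw [Matrix.of_apply]
    have : (((0 : ℕ) : ℤ) - (i : ℤ) + (i : ℤ)) = ((0 : ℕ) : ℤ) := by push_cast; ring
    rw [this, completeInt_natCast, complete_zero]
  · intro i j hij
    have hij' : (j : ℕ) < i := hij
    exact completeInt_of_neg (by push_cast; omega)

/-- The bialternant formula. -/
lemma alternant_eq_jacobiTrudi_mul (r : Fin N → ℕ) :
    alternant (fun p => r p + (Fin.rev p : ℕ)) =
      evalVars N (jacobiTrudi r) * alternant (fun p : Fin N => (Fin.rev p : ℕ)) := by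
  -- At `r = 0` the Jacobi–Trudi determinant is 1, which identifies the common second factor with
  -- the Vandermonde alternant.
  have h := alternant_eq_mul (fun _ : Fin N => 0)
  rw [jacobiTrudi_zero, map_one, one_mul] at h
  simp only [zero_add] at h
  rw [h, alternant_eq_mul]

lemma coeff_alternant (α : Fin N → ℕ) (a : Fin N →₀ ℕ) :
    coeff a (alternant α) = ∑ σ : Equiv.Perm (Fin N),
      if (Finsupp.equivFunOnFinite.symm fun i => α (σ i)) = a then
        (((Equiv.Perm.sign σ : ℤ)) : Kt) else 0 := by
  rw [alternant, Matrix.det_apply', coeff_sum]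
  refine Finset.sum_congr rfl fun σ _ => ?_
  have h1 : ∏ i, Matrix.of (fun p i : Fin N => (X i ^ α p : MvPolynomial (Fin N) Kt)) (σ i) i =
      monomial (Finsupp.equivFunOnFinite.symm fun i => α (σ i)) 1 := by
    rw [monomial_eq, C_1, one_mul, Finsupp.prod_fintype _ _ fun _ => pow_zero _]
    rfl
  have h2 : (((Equiv.Perm.sign σ : ℤ)) : MvPolynomial (Fin N) Kt) =
      C (((Equiv.Perm.sign σ : ℤ)) : Kt) := by simp
  rw [h1, h2, C_mul_monomial, mul_one, coeff_monomial]

lemma lexKey_comp_lt {α : Fin N → ℕ} (hα : StrictAnti α) {σ : Equiv.Perm (Fin N)} (hσ : σ ≠ 1) :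
    lexKey (Finsupp.equivFunOnFinite.symm fun i => α (σ i)) <
      lexKey (Finsupp.equivFunOnFinite.symm α) := by
  obtain ⟨i, h1, h2⟩ := exists_first_moved hσ
  exact lexKey_lt_iff.2 ⟨i, fun j hj => by simp [h1 j hj], by simpa using hα h2⟩

lemma coeff_alternant_self {α : Fin N → ℕ} (hα : StrictAnti α) :
    coeff (Finsupp.equivFunOnFinite.symm α) (alternant α) = 1 := by
  rw [coeff_alternant, Finset.sum_eq_single 1]
  · simp
  · intro σ _ hσ
    exact if_neg fun h => (lexKey_comp_lt hα hσ).ne (congrArg lexKey h)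
  · simp

lemma degree_alternant {α : Fin N → ℕ} (hα : StrictAnti α) :
    MonomialOrder.lex.degree (alternant α) = Finsupp.equivFunOnFinite.symm α := by
  have h0 : Finsupp.equivFunOnFinite.symm α ∈ (alternant α).support := by
    rw [mem_support_iff, coeff_alternant_self hα]; exact one_ne_zero
  apply MonomialOrder.lex.toSyn.injective
  refine le_antisymm ?_ (MonomialOrder.lex.le_degree h0)
  rw [MonomialOrder.degree_le_iff]
  intro c hc
  rw [MonomialOrder.lex_le_iff]
  rw [mem_support_iff, coeff_alternant] at hc
  obtain ⟨σ, _, hσ⟩ := Finset.exists_ne_zero_of_sum_ne_zero hc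
  rw [ite_ne_right_iff] at hσ
  rw [← hσ.1]
  rcases eq_or_ne σ 1 with rfl | h
  · exact le_rfl
  · exact (lexKey_comp_lt hα h).le

lemma leadingCoeff_alternant {α : Fin N → ℕ} (hα : StrictAnti α) :
    MonomialOrder.lex.leadingCoeff (alternant α) = 1 := by
  rw [MonomialOrder.leadingCoeff, degree_alternant hα, coeff_alternant_self hα]

lemma strictAnti_add_rev {r : Fin N → ℕ} (hr : Antitone r) :
    StrictAnti fun p => r p + (Fin.rev p : ℕ) := fun p q hpq => by
  have h1 := hr hpq.le
  have h2 : (Fin.rev q : ℕ) < Fin.rev p := Fin.rev_lt_rev.2 hpq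
  exact add_lt_add_of_le_of_lt h1 h2

/-- Lexicographic leading terms multiply, so the bialternant formula gives the leading term as the
quotient of those of two alternants. -/
lemma degree_leadingCoeff_jacobiTrudi {r : Fin N → ℕ} (hr : Antitone r) :
    MonomialOrder.lex.degree (evalVars N (jacobiTrudi r)) = Finsupp.equivFunOnFinite.symm r ∧
      MonomialOrder.lex.leadingCoeff (evalVars N (jacobiTrudi r)) = 1 := by
  have h1 := degree_alternant (strictAnti_add_rev hr)
  have h2 := leadingCoeff_alternant (strictAnti_add_rev hr)
  have hδ : StrictAnti fun p : Fin N => (Fin.rev p : ℕ) := fun p q hpq => Fin.rev_lt_rev.2 hpq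
  rw [alternant_eq_jacobiTrudi_mul] at h1 h2
  rw [MonomialOrder.leadingCoeff_mul, leadingCoeff_alternant hδ, mul_one] at h2
  rw [MonomialOrder.degree_mul', degree_alternant hδ] at h1
  · refine ⟨?_, h2⟩
    ext i
    have := congrArg (fun v => v i) h1
    simpa using this
  · intro h0
    have h3 := leadingCoeff_alternant (strictAnti_add_rev hr)
    rw [alternant_eq_jacobiTrudi_mul, h0, MonomialOrder.leadingCoeff_zero] at h3
    exact zero_ne_one h3

end Bialternant

/-! ### Jacobi–Trudi determinants as functions of Young symmetrizers -/

section SchurEq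

open MvPolynomial

variable {n : ℕ}

/-- An empty row adds a last row (0, ..., 0, 1), so the determinant may be taken of size n for every
partition of n. -/
lemma det_completeInt_succ {N : ℕ} (r : ℕ → ℕ) (h : r N = 0) :
    Matrix.det (Matrix.of fun p q : Fin (N + 1) =>
      completeInt ((r p : ℤ) - (p : ℤ) + (q : ℤ))) =
    Matrix.det (Matrix.of fun p q : Fin N => completeInt ((r p : ℤ) - (p : ℤ) + (q : ℤ))) := by
  rw [Matrix.det_succ_row _ (Fin.last N), Finset.sum_eq_single (Fin.last N)]
  · have h1 : (((r (Fin.last N : ℕ) : ℕ) : ℤ) - ((Fin.last N : ℕ) : ℤ) + ((Fin.last N : ℕ) : ℤ)) =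
        ((0 : ℕ) : ℤ) := by rw [Fin.val_last, h]; push_cast; ring
    rw [Matrix.of_apply, h1, completeInt_natCast, complete_zero, mul_one, Fin.val_last,
      Even.neg_one_pow ⟨N, rfl⟩, one_mul]
    congr 1
    ext1 p q
    simp [Matrix.submatrix_apply, Fin.succAbove_last]
  · intro q _ hq
    have hq' : (q : ℕ) < N := Fin.val_lt_last hq
    rw [Matrix.of_apply, Fin.val_last, h, completeInt_of_neg (by push_cast; omega), mul_zero,
      zero_mul]
  · simp

lemma length_rows_le (lam : n.Partition) : (rows lam).length ≤ n := by
  by_contra h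
  have h3 := row_of_lt (lam := lam) ⟨n, not_le.1 h⟩
  rw [row_eq_zero_of_le le_rfl] at h3
  have h4 : (rows lam).get ⟨n, not_le.1 h⟩ ∈ lam.parts := by
    rw [← coe_rows]
    exact Multiset.mem_coe.2 (List.get_mem _ _)
  exact (lam.parts_pos h4).ne h3

lemma schur_eq_jacobiTrudi (lam : n.Partition) :
    schur lam = jacobiTrudi fun i : Fin n => row lam i := by
  have h1 : schur lam = Matrix.det (Matrix.of fun p q : Fin (rows lam).length =>
      completeInt ((row lam p : ℤ) - (p : ℤ) + (q : ℤ))) := by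
    rw [schur]
    congr 1
    ext1 p q
    rw [Matrix.of_apply, Matrix.of_apply, row, List.getD_eq_getElem _ _ p.isLt]
    rfl
  have h2 : ∀ d, Matrix.det (Matrix.of fun p q : Fin ((rows lam).length + d) =>
      completeInt ((row lam p : ℤ) - (p : ℤ) + (q : ℤ))) = schur lam := by
    intro d
    induction d with
    | zero => exact h1.symm
    | succ d ih =>
      rw [← ih, ← add_assoc, det_completeInt_succ (row lam)]
      rw [row, List.getD_eq_default _ _ (Nat.le_add_right _ _)]
  obtain ⟨d, hd⟩ := Nat.exists_eq_add_of_le (length_rows_le lam)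
  have h3 := h2 d
  rw [← hd] at h3
  exact h3.symm

lemma antitone_row (lam : n.Partition) : Antitone fun i : Fin n => row lam i := fun i j hij => by
  by_contra h
  have h1 := lt_row_iff.1 (not_le.1 h)
  exact lt_irrefl _ (lt_row_iff.2 (lt_of_le_of_lt (Fin.le_def.1 hij) h1))

lemma isWeightedHomogeneous_prod_completeInt {N : ℕ} (α : Fin N → ℤ) (d : ℕ)
    (h : ∑ i, α i = d) : (∏ i, completeInt (α i)).IsWeightedHomogeneous (powDeg 1) d := by
  by_cases hα : ∀ i, 0 ≤ α i
  · have h1 : ∑ i, (α i).toNat = d := by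
      zify
      rw [← h]
      exact Finset.sum_congr rfl fun i _ => Int.toNat_of_nonneg (hα i)
    rw [← h1]
    refine IsWeightedHomogeneous.prod _ _ (fun i => (α i).toNat) fun i _ => ?_
    rw [completeInt, if_pos (hα i)]
    exact isWeightedHomogeneous_complete _
  · push Not at hα
    obtain ⟨i, hi⟩ := hα
    rw [Finset.prod_eq_zero (Finset.mem_univ i) (completeInt_of_neg hi)]
    exact isWeightedHomogeneous_zero _ _ _

lemma sum_row (lam : n.Partition) : ∑ i : Fin n, row lam i = n := by
  rw [Fin.sum_univ_eq_sum_range (fun i => row lam i), ← sum_take_rows, List.take_of_length_le]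
  · rw [← Multiset.sum_coe, coe_rows, lam.parts_sum]
  · exact length_rows_le lam

lemma isWeightedHomogeneous_jacobiTrudi (lam : n.Partition) :
    (jacobiTrudi fun i : Fin n => row lam i).IsWeightedHomogeneous (powDeg 1) n := by
  rw [jacobiTrudi, ← Matrix.det_transpose, Matrix.det_apply, ← mem_weightedHomogeneousSubmodule]
  refine Submodule.sum_mem _ fun σ _ => ?_
  rw [Units.smul_def, ← Int.cast_smul_eq_zsmul Kt]
  refine Submodule.smul_mem _ _ ?_
  refine isWeightedHomogeneous_prod_completeInt
    (fun i => (row lam i : ℤ) - (i : ℤ) + (σ i : ℕ)) n ?_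
  rw [Finset.sum_add_distrib, Finset.sum_sub_distrib,
    Equiv.sum_comp σ fun i : Fin n => ((i : ℕ) : ℤ), sub_add_cancel, ← Nat.cast_sum, sum_row]

lemma hallForm_jacobiTrudi {N : ℕ} (f : Sym1) (r : Fin N → ℕ) :
    hallForm 1 f (jacobiTrudi r) = ∑ σ : Equiv.Perm (Fin N), ((Equiv.Perm.sign σ : ℤ) : Kt) *
      intCoeff (fun i => (r i : ℤ) - (i : ℤ) + (σ i : ℕ)) (evalVars N f) := by
  rw [jacobiTrudi, ← Matrix.det_transpose, Matrix.det_apply', map_sum]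
  refine Finset.sum_congr rfl fun σ _ => ?_
  have h2 : (((Equiv.Perm.sign σ : ℤ)) : Sym1) = C (((Equiv.Perm.sign σ : ℤ)) : Kt) := by simp
  rw [h2, ← smul_eq_C_mul, map_smul, smul_eq_mul, ← hallForm_prod_completeInt]
  rfl

/-- The pairing with `cellSchur mu` is a signed sum of coefficients at exponents lam_i - i + σ(i).
Each of these is lexicographically at least lam, so mu ≥ lam if the pairing is nonzero. The
bialternant formula bounds the monomials from the other side, and `eq_cellSchur` applies. -/
theorem schur_eq_cellSchur (lam : n.Partition) : schur lam = cellSchur lam := by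
  rw [schur_eq_jacobiTrudi]
  have hdeg := degree_leadingCoeff_jacobiTrudi (antitone_row lam)
  refine eq_cellSchur (isWeightedHomogeneous_jacobiTrudi lam) ?_ ?_ ?_
  · intro mu h
    rw [hallForm_jacobiTrudi] at h
    obtain ⟨σ, _, hσ⟩ := Finset.exists_ne_zero_of_sum_ne_zero h
    have h1 := (mul_ne_zero_iff.1 hσ).2
    rw [intCoeff, ite_ne_right_iff] at h1
    obtain ⟨hpos, h1⟩ := h1
    refine le_trans ?_ (lexKey_le_of_partial_sums
      (a := Finsupp.equivFunOnFinite.symm fun i => ((row lam i : ℤ) - (i : ℤ) + (σ i : ℕ)).toNat)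
      fun k => by
      rw [sum_rowExp_lt]; exact coeff_evalVars_cellSchur_le h1 k)
    rcases eq_or_ne σ 1 with rfl | hne
    · refine le_of_eq (congrArg lexKey ?_)
      ext i
      simp [rowExp_apply]
    -- The first index moved by σ moves up, so the exponent there exceeds lam_i while the earlier
    -- ones agree.
    · obtain ⟨i, h3, h4⟩ := exists_first_moved hne
      refine (lexKey_lt_iff.2 ⟨i, fun j hj => ?_, ?_⟩).le
      · simp [rowExp_apply, h3 j hj]
      · have := hpos i
        have h5 : (i : ℕ) < σ i := h4
        simp only [rowExp_apply, Finsupp.equivFunOnFinite_symm_apply_apply]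
        omega
  · intro nu h
    have := MonomialOrder.lex.le_degree (mem_support_iff.2 h)
    rw [hdeg.1, MonomialOrder.lex_le_iff] at this
    exact this
  · have := hdeg.2
    rw [MonomialOrder.leadingCoeff, hdeg.1] at this
    exact this

end SchurEq

/-! ## Monomial symmetric polynomials -/

section Monomial

open MvPolynomial

variable {n : ℕ}

lemma prod_map_X {σ : Type*} [DecidableEq σ] (s : Multiset σ) :
    (s.map fun x => (X x : MvPolynomial σ Kt)).prod = monomial (Multiset.toFinsupp s) 1 := by
  induction s using Multiset.induction_on with
  | empty => simp
  | cons a s ih =>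
    rw [Multiset.map_cons, Multiset.prod_cons, ih, X, monomial_mul, one_mul,
      ← Multiset.singleton_add, map_add, Multiset.toFinsupp_singleton]

lemma count_parts_ofSym {N : ℕ} (s : Sym (Fin N) n) {v : ℕ} (hv : v ≠ 0) :
    (Nat.Partition.ofSym s).parts.count v = Finset.card {i | s.1.count i = v} := by
  change Multiset.count v (s.1.dedup.map s.1.count) = _
  rw [Multiset.count_map, ← Multiset.toFinset_val, ← Finset.filter_val, Finset.card_val]
  congr 1
  ext i
  rw [Finset.mem_filter, Finset.mem_filter, Multiset.mem_toFinset, eq_comm]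
  refine ⟨fun h => ⟨Finset.mem_univ _, h.2⟩, fun h => ⟨?_, h.2⟩⟩
  rw [← Multiset.count_pos, h.2]
  exact Nat.pos_of_ne_zero hv

lemma card_parts_ofSym {N : ℕ} (s : Sym (Fin N) n) :
    (Nat.Partition.ofSym s).parts.card = Finset.card {i | s.1.count i ≠ 0} := by
  change Multiset.card (s.1.dedup.map s.1.count) = _
  rw [Multiset.card_map, ← Multiset.toFinset_val, Finset.card_val]
  congr 1
  ext i
  simp

lemma exists_perm_of_ofSym_eq {N : ℕ} {s s' : Sym (Fin N) n}
    (h : Nat.Partition.ofSym s = Nat.Partition.ofSym s') :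
    ∃ σ : Equiv.Perm (Fin N), ∀ i, s'.1.count (σ i) = s.1.count i := by
  have hc : ∀ v, Finset.card {i | s.1.count i = v} = Finset.card {i | s'.1.count i = v} := by
    intro v
    -- Multiplicity 0 is not recorded among the parts; its fibre is counted as the complement of the
    -- others.
    rcases eq_or_ne v 0 with rfl | hv
    · have h1 := card_parts_ofSym s
      have h2 := card_parts_ofSym s'
      rw [h] at h1
      have h3 := Finset.card_filter_add_card_filter_not (s := Finset.univ)
        (fun i : Fin N => s.1.count i = 0)
      have h4 := Finset.card_filter_add_card_filter_not (s := Finset.univ)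
        (fun i : Fin N => s'.1.count i = 0)
      simp only [ne_eq] at h1 h2
      omega
    · rw [← count_parts_ofSym s hv, ← count_parts_ofSym s' hv, h]
  have e : ∀ v, Nonempty ({i // s.1.count i = v} ≃ {i // s'.1.count i = v}) := fun v => by
    rw [← Fintype.card_eq, Fintype.card_subtype, Fintype.card_subtype, hc]
  exact ⟨Equiv.ofFiberEquiv fun v => (e v).some, fun i =>
    Equiv.ofFiberEquiv_map (f := fun i => s.1.count i) (g := fun i => s'.1.count i)
      (fun v => (e v).some) i⟩

/-- The exponent `rowExp lam` as a multiset. -/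
def rowSym (lam : n.Partition) : Sym (Fin n) n :=
  ⟨Finsupp.toMultiset (rowExp lam), by
    rw [Finsupp.card_toMultiset, Finsupp.sum_fintype _ _ fun _ => rfl]
    exact sum_row lam⟩

lemma count_rowSym (lam : n.Partition) (i : Fin n) : (rowSym lam).1.count i = row lam i :=
  Finsupp.count_toMultiset _ _

lemma ofSym_rowSym (lam : n.Partition) : Nat.Partition.ofSym (rowSym lam) = lam := by
  classical
  refine Nat.Partition.ext (Multiset.ext.2 fun v => ?_)
  rcases eq_or_ne v 0 with rfl | hv
  · rw [Multiset.count_eq_zero_of_notMem fun h => lt_irrefl _ (Nat.Partition.parts_pos _ h),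
      Multiset.count_eq_zero_of_notMem fun h => lt_irrefl _ (Nat.Partition.parts_pos _ h)]
  · rw [count_parts_ofSym _ hv]
    simp only [count_rowSym]
    have h1 : lam.parts = (Finset.univ : Finset (Fin (rows lam).length)).val.map (rows lam).get := by
      rw [Fin.univ_val_map, List.ofFn_get, coe_rows]
    rw [h1, Multiset.count_map, ← Finset.filter_val, Finset.card_val]
    refine (Finset.card_bij (fun i _ => Fin.castLE (length_rows_le lam) i) ?_ ?_ ?_).symm
    · intro i hi
      simp only [Finset.mem_filter, Finset.mem_univ, true_and, Fin.val_castLE] at hi ⊢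
      rw [row_of_lt, hi]
    · intro i _ j _ hij
      exact Fin.castLE_injective _ hij
    · intro i hi
      simp only [Finset.mem_filter, Finset.mem_univ, true_and] at hi
      have hlt : (i : ℕ) < (rows lam).length := by
        by_contra hge
        rw [row, List.getD_eq_default _ _ (not_lt.1 hge)] at hi
        exact hv hi.symm
      refine ⟨⟨i, hlt⟩, ?_, rfl⟩
      simp only [Finset.mem_filter, Finset.mem_univ, true_and]
      rw [← hi, ← row_of_lt (lam := lam) ⟨i, hlt⟩]

lemma coeff_msymm {N : ℕ} (s : Sym (Fin N) n) (mu : n.Partition) :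
    coeff (Multiset.toFinsupp s.1) (msymm (Fin N) Kt mu) =
      if Nat.Partition.ofSym s = mu then 1 else 0 := by
  rw [msymm, coeff_sum]
  have h1 : ∀ s' : {a : Sym (Fin N) n // Nat.Partition.ofSym a = mu},
      coeff (Multiset.toFinsupp s.1) ((s'.1.1.map X).prod : MvPolynomial (Fin N) Kt) =
      if s'.1 = s then 1 else 0 := by
    intro s'
    rw [prod_map_X, coeff_monomial]
    refine if_congr ?_ rfl rfl
    rw [EmbeddingLike.apply_eq_iff_eq]
    exact Subtype.ext_iff.symm
  simp only [h1]
  split_ifs with h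
  · rw [Finset.sum_eq_single ⟨s, h⟩]
    · simp
    · intro s' _ hne
      exact if_neg fun h2 => hne (Subtype.ext h2)
    · simp
  · refine Finset.sum_eq_zero fun s' _ => if_neg fun h2 => h ?_
    rw [← h2, s'.2]

lemma coeff_rowExp_msymm (lam mu : n.Partition) :
    coeff (rowExp lam) (msymm (Fin n) Kt mu) = if lam = mu then 1 else 0 := by
  have h := coeff_msymm (rowSym lam) mu
  rw [ofSym_rowSym, rowSym, Finsupp.toMultiset_toFinsupp] at h
  exact h

lemma sum_eq_of_coeff_msymm_ne_zero {N : ℕ} {a : Fin N →₀ ℕ} {mu : n.Partition}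
    (h : coeff a (msymm (Fin N) Kt mu) ≠ 0) : ∑ i, a i = n := by
  rw [msymm, coeff_sum] at h
  obtain ⟨s, _, hs⟩ := Finset.exists_ne_zero_of_sum_ne_zero h
  rw [prod_map_X, coeff_monomial, ite_ne_right_iff] at hs
  rw [← hs.1]
  refine Eq.trans ?_ s.1.2
  simp

/-- Symmetric polynomials are combinations of monomial symmetric polynomials. -/
lemma eq_sum_coeff_smul_msymm {p : MvPolynomial (Fin n) Kt} (hp : p.IsSymmetric)
    (hd : ∀ a, coeff a p ≠ 0 → ∑ i, a i = n) :
    p = ∑ mu : n.Partition, coeff (rowExp mu) p • msymm (Fin n) Kt mu := by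
  ext a
  rw [coeff_sum]
  simp only [coeff_smul, smul_eq_mul]
  by_cases ha : ∑ i, a i = n
  · let s : Sym (Fin n) n := ⟨Finsupp.toMultiset a, by
      rw [Finsupp.card_toMultiset, Finsupp.sum_fintype _ _ fun _ => rfl]; exact ha⟩
    have h1 : Multiset.toFinsupp s.1 = a := Finsupp.toMultiset_toFinsupp a
    obtain ⟨σ, hσ⟩ := exists_perm_of_ofSym_eq (ofSym_rowSym (Nat.Partition.ofSym s))
    -- The exponent `a` rearranges a sorted one, so the symmetry of `p` equates the two
    -- coefficients.
    have h2 : (rowExp (Nat.Partition.ofSym s)).mapDomain σ = a := by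
      ext i
      obtain ⟨j, rfl⟩ := σ.surjective i
      rw [Finsupp.mapDomain_apply σ.injective, ← h1, Multiset.toFinsupp_apply, hσ, count_rowSym,
        rowExp_apply]
    rw [Finset.sum_eq_single (Nat.Partition.ofSym s)]
    · have h3 := coeff_msymm s (Nat.Partition.ofSym s)
      rw [if_pos rfl, h1] at h3
      rw [h3, mul_one]
      have h4 := coeff_rename_mapDomain σ σ.injective p (rowExp (Nat.Partition.ofSym s))
      rw [h2, hp σ] at h4
      exact h4
    · intro mu _ hne
      have h3 := coeff_msymm s mu
      rw [if_neg (Ne.symm hne), h1] at h3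
      rw [h3, mul_zero]
    · simp
  · rw [Finset.sum_eq_zero fun mu _ => ?_]
    · by_contra h
      exact ha (hd a h)
    · by_contra h
      exact ha (sum_eq_of_coeff_msymm_ne_zero (mul_ne_zero_iff.1 h).2)

lemma isSymmetric_evalVars {N : ℕ} (f : Sym1) : (evalVars N f).IsSymmetric := by
  intro e
  have h : (rename (R := Kt) e).comp (evalVars N) = evalVars N := by
    refine algHom_ext fun x => ?_
    rw [AlgHom.comp_apply, evalVars, aeval_X]
    exact psum_isSymmetric _ _ _ e
  exact DFunLike.congr_fun h f

lemma sum_eq_of_coeff_evalVars_cellSchur_ne_zero {N : ℕ} {lam : n.Partition} {a : Fin N →₀ ℕ}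
    (h : coeff a (evalVars N (cellSchur lam)) ≠ 0) : ∑ i, a i = n := by
  classical
  rw [cellSchur, tabSchur, map_smul, coeff_smul, coeff_evalVars_tabSym, smul_eq_mul] at h
  have h1 := (mul_ne_zero_iff.1 h).2
  rw [Ne, map_eq_zero] at h1
  obtain ⟨f, _, hf⟩ := Finset.exists_ne_zero_of_sum_ne_zero h1
  rw [ite_ne_right_iff] at hf
  rw [← hf.1, content]
  simp only [Finsupp.finsetSum_apply]
  rw [Finset.sum_comm]
  simp only [Finsupp.single_apply, Finset.sum_ite_eq, Finset.mem_univ, if_true,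
    Finset.sum_const, smul_eq_mul, mul_one]
  exact card_cell lam

end Monomial

/-! ## Macdonald functions at equal parameters -/

section Macdonald

open MvPolynomial

variable {n : ℕ}

/-- Each factor (1 - u^r)/(1 - u^r) is 1; `hu` is needed because a vanishing denominator would make
it 0. -/
lemma macInner_self_eq_hallForm {u : Kt} (hu : ∀ r, 0 < r → u ^ r ≠ 1) {f : Sym1} (g : Sym1)
    (hf : f.IsWeightedHomogeneous (powDeg 1) n) : macInner n u u f g = hallForm 1 f g := by
  have h1 : f = ∑ mu : n.Partition, monomial (powExponent mu) (coeff (powExponent mu) f) := by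
    ext m
    rw [coeff_sum]
    simp only [coeff_monomial]
    by_cases hm : coeff m f = 0
    · rw [hm, Finset.sum_eq_zero]
      intro mu _
      split_ifs with h
      · rw [h, hm]
      · rfl
    · obtain ⟨mu, rfl⟩ := exists_powExponent_eq (hf hm)
      rw [Finset.sum_eq_single mu]
      · rw [if_pos rfl]
      · intro nu _ hne
        exact if_neg fun h => hne (powExponent_injective h)
      · simp
  conv_rhs => rw [h1]
  rw [map_sum, LinearMap.sum_apply, macInner]
  refine Finset.sum_congr rfl fun mu _ => ?_
  rw [hallForm, hall_monomial, hallNorm_powExponent, Multiset.prod_eq_one]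
  · ring
  · intro x hx
    obtain ⟨r, hr, rfl⟩ := Multiset.mem_map.1 hx
    exact div_self (sub_ne_zero.2 (hu r (mu.parts_pos hr)).symm)

lemma isMacdonaldFamily_cellSchur {u : Kt} (hu : ∀ r, 0 < r → u ^ r ≠ 1) :
    IsMacdonaldFamily n u u cellSchur where
  homogeneous := isWeightedHomogeneous_cellSchur
  triangular lam := by
    classical
    refine ⟨fun mu => if mu = lam then 0 else coeff (rowExp mu) (evalVars n (cellSchur lam)),
      fun mu h => ?_, ?_⟩
    · rw [Ne, ite_eq_left_iff, not_forall] at h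
      exact ⟨dominated_of_coeff_ne_zero h.2, h.1⟩
    · conv_lhs => rw [eq_sum_coeff_smul_msymm (isSymmetric_evalVars (cellSchur lam))
        fun a => sum_eq_of_coeff_evalVars_cellSchur_ne_zero]
      rw [← Finset.add_sum_erase _ _ (Finset.mem_univ lam), coeff_rowExp_evalVars_cellSchur,
        one_smul]
      congr 1
      rw [← Finset.add_sum_erase _ (fun mu => (if mu = lam then (0 : Kt) else _) • _)
        (Finset.mem_univ lam), if_pos rfl, zero_smul, zero_add]
      refine Finset.sum_congr rfl fun mu hmu => ?_
      rw [if_neg (Finset.ne_of_mem_erase hmu)]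
  orthogonal lam mu hne := by
    rw [macInner_self_eq_hallForm hu _ (isWeightedHomogeneous_cellSchur lam), hallForm_cellSchur,
      if_neg hne]

/-- Gram–Schmidt along the lexicographic order: orthogonality to the smaller members, already known
to be `cellSchur`, leaves only mu ≥ lam in the expansion, and unitriangularity in monomials bounds
it from above. -/
lemma IsMacdonaldFamily.eq_cellSchur {u : Kt} (hu : ∀ r, 0 < r → u ^ r ≠ 1)
    {P : n.Partition → Sym1} (hP : IsMacdonaldFamily n u u P) (lam : n.Partition) :
    P lam = cellSchur lam := by
  classical
  -- The set `L` contains all partitions lexicographically below lam; its shrinking drives the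
  -- strong induction.
  have key : ∀ (L : Finset n.Partition) (lam : n.Partition),
      (∀ mu, lexKey (rowExp mu) < lexKey (rowExp lam) → mu ∈ L) → P lam = cellSchur lam := by
    intro L
    induction L using Finset.strongInduction with
    | H L ih =>
      intro lam hL
      have hcoeff := hP.triangular lam
      obtain ⟨u', h1, h2⟩ := hcoeff
      have h3 : ∀ nu, coeff (rowExp nu) (evalVars n (P lam)) =
          (if nu = lam then 1 else 0) + u' nu := by
        intro nu
        rw [h2, coeff_add, coeff_sum, coeff_rowExp_msymm]
        simp only [coeff_smul, coeff_rowExp_msymm, smul_eq_mul]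
        simp
      refine WreathKM.eq_cellSchur (hP.homogeneous lam) ?_ ?_ ?_
      · intro mu hmu
        by_contra hlt
        rw [not_le] at hlt
        have hmem := hL mu hlt
        have h4 := ih (L.erase mu) (Finset.erase_ssubset hmem) mu fun nu hnu =>
          Finset.mem_erase.2 ⟨fun h => by rw [h] at hnu; exact lt_irrefl _ hnu,
            hL nu (hnu.trans hlt)⟩
        rw [← h4, ← macInner_self_eq_hallForm hu _ (hP.homogeneous mu)] at hmu
        exact hmu (hP.orthogonal mu lam fun h => by rw [h] at hlt; exact lt_irrefl _ hlt)
      · intro nu hnu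
        rw [h3] at hnu
        rcases eq_or_ne nu lam with rfl | hne
        · exact le_rfl
        · rw [if_neg hne, zero_add] at hnu
          exact (h1 nu hnu).1.lexKey_le
      · rw [h3, if_pos rfl]
        by_contra h
        exact (h1 lam fun h0 => h (by rw [h0, add_zero])).2 rfl
  exact key Finset.univ lam fun mu _ => Finset.mem_univ mu

/-- The family exists and is unique, so the choice in the definition is harmless. -/
lemma macdonaldP_self {u : Kt} (hu : ∀ r, 0 < r → u ^ r ≠ 1) (lam : n.Partition) :
    macdonaldP u u lam = schur lam := by
  have h : ∃ P : n.Partition → Sym1, IsMacdonaldFamily n u u P :=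
    ⟨_, isMacdonaldFamily_cellSchur hu⟩
  rw [macdonaldP, dif_pos h, h.choose_spec.eq_cellSchur hu, schur_eq_cellSchur]

lemma plethysm_smul {l : ℕ} (c : Kt) (f : Sym1) (g : MultiSym l) :
    plethysm (c • f) g = c • plethysm f g := map_smul _ _ _

/-- The powers u^b and u^{-b} cancel, both parameters of J become u, and the exponent arm + leg + 1
is the hook length. -/
lemma typeAG_eq {u : Kt} (h0 : u ≠ 0) (hu : ∀ r, 0 < r → u ^ r ≠ 1) (lam : n.Partition) :
    typeAG u lam = hookPoly lam u •
      plethysm (schur lam) ((1 - u)⁻¹ • alphabet (0 : Fin 1)) := by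
  rw [typeAG, macdonaldH, inv_inv, smul_smul, ← mul_pow, mul_inv_cancel₀ h0, one_pow, one_smul,
    macdonaldJ, plethysm_smul, macdonaldP_self hu, hookPoly]
  congr 1
  refine Finset.prod_congr rfl fun s _ => ?_
  rw [← pow_add, hookLength]
  congr 2
  ring

lemma tt_ne_zero : tt ≠ 0 := RatFunc.X_ne_zero

lemma scalarAdams_tt (r : ℕ+) : scalarAdams r tt = tt ^ (r : ℕ) := by
  have h := RatFunc.map_apply_div (Polynomial.expand ℂ (r : ℕ)) (expand_mem_nonZeroDivisors r)
    Polynomial.X 1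
  rw [map_one, div_one, map_one, map_one, div_one, RatFunc.algebraMap_X, Polynomial.expand_X,
    map_pow, RatFunc.algebraMap_X] at h
  exact h

lemma tt_pow_ne_C {r : ℕ} (hr : 0 < r) (c : ℂ) : tt ^ r ≠ RatFunc.C c := by
  intro h
  have h1 : algebraMap (Polynomial ℂ) Kt (Polynomial.X ^ r) =
      algebraMap (Polynomial ℂ) Kt (Polynomial.C c) := by
    rw [map_pow, RatFunc.algebraMap_X, RatFunc.algebraMap_C]; exact h
  have h2 := congrArg Polynomial.natDegree (RatFunc.algebraMap_injective ℂ h1)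
  rw [Polynomial.natDegree_X_pow, Polynomial.natDegree_C] at h2
  omega

lemma tt_pow_ne_one {r : ℕ} (hr : 0 < r) : tt ^ r ≠ 1 := by
  have := tt_pow_ne_C hr 1
  rwa [map_one] at this

lemma adams_C {l : ℕ} (r : ℕ+) (c : Kt) : adams (l := l) r (C c) = C (scalarAdams r c) := by
  rw [adams, coe_eval₂Hom, eval₂_C]; rfl

lemma adams_X {l : ℕ} (r : ℕ+) (x : Fin l × ℕ+) :
    adams (l := l) r (X x) = X (x.1, r * x.2) := by
  rw [adams, coe_eval₂Hom, eval₂_X]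

lemma adams_alphabet {l : ℕ} (r : ℕ+) (j : Fin l) :
    adams r (alphabet j) = X (j, r) := by
  rw [alphabet, pow, adams_X]
  have : r * Nat.toPNat' 1 = r := mul_one r
  rw [this]

/-- The image of the power sum `p_r[X^(p)]` under the substitution `X^(p) ↦ Z^(p) / (1 - t^l)`. -/
def zSub (l : ℕ) (x : Fin l × ℕ+) : MultiSym l :=
  (1 - tt ^ (l * (x.2 : ℕ)))⁻¹ •
    ∑ i : Fin l, (tt ^ (((i - x.1 : Fin l) : ℕ) * (x.2 : ℕ))) • X (i, x.2)

/-- Dividing the alphabet by 1 - t^l and then inserting Z^(j) is one substitution of power sums, the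
same for all components, so it passes through the product of Schur functions. -/
lemma multiG_eq {l n : ℕ} [NeZero l] (lam : MultiPartition l n) :
    multiG lam = (∏ j, hookPoly (lam.2 j) (tt ^ l)) • aeval (zSub l) (multiSchur lam) := by
  have hl : 0 < l := Nat.pos_of_ne_zero (NeZero.ne l)
  have hu : ∀ r, 0 < r → (tt ^ l) ^ r ≠ 1 := fun r hr => by
    rw [← pow_mul]; exact tt_pow_ne_one (Nat.mul_pos hl hr)
  have h1 : ∀ j, plethysm (typeAG (tt ^ l) (lam.2 j)) (zAlphabet j) =
      C (hookPoly (lam.2 j) (tt ^ l)) *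
        aeval (zSub l) (plethysm (schur (lam.2 j)) (alphabet j)) := by
    intro j
    rw [typeAG_eq (pow_ne_zero _ tt_ne_zero) hu, plethysm_smul, smul_eq_C_mul]
    congr 1
    simp only [plethysm, adams_alphabet]
    rw [← AlgHom.comp_apply, ← AlgHom.comp_apply, comp_aeval, comp_aeval]
    congr 2
    funext x
    rw [aeval_X, smul_eq_C_mul, map_mul, adams_C, adams_alphabet, map_mul, aeval_X, zSub,
      map_inv₀, map_sub, map_one, map_pow, scalarAdams_tt, ← pow_mul, mul_comm _ l,
      aeval_C, smul_eq_C_mul, algebraMap_eq]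
    congr 1
    rw [zAlphabet, map_sum]
    refine Finset.sum_congr rfl fun i _ => ?_
    rw [smul_eq_C_mul, map_mul, adams_C, map_pow, scalarAdams_tt, ← pow_mul, mul_comm (x.2 : ℕ),
      adams_alphabet, smul_eq_C_mul]
  rw [multiG, multiSchur, map_prod, Finset.prod_congr rfl fun j _ => h1 j,
    Finset.prod_mul_distrib, smul_eq_C_mul, map_prod]

end Macdonald

/-! ## Multi-Schur functions as symmetric functions of tableaux -/

section SigmaPerm

open MvPolynomial Equiv

variable {l : ℕ} {α : Fin l → Type} [∀ j, Fintype (α j)] [∀ j, DecidableEq (α j)]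

/-- A family of functions on the components, refined by the component. -/
def sigmaMap {A : Type} (f : ∀ j, α j → A) (s : Σ j, α j) : Fin l × A := (s.1, f s.1 s.2)

lemma exists_eq_sigmaCongrRight {β : Fin l → Type} (g : (Σ j, α j) ≃ Σ j, β j)
    (hg : ∀ s, (g s).1 = s.1) : ∃ γ : ∀ j, α j ≃ β j, g = Equiv.sigmaCongrRight γ := by
  have hg' : ∀ s, (g.symm s).1 = s.1 := fun s => by rw [← hg, apply_symm_apply]
  have h1 : ∀ j (x : α j), ∃ y : β j, g ⟨j, x⟩ = ⟨j, y⟩ := fun j x => by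
    have h := hg ⟨j, x⟩
    generalize g ⟨j, x⟩ = s at h ⊢
    obtain ⟨i, y⟩ := s
    obtain rfl : i = j := h
    exact ⟨y, rfl⟩
  have h2 : ∀ j (y : β j), ∃ x : α j, g.symm ⟨j, y⟩ = ⟨j, x⟩ := fun j y => by
    have h := hg' ⟨j, y⟩
    generalize g.symm ⟨j, y⟩ = s at h ⊢
    obtain ⟨i, x⟩ := s
    obtain rfl : i = j := h
    exact ⟨x, rfl⟩
  choose γ hγ using h1
  choose δ hδ using h2
  refine ⟨fun j => ⟨γ j, δ j, fun x => ?_, fun y => ?_⟩, Equiv.ext fun s => hγ s.1 s.2⟩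
  · have := hδ j (γ j x)
    rw [← hγ, symm_apply_apply] at this
    exact (eq_of_heq (Sigma.mk.inj this).2).symm
  · have := hγ j (δ j y)
    rw [← hδ, apply_symm_apply] at this
    exact (eq_of_heq (Sigma.mk.inj this).2).symm

/-- The permutation of the disjoint union given by a family of permutations. -/
abbrev sigmaPerm (σ : ∀ j, Perm (α j)) : Perm (Σ j, α j) := Perm.sigmaCongrRight σ

lemma sigmaPerm_mk (σ : ∀ j, Perm (α j)) (j : Fin l) (x : α j) :
    sigmaPerm σ ⟨j, x⟩ = ⟨j, σ j x⟩ := rfl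

lemma sigmaPerm_mul (σ τ : ∀ j, Perm (α j)) :
    sigmaPerm σ * sigmaPerm τ = sigmaPerm fun j => σ j * τ j := rfl

lemma sigmaPerm_eq_one {σ : ∀ j, Perm (α j)} : sigmaPerm σ = 1 ↔ ∀ j, σ j = 1 := by
  constructor
  · intro h j
    ext x
    have := congrArg (fun f : Perm (Σ j, α j) => f ⟨j, x⟩) h
    exact eq_of_heq (Sigma.mk.inj this).2
  · intro h
    ext1 s
    rw [show s = ⟨s.1, s.2⟩ from rfl, sigmaPerm_mk, h]
    rfl

lemma sigmaPerm_zpow (σ : ∀ j, Perm (α j)) (i : ℤ) :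
    sigmaPerm σ ^ i = sigmaPerm fun j => σ j ^ i :=
  (map_zpow (Perm.sigmaCongrRightHom α) σ i).symm

lemma csign_sigmaPerm (σ : ∀ j, Perm (α j)) : csign (sigmaPerm σ) = ∏ j, csign (σ j) := by
  have h1 : ∀ i (x : Perm (α i)), csign (sigmaPerm (Pi.mulSingle i x)) = csign x := by
    intro i x
    rw [csign, csign, Perm.sign_bij (f := x) (g := sigmaPerm (Pi.mulSingle i x))
      (fun y _ => (⟨i, y⟩ : Σ j, α j))]
    · intro y _ _
      rw [sigmaPerm_mk, Pi.mulSingle_eq_same]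
    · intro y z _ _ h
      exact eq_of_heq (Sigma.mk.inj h).2
    · rintro ⟨j, y⟩ hy
      rw [sigmaPerm_mk] at hy
      rcases eq_or_ne j i with rfl | hj
      · rw [Pi.mulSingle_eq_same] at hy
        exact ⟨y, fun h => hy (by rw [h]), rfl⟩
      · rw [Pi.mulSingle_eq_of_ne hj] at hy
        exact (hy rfl).elim
  -- Induction on a set `S` of components outside of which σ is trivial, splitting off one component
  -- at a time.
  have h2 : ∀ (S : Finset (Fin l)) (σ : ∀ j, Perm (α j)), (∀ j, j ∉ S → σ j = 1) →
      csign (sigmaPerm σ) = ∏ j ∈ S, csign (σ j) := by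
    intro S
    induction S using Finset.induction_on with
    | empty =>
      intro σ hσ
      rw [sigmaPerm_eq_one.2 fun j => hσ j (Finset.notMem_empty j), csign_one, Finset.prod_empty]
    | insert a S ha ih =>
      intro σ hσ
      have h3 : σ = fun j => (Pi.mulSingle a (σ a) : ∀ j, Perm (α j)) j *
          Function.update σ a 1 j := by
        funext j
        rcases eq_or_ne j a with rfl | hj
        · rw [Pi.mulSingle_eq_same, Function.update_self, mul_one]
        · rw [Pi.mulSingle_eq_of_ne hj, Function.update_of_ne hj, one_mul]
      rw [Finset.prod_insert ha]
      conv_lhs => rw [h3]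
      rw [← sigmaPerm_mul, csign_mul, h1, ih]
      · congr 1
        refine Finset.prod_congr rfl fun j hj => ?_
        rw [Function.update_of_ne (ne_of_mem_of_not_mem hj ha)]
      · intro j hj
        rcases eq_or_ne j a with rfl | hja
        · rw [Function.update_self]
        · rw [Function.update_of_ne hja]
          exact hσ j fun h => (Finset.mem_insert.1 h).elim hja hj
  exact h2 Finset.univ σ fun j hj => (hj (Finset.mem_univ j)).elim

lemma sigmaPerm_mem_fixers {A : Type} (f : ∀ j, α j → A) (σ : ∀ j, Perm (α j)) :
    sigmaPerm σ ∈ fixers (sigmaMap f) ↔ ∀ j, σ j ∈ fixers (f j) := by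
  simp only [mem_fixers]
  constructor
  · intro h j x
    exact congrArg Prod.snd (h ⟨j, x⟩)
  · rintro h ⟨j, x⟩
    exact Prod.ext rfl (h j x)

lemma sum_fixers_sigmaMap {A M : Type} [AddCommMonoid M] (f : ∀ j, α j → A)
    (F : Perm (Σ j, α j) → M) :
    ∑ π ∈ fixers (sigmaMap f), F π =
      ∑ σ ∈ Fintype.piFinset fun j => fixers (f j), F (sigmaPerm σ) := by
  refine (Finset.sum_bij (fun σ _ => sigmaPerm σ) ?_ ?_ ?_ ?_).symm
  · intro σ hσ
    exact (sigmaPerm_mem_fixers f σ).2 (Fintype.mem_piFinset.1 hσ)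
  · intro σ _ τ _ h
    funext j
    ext x
    have := congrArg (fun f : Perm (Σ j, α j) => f ⟨j, x⟩) h
    exact eq_of_heq (Sigma.mk.inj this).2
  · intro π hπ
    obtain ⟨γ, rfl⟩ := exists_eq_sigmaCongrRight π fun s =>
      congrArg Prod.fst (mem_fixers.1 hπ s)
    exact ⟨γ, Fintype.mem_piFinset.2 ((sigmaPerm_mem_fixers f γ).1 hπ), rfl⟩
  · intro σ _
    rfl

lemma orbMk_sigmaPerm_eq_iff (σ : ∀ j, Perm (α j)) (i j : Fin l) (x : α i) (y : α j) :
    orbMk (sigmaPerm σ) ⟨i, x⟩ = orbMk (sigmaPerm σ) ⟨j, y⟩ ↔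
      ∃ h : i = j, orbMk (σ j) (h ▸ x) = orbMk (σ j) y := by
  rw [orbMk_eq_iff]
  constructor
  · rintro ⟨m, hm⟩
    rw [sigmaPerm_zpow, sigmaPerm_mk] at hm
    obtain ⟨rfl, h2⟩ := Sigma.mk.inj hm
    exact ⟨rfl, orbMk_eq_iff.2 ⟨m, eq_of_heq h2⟩⟩
  · rintro ⟨rfl, h⟩
    obtain ⟨m, hm⟩ := orbMk_eq_iff.1 h
    refine ⟨m, ?_⟩
    rw [sigmaPerm_zpow, sigmaPerm_mk, hm]

lemma orbSize_sigmaPerm (σ : ∀ j, Perm (α j)) (j : Fin l) (x : α j) :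
    orbSize (orbMk (sigmaPerm σ) ⟨j, x⟩) = orbSize (orbMk (σ j) x) := by
  classical
  rw [orbSize, orbSize]
  refine (Finset.card_bij (fun y _ => ⟨j, y⟩) ?_ ?_ ?_).symm
  · intro y hy
    rw [Finset.mem_filter] at hy ⊢
    exact ⟨Finset.mem_univ _, (orbMk_sigmaPerm_eq_iff σ j j y x).2 ⟨rfl, hy.2⟩⟩
  · intro y _ z _ h
    exact eq_of_heq (Sigma.mk.inj h).2
  · rintro ⟨i, y⟩ hy
    obtain ⟨rfl, h⟩ := (orbMk_sigmaPerm_eq_iff σ i j y x).1 (Finset.mem_filter.1 hy).2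
    exact ⟨y, Finset.mem_filter.2 ⟨Finset.mem_univ _, h⟩, rfl⟩

/-- The cycles of a permutation of a disjoint union that acts componentwise are the cycles of its
components. -/
lemma permPow_sigmaPerm (σ : ∀ j, Perm (α j)) :
    permPow (fun s : Σ j, α j => s.1) (sigmaPerm σ) = ∏ j, permPow (fun _ : α j => j) (σ j) := by
  classical
  simp only [permPow]
  rw [← Fintype.prod_sigma']
  refine (Fintype.prod_bijective
    (fun s : Σ j, Orb (σ j) => orbMk (sigmaPerm σ) ⟨s.1, s.2.out⟩) ⟨?_, ?_⟩ _ _ ?_).symm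
  · rintro ⟨i, o⟩ ⟨j, o'⟩ h
    obtain ⟨rfl, h⟩ := (orbMk_sigmaPerm_eq_iff σ i j _ _).1 h
    have h' : orbMk (σ i) o.out = orbMk (σ i) o'.out := h
    rw [orbMk_out, orbMk_out] at h'
    rw [h']
  · intro o
    refine ⟨⟨o.out.1, orbMk (σ o.out.1) o.out.2⟩, ?_⟩
    conv_rhs => rw [← orbMk_out o]
    exact (orbMk_sigmaPerm_eq_iff σ _ _ _ _).2 ⟨rfl, orbMk_out _⟩
  · rintro ⟨j, o⟩
    dsimp only
    rw [orbSize_sigmaPerm, orbMk_out]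
    congr 2
    exact (apply_orbMk_out (f := fun s : Σ j, α j => s.1) (ρ := sigmaPerm σ) (fun s => rfl)
      ⟨j, o.out⟩).symm

end SigmaPerm

/-! ### Expansions over row and column permutations -/

section TabSums

open MvPolynomial Equiv

variable {α A A' : Type} [Fintype α] [DecidableEq α]

lemma tabSym_eq_sum {l : ℕ} (comp : α → Fin l) (row : α → A) (col : α → A') :
    tabSym comp row col = ∑ σ ∈ fixers row, ∑ τ ∈ fixers col,
      C (RatFunc.C (csign τ) : Kt) * permPow comp (σ * τ) := by
  simp only [tabSym, youngElt_coeff, map_sum, Finset.sum_smul]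
  rw [Finset.sum_comm]
  refine Finset.sum_congr rfl fun σ _ => ?_
  rw [Finset.sum_comm]
  refine Finset.sum_congr rfl fun τ _ => ?_
  rw [Finset.sum_eq_single (σ * τ)]
  · rw [if_pos rfl, smul_eq_C_mul]
  · intro π _ h
    rw [if_neg (Ne.symm h), map_zero, zero_smul]
  · simp

lemma youngConst_eq_sum_ite (row : α → A) (col : α → A') :
    youngConst row col = ∑ σ ∈ fixers row, ∑ τ ∈ fixers col, ∑ σ' ∈ fixers row,
      ∑ τ' ∈ fixers col, if σ * τ * (σ' * τ') = 1 then csign τ * csign τ' else 0 := by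
  classical
  rw [youngConst]
  nth_rw 1 [youngElt]
  simp only [Finset.sum_mul]
  simp only [youngElt, Finset.mul_sum, MonoidAlgebra.single_mul_single,
    MonoidAlgebra.coeff_sum, Finsupp.finsetSum_apply, MonoidAlgebra.coeff_single,
    Finsupp.single_apply]

end TabSums

/-! ### Tableaux on disjoint unions -/

section SigmaTab

open MvPolynomial Equiv

variable {l : ℕ} {α : Fin l → Type} [∀ j, Fintype (α j)] [∀ j, DecidableEq (α j)] {A A' : Type}
  (row : ∀ j, α j → A) (col : ∀ j, α j → A')

lemma youngConst_sigmaMap :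
    youngConst (sigmaMap row) (sigmaMap col) = ∏ j, youngConst (row j) (col j) := by
  simp only [youngConst_eq_sum_ite, sum_fixers_sigmaMap, Finset.prod_univ_sum, sigmaPerm_mul,
    sigmaPerm_eq_one, csign_sigmaPerm, ← Finset.prod_mul_distrib]
  refine Finset.sum_congr rfl fun σ _ => Finset.sum_congr rfl fun τ _ =>
    Finset.sum_congr rfl fun σ' _ => Finset.sum_congr rfl fun τ' _ => ?_
  by_cases h : ∀ j, σ j * τ j * (σ' j * τ' j) = 1
  · rw [if_pos h]
    exact Finset.prod_congr rfl fun j _ => (if_pos (h j)).symm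
  · rw [if_neg h]
    obtain ⟨j, hj⟩ := not_forall.1 h
    exact (Finset.prod_eq_zero (Finset.mem_univ j) (if_neg hj)).symm

lemma tabSym_sigmaMap :
    tabSym (fun s : Σ j, α j => s.1) (sigmaMap row) (sigmaMap col) =
      ∏ j, tabSym (fun _ : α j => j) (row j) (col j) := by
  simp only [tabSym_eq_sum, sum_fixers_sigmaMap, Finset.prod_univ_sum, sigmaPerm_mul,
    csign_sigmaPerm, Finset.prod_mul_distrib, permPow_sigmaPerm, map_prod]

lemma tabSchur_sigmaMap :
    tabSchur (fun s : Σ j, α j => s.1) (sigmaMap row) (sigmaMap col) =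
      ∏ j, tabSchur (fun _ : α j => j) (row j) (col j) := by
  simp only [tabSchur, smul_eq_C_mul, tabSym_sigmaMap, youngConst_sigmaMap,
    Finset.prod_mul_distrib, map_prod, ← map_inv₀, ← Finset.prod_inv_distrib]

lemma isTableau_sigmaMap (h : ∀ j, IsTableau (fun _ : α j => (0 : Fin 1)) (row j) (col j)) :
    IsTableau (fun s : Σ j, α j => s.1) (sigmaMap row) (sigmaMap col) where
  row_comp _ _ h := congrArg Prod.fst h
  col_comp _ _ h := congrArg Prod.fst h
  inj := by
    rintro ⟨i, x⟩ ⟨j, y⟩ h1 h2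
    obtain rfl : i = j := congrArg Prod.fst h1
    rw [(h i).inj x y (congrArg Prod.snd h1) (congrArg Prod.snd h2)]
  factor g hg := by
    obtain ⟨γ, rfl⟩ := exists_eq_sigmaCongrRight g hg
    by_cases hr : ∃ j, ∃ a b, a ≠ b ∧ col j a = col j b ∧ row j (γ j a) = row j (γ j b)
    · obtain ⟨j, a, b, hab, hc, hr⟩ := hr
      refine Or.inr ⟨⟨j, a⟩, ⟨j, b⟩, fun h => hab (eq_of_heq (Sigma.mk.inj h).2),
        Prod.ext rfl hc, Prod.ext rfl hr⟩
    · have h1 : ∀ j, ∃ σ ∈ fixers (row j), ∃ τ ∈ fixers (col j), γ j = σ * τ := fun j =>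
        ((h j).factor (γ j) fun _ => rfl).resolve_right fun h2 => hr ⟨j, h2⟩
      choose σ hσ τ hτ h2 using h1
      refine Or.inl ⟨sigmaPerm σ, (sigmaPerm_mem_fixers row σ).2 hσ, sigmaPerm τ,
        (sigmaPerm_mem_fixers col τ).2 hτ, ?_⟩
      rw [sigmaPerm_mul, ← funext h2]

end SigmaTab

/-! ### Orthonormality and spanning of multi-Schur functions -/

section MultiSchur

open MvPolynomial Equiv

variable {l n : ℕ}

/-- The row of a box of a multipartition, with its component. -/
def multiRow (lam : MultiPartition l n) : MultiCell lam → Fin l × ℕ := sigmaMap fun _ => cellRow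

/-- The column of a box of a multipartition, with its component. -/
def multiCol (lam : MultiPartition l n) : MultiCell lam → Fin l × ℕ := sigmaMap fun _ => cellCol

/-- The component of a box of a multipartition. -/
def multiComp (lam : MultiPartition l n) : MultiCell lam → Fin l := fun s => s.1

lemma isTableau_multi (lam : MultiPartition l n) :
    IsTableau (multiComp lam) (multiRow lam) (multiCol lam) :=
  isTableau_sigmaMap _ _ fun j => isTableau_cell (lam.2 j)

lemma plethysm_cellSchur_alphabet {n : ℕ} (lam : n.Partition) (j : Fin l) :
    plethysm (cellSchur lam) (alphabet j) =
      tabSchur (fun _ : Cell lam => j) cellRow cellCol := by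
  have h : ∀ π : Perm (Cell lam), plethysm (permPow (fun _ : Cell lam => (0 : Fin 1)) π)
      (alphabet j) = permPow (fun _ : Cell lam => j) π := by
    intro π
    simp only [plethysm, permPow, map_prod, aeval_X, adams_alphabet]
  rw [cellSchur, tabSchur, plethysm_smul, tabSym, tabSchur, tabSym]
  congr 1
  rw [plethysm, map_sum]
  exact Finset.sum_congr rfl fun π _ => by rw [map_smul, ← h]; rfl

lemma multiSchur_eq_tabSchur (lam : MultiPartition l n) :
    multiSchur lam = tabSchur (multiComp lam) (multiRow lam) (multiCol lam) := by
  rw [multiSchur]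
  simp only [schur_eq_cellSchur, plethysm_cellSchur_alphabet]
  exact (tabSchur_sigmaMap _ _).symm

lemma isWeightedHomogeneous_multiSchur (lam : MultiPartition l n) :
    (multiSchur lam).IsWeightedHomogeneous (powDeg l) n := by
  have h := isWeightedHomogeneous_tabSchur (multiComp lam) (multiRow lam) (multiCol lam)
  rwa [card_multiCell, ← multiSchur_eq_tabSchur] at h

/-- A bijection of boxes preserving components is a family of bijections, and one bad column in one
component kills its term. If the component sizes differ there is no such family and the hypothesis
is vacuous. -/
lemma hallForm_multiSchur_eq_zero {lam mu : MultiPartition l n}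
    (h : ∀ γ : ∀ j, Cell (lam.2 j) ≃ Cell (mu.2 j), ∃ j, ∃ a b, a ≠ b ∧
      cellCol a = cellCol b ∧ cellRow (γ j a) = cellRow (γ j b)) :
    hallForm l (multiSchur lam) (multiSchur mu) = 0 := by
  let e : MultiCell mu ≃ MultiCell lam :=
    Fintype.equivOfCardEq (by rw [card_multiCell, card_multiCell])
  rw [multiSchur_eq_tabSchur, multiSchur_eq_tabSchur,
    ← tabSchur_comp_equiv e (isTableau_multi mu).compSupported_youngElt]
  refine hallForm_tabSchur_eq_zero (isTableau_multi lam) ((isTableau_multi mu).comp_equiv e) ?_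
  intro g hg
  obtain ⟨γ, hγ⟩ := exists_eq_sigmaCongrRight (g.trans e.symm) hg
  obtain ⟨j, a, b, hab, hc, hr⟩ := h γ
  have h1 : ∀ x, e.symm (g ⟨j, x⟩) = ⟨j, γ j x⟩ := fun x =>
    congrArg (fun f : MultiCell lam ≃ MultiCell mu => f ⟨j, x⟩) hγ
  refine ⟨⟨j, a⟩, ⟨j, b⟩, fun h => hab (eq_of_heq (Sigma.mk.inj h).2), Prod.ext rfl hc, ?_⟩
  rw [Function.comp_apply, Function.comp_apply, h1, h1]
  exact Prod.ext rfl hr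

lemma hallForm_multiSchur (lam mu : MultiPartition l n) :
    hallForm l (multiSchur lam) (multiSchur mu) = if lam = mu then 1 else 0 := by
  split_ifs with h
  · rw [← h, multiSchur_eq_tabSchur]
    exact (isTableau_multi lam).hallForm_tabSchur_self
  · by_cases hs : lam.1 = mu.1
    · obtain ⟨α, lam⟩ := lam
      obtain ⟨β, mu⟩ := mu
      obtain rfl : α = β := hs
      have key : ∀ lam mu : ∀ j, Nat.Partition (α.1 j), ∀ j, ¬ Dominated (mu j) (lam j) →
          hallForm l (multiSchur (⟨α, lam⟩ : MultiPartition l n)) (multiSchur ⟨α, mu⟩) = 0 :=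
        fun lam mu j hj => hallForm_multiSchur_eq_zero fun γ =>
          ⟨j, exists_same_column_of_not_dominated hj (γ j)⟩
      by_cases h1 : ∀ j, Dominated (mu j) (lam j)
      · by_cases h2 : ∀ j, Dominated (lam j) (mu j)
        · exact (h (by rw [funext fun j => (h2 j).antisymm (h1 j)])).elim
        · obtain ⟨j, hj⟩ := not_forall.1 h2
          rw [hallForm, hall_comm]
          exact key mu lam j hj
      · obtain ⟨j, hj⟩ := not_forall.1 h1
        exact key lam mu j hj
    · refine hallForm_multiSchur_eq_zero fun γ => (hs ?_).elim
      refine Subtype.ext (funext fun j => ?_)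
      rw [← card_cell (lam.2 j), ← card_cell (mu.2 j)]
      exact Fintype.card_congr (γ j)

/-- The exponent of the product of the power sums `p_{lam^(j)}[X^(j)]`. -/
def multiExponent (lam : MultiPartition l n) : Fin l × ℕ+ →₀ ℕ :=
  Multiset.toFinsupp (∑ j, (lam.2 j).parts.map fun r => (j, r.toPNat'))

lemma exists_multiExponent_eq {m : Fin l × ℕ+ →₀ ℕ} (h : Finsupp.weight (powDeg l) m = n) :
    ∃ lam : MultiPartition l n, multiExponent lam = m := by
  classical
  have hsum : ∑ j : Fin l, (Finsupp.toMultiset m).filter (fun x => x.1 = j) =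
      Finsupp.toMultiset m := by
    ext x
    rw [Multiset.count_sum']
    simp only [Multiset.count_filter]
    simp
  let P : Fin l → Multiset ℕ := fun j =>
    ((Finsupp.toMultiset m).filter fun x => x.1 = j).map fun x => (x.2 : ℕ)
  have hP : ∑ j, (P j).sum = n := by
    rw [← h, weight_eq_sum_toMultiset]
    conv_rhs => rw [← hsum]
    rw [← Multiset.coe_mapAddMonoidHom, map_sum, ← Multiset.coe_sumAddMonoidHom, map_sum]
    rfl
  refine ⟨⟨⟨fun j => (P j).sum, Finset.mem_piAntidiag.2 ⟨hP, fun _ _ => Finset.mem_univ _⟩⟩,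
    fun j => ⟨P j, ?_, rfl⟩⟩, ?_⟩
  · intro i hi
    obtain ⟨x, _, rfl⟩ := Multiset.mem_map.1 hi
    exact x.2.pos
  · apply Function.LeftInverse.injective Finsupp.toMultiset_toFinsupp
    rw [multiExponent, Multiset.toFinsupp_toMultiset]
    conv_rhs => rw [← hsum]
    refine Finset.sum_congr rfl fun j _ => ?_
    change Multiset.map _ (Multiset.map _ _) = _
    rw [Multiset.map_map]
    conv_rhs => rw [← Multiset.map_id ((Finsupp.toMultiset m).filter fun x => x.1 = j)]
    refine Multiset.map_congr rfl fun x hx => ?_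
    exact Prod.ext (Multiset.mem_filter.1 hx).2.symm (PNat.coe_toPNat' x.2)

/-- Expansion in multi-Schur functions. -/
lemma eq_sum_hallForm_multiSchur {f : MultiSym l} (hf : f.IsWeightedHomogeneous (powDeg l) n) :
    f = ∑ mu : MultiPartition l n, hallForm l (multiSchur mu) f • multiSchur mu := by
  classical
  exact eq_sum_hallForm_smul _ isWeightedHomogeneous_multiSchur
    (fun i j => by rw [hallForm_multiSchur]) multiExponent
    (fun m hm => exists_multiExponent_eq hm) hf

lemma isWeightedHomogeneous_aeval {Θ : Fin l × ℕ+ → MultiSym l}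
    (hΘ : ∀ x, (Θ x).IsWeightedHomogeneous (powDeg l) (x.2 : ℕ)) {f : MultiSym l}
    (hf : f.IsWeightedHomogeneous (powDeg l) n) :
    (aeval Θ f).IsWeightedHomogeneous (powDeg l) n := by
  rw [f.as_sum, map_sum, ← mem_weightedHomogeneousSubmodule]
  refine Submodule.sum_mem _ fun m hm => ?_
  rw [aeval_monomial, algebraMap_eq, ← smul_eq_C_mul]
  refine Submodule.smul_mem _ _ ?_
  have h := hf (mem_support_iff.1 hm)
  rw [Finsupp.weight_apply, Finsupp.sum] at h
  rw [mem_weightedHomogeneousSubmodule, ← h]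
  exact IsWeightedHomogeneous.prod _ _ _ fun x _ => (hΘ x).pow (m x)

lemma isWeightedHomogeneous_zSub (x : Fin l × ℕ+) :
    (zSub l x).IsWeightedHomogeneous (powDeg l) (x.2 : ℕ) := by
  rw [zSub, ← mem_weightedHomogeneousSubmodule]
  exact Submodule.smul_mem _ _ (Submodule.sum_mem _ fun i _ => Submodule.smul_mem _ _
    (isWeightedHomogeneous_X Kt (powDeg l) (i, x.2)))

lemma isWeightedHomogeneous_multiG [NeZero l] (lam : MultiPartition l n) :
    (multiG lam).IsWeightedHomogeneous (powDeg l) n := by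
  rw [multiG_eq, ← mem_weightedHomogeneousSubmodule]
  exact Submodule.smul_mem _ _ (isWeightedHomogeneous_aeval isWeightedHomogeneous_zSub
    (isWeightedHomogeneous_multiSchur lam))

/-- Pairing the defining expansion with an orthonormal family reads off the coefficients; spanning
in degree n gives the converse. -/
lemma isKostkaMacdonald_iff [NeZero l]
    {K : MultiPartition l n → MultiPartition l n → Kt} :
    IsKostkaMacdonald K ↔ ∀ mu lam, K mu lam = hallForm l (multiSchur mu) (multiG lam) := by
  classical
  constructor
  · intro hK mu lam
    rw [hK lam, map_sum]
    simp [hallForm_multiSchur]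
  · intro h lam
    conv_lhs => rw [eq_sum_hallForm_multiSchur (isWeightedHomogeneous_multiG lam)]
    simp only [h]

lemma existsUnique_isKostkaMacdonald [NeZero l] :
    ∃! K : MultiPartition l n → MultiPartition l n → Kt, IsKostkaMacdonald K :=
  ⟨fun mu lam => hallForm l (multiSchur mu) (multiG lam), isKostkaMacdonald_iff.2 fun _ _ => rfl,
    fun _ hK => funext fun mu => funext fun lam => isKostkaMacdonald_iff.1 hK mu lam⟩

end MultiSchur

/-! ## Traces on left ideals of group algebras -/

section LeftIdeal

variable {G : Type} [Group G]

/-- The action of the group on the left ideal generated by an element. -/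
def leftIdealRep (e : MonoidAlgebra ℂ G) : Representation ℂ G (Ideal.span {e}) :=
  (Algebra.lsmul ℂ ℂ (Ideal.span {e})).toMonoidHom.comp (MonoidAlgebra.of ℂ G)

/-- The character of the left ideal generated by a quasi-idempotent. -/
lemma trace_leftIdealRep [Fintype G] {e : MonoidAlgebra ℂ G} {κ : ℂ} (hκ : κ ≠ 0) (he : e * e = κ • e)
    (w : G) : LinearMap.trace ℂ _ (leftIdealRep e w) = κ⁻¹ * ∑ g : G, e.coeff (g⁻¹ * w⁻¹ * g) := by
  let p : Submodule ℂ (MonoidAlgebra ℂ G) := (Ideal.span {e}).restrictScalars ℂ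
  -- This map has image in the left ideal and agrees there with the action of `w`, since right
  -- multiplication by `e` is κ on the ideal. Its trace on the whole algebra is therefore the
  -- character.
  let f : MonoidAlgebra ℂ G →ₗ[ℂ] MonoidAlgebra ℂ G :=
    κ⁻¹ • (LinearMap.mulLeft ℂ (MonoidAlgebra.single w 1)).comp (LinearMap.mulRight ℂ e)
  have hf : ∀ x, f x ∈ p := fun x => by
    refine p.smul_mem _ ?_
    change MonoidAlgebra.single w 1 * (x * e) ∈ Ideal.span {e}
    rw [← mul_assoc]
    exact Ideal.mul_mem_left _ _ (Ideal.subset_span rfl)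
  have h1 := LinearMap.trace_restrict_eq_of_forall_mem p f hf
  let E : p ≃ₗ[ℂ] Ideal.span {e} :=
    { toFun := fun x => ⟨x.1, x.2⟩
      invFun := fun x => ⟨x.1, x.2⟩
      map_add' := fun _ _ => rfl
      map_smul' := fun _ _ => rfl
      left_inv := fun _ => rfl
      right_inv := fun _ => rfl }
  have h2 : E.conj (f.restrict fun x _ => hf x) = leftIdealRep e w := by
    refine LinearMap.ext fun x => Subtype.ext ?_
    obtain ⟨y, hy⟩ := Ideal.mem_span_singleton'.1 x.2
    change κ⁻¹ • (MonoidAlgebra.single w 1 * ((x : MonoidAlgebra ℂ G) * e)) =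
      MonoidAlgebra.single w 1 * (x : MonoidAlgebra ℂ G)
    have h3 : (x : MonoidAlgebra ℂ G) * e = κ • (x : MonoidAlgebra ℂ G) := by
      rw [← hy, mul_assoc, he, mul_smul_comm]
    rw [h3, mul_smul_comm, smul_smul, inv_mul_cancel₀ hκ, one_smul]
  rw [← LinearMap.trace_conj' _ E, h2] at h1
  refine h1.trans ?_
  rw [trace_eq_sum_coeff, Finset.mul_sum]
  refine Finset.sum_congr rfl fun g _ => ?_
  change (κ⁻¹ • (MonoidAlgebra.single w 1 * (MonoidAlgebra.single g 1 * e))).coeff g = _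
  rw [MonoidAlgebra.coeff_smul_apply, smul_eq_mul, MonoidAlgebra.coeff_single_mul_apply,
    MonoidAlgebra.coeff_single_mul_apply, one_mul, one_mul, mul_assoc]

end LeftIdeal

/-! ## Irreducible characters of the wreath product -/

section WreathChar

open Equiv

variable {l n : ℕ} [NeZero l]

lemma colour_inl_mul_inr (a : Fin n → ZMod l) (σ : Perm (Fin n)) (i : Fin n) :
    colour (baseElt a * permElt σ : Wreath l n) i = a i := by
  rw [colour_mul]
  change a i + 0 = a i
  rw [add_zero]

lemma right_inl_mul_inr (a : Fin n → ZMod l) (σ : Perm (Fin n)) :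
    (baseElt a * permElt σ : Wreath l n).right = σ := by
  simp [baseElt, permElt]

/-- Elements of the wreath product are pairs of colours and a permutation. -/
def wreathEquiv (l n : ℕ) [NeZero l] : (Fin n → ZMod l) × Perm (Fin n) ≃ Wreath l n where
  toFun x := baseElt x.1 * permElt x.2
  invFun w := (colour w, w.right)
  left_inv x := Prod.ext (funext fun i => colour_inl_mul_inr x.1 x.2 i) (right_inl_mul_inr x.1 x.2)
  right_inv w := SemidirectProduct.ext (funext fun i => colour_inl_mul_inr (colour w) w.right i)
    (right_inl_mul_inr _ _)

instance fintypeWreath : Fintype (Wreath l n) := Fintype.ofEquiv _ (wreathEquiv l n)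

lemma sum_wreath {M : Type*} [AddCommMonoid M] (F : Wreath l n → M) :
    ∑ w, F w = ∑ a : Fin n → ZMod l, ∑ σ : Perm (Fin n), F (baseElt a * permElt σ) := by
  rw [← Fintype.sum_prod_type']
  exact (Equiv.sum_comp (wreathEquiv l n) F).symm

lemma baseElt_mul (a b : Fin n → ZMod l) :
    (baseElt a * baseElt b : Wreath l n) = baseElt (a + b) := by
  rw [baseElt, baseElt, ← map_mul]; rfl

lemma permElt_mul_baseElt (σ : Perm (Fin n)) (a : Fin n → ZMod l) :
    (permElt σ * baseElt a : Wreath l n) = baseElt (fun i => a (σ⁻¹ i)) * permElt σ := by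
  refine (wreathEquiv l n).symm.injective (Prod.ext (funext fun i => ?_) ?_)
  · change colour _ i = colour _ i
    rw [colour_inl_mul_inr, colour_mul]
    change 0 + a (σ⁻¹ i) = _
    rw [zero_add]
  · change (permElt σ * baseElt a : Wreath l n).right = (baseElt _ * permElt σ : Wreath l n).right
    rw [right_inl_mul_inr]
    simp [baseElt, permElt]

variable {ζ : ℂ}

/-- The character of the base group given by an exponent for each letter. -/
def baseChar (ζ : ℂ) (f : Fin n → ℕ) (a : Fin n → ZMod l) : ℂ := ∏ k, ζ ^ (f k * (a k).val)

lemma baseChar_add (hζ : IsPrimitiveRoot ζ l) (f : Fin n → ℕ) (a b : Fin n → ZMod l) :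
    baseChar ζ f (a + b) = baseChar ζ f a * baseChar ζ f b := by
  rw [baseChar, baseChar, baseChar, ← Finset.prod_mul_distrib]
  refine Finset.prod_congr rfl fun k _ => ?_
  rw [Pi.add_apply, mul_comm, pow_mul, zeta_pow_val_add hζ, mul_pow, ← pow_mul, ← pow_mul,
    mul_comm (f k), mul_comm (f k)]

lemma baseChar_ne_zero (hζ : IsPrimitiveRoot ζ l) (f : Fin n → ℕ) (a : Fin n → ZMod l) :
    baseChar ζ f a ≠ 0 :=
  Finset.prod_ne_zero_iff.2 fun _ _ => pow_ne_zero _ (hζ.ne_zero (NeZero.ne l))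

lemma baseChar_comp {f : Fin n → ℕ} {ρ : Perm (Fin n)} (hρ : ∀ k, f (ρ k) = f k)
    (a : Fin n → ZMod l) : baseChar ζ f (fun k => a (ρ k)) = baseChar ζ f a := by
  rw [baseChar, baseChar, ← Equiv.prod_comp ρ fun k => ζ ^ (f k * (a k).val)]
  exact Finset.prod_congr rfl fun k _ => by rw [hρ]

/-- The quasi-idempotent of a character of the base group. -/
def baseSym (ζ : ℂ) (f : Fin n → ℕ) : MonoidAlgebra ℂ (Wreath l n) :=
  ∑ a : Fin n → ZMod l, MonoidAlgebra.single (baseElt a) (baseChar ζ f a)⁻¹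

lemma baseSym_mul_self (hζ : IsPrimitiveRoot ζ l) (f : Fin n → ℕ) :
    baseSym ζ f * baseSym ζ f = ((l : ℂ) ^ n) • (baseSym ζ f : MonoidAlgebra ℂ (Wreath l n)) := by
  conv_lhs => rw [baseSym, Finset.sum_mul_sum]
  have h : ∀ a : Fin n → ZMod l, ∑ b : Fin n → ZMod l,
      MonoidAlgebra.single (baseElt a : Wreath l n) (baseChar ζ f a)⁻¹ *
        MonoidAlgebra.single (baseElt b) (baseChar ζ f b)⁻¹ = baseSym ζ f := by
    intro a
    conv_rhs => rw [baseSym, ← Equiv.sum_comp (Equiv.addLeft a)]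
    refine Finset.sum_congr rfl fun b _ => ?_
    rw [MonoidAlgebra.single_mul_single, baseElt_mul, Equiv.coe_addLeft, baseChar_add hζ, mul_inv]
  rw [Finset.sum_congr rfl fun a _ => h a, Finset.sum_const, Finset.card_univ, Fintype.card_fun,
    ZMod.card, Fintype.card_fin, ← Nat.cast_smul_eq_nsmul ℂ, Nat.cast_pow]

lemma single_permElt_mul_baseSym {f : Fin n → ℕ} {ρ : Perm (Fin n)} (hρ : ∀ k, f (ρ k) = f k)
    (c : ℂ) : MonoidAlgebra.single (permElt ρ : Wreath l n) c * baseSym ζ f =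
      baseSym ζ f * MonoidAlgebra.single (permElt ρ) c := by
  rw [baseSym, Finset.mul_sum, Finset.sum_mul]
  conv_rhs => rw [← Equiv.sum_comp (Equiv.arrowCongr ρ (Equiv.refl (ZMod l)))]
  refine Finset.sum_congr rfl fun a _ => ?_
  rw [MonoidAlgebra.single_mul_single, MonoidAlgebra.single_mul_single, permElt_mul_baseElt,
    mul_comm c]
  have h : baseChar ζ f (Equiv.arrowCongr ρ (Equiv.refl (ZMod l)) a) = baseChar ζ f a := by
    have hρ' : ∀ k, f (ρ⁻¹ k) = f k := fun k => by
      rw [← hρ, ← Perm.mul_apply, mul_inv_cancel, Perm.one_apply]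
    exact baseChar_comp hρ' a
  rw [h]
  rfl

/-- The element of the group algebra given by an element of the group algebra of the symmetric
group. -/
def permAlg (x : MonoidAlgebra ℂ (Perm (Fin n))) : MonoidAlgebra ℂ (Wreath l n) :=
  ∑ σ, MonoidAlgebra.single (permElt σ) (x.coeff σ)

lemma permAlg_eq (x : MonoidAlgebra ℂ (Perm (Fin n))) :
    (permAlg x : MonoidAlgebra ℂ (Wreath l n)) =
      MonoidAlgebra.mapDomainAlgHom ℂ ℂ (SemidirectProduct.inr : Perm (Fin n) →* Wreath l n) x := by
  conv_rhs => rw [eq_sum_single x, map_sum]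
  refine Finset.sum_congr rfl fun σ _ => ?_
  simp [permElt]

lemma permAlg_mul (x y : MonoidAlgebra ℂ (Perm (Fin n))) :
    (permAlg (x * y) : MonoidAlgebra ℂ (Wreath l n)) = permAlg x * permAlg y := by
  rw [permAlg_eq, permAlg_eq, permAlg_eq, map_mul]

lemma permAlg_mul_baseSym {f : Fin n → ℕ} {x : MonoidAlgebra ℂ (Perm (Fin n))}
    (hx : ∀ ρ, x.coeff ρ ≠ 0 → ∀ k, f (ρ k) = f k) :
    permAlg x * baseSym ζ f = (baseSym ζ f * permAlg x : MonoidAlgebra ℂ (Wreath l n)) := by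
  rw [permAlg, Finset.sum_mul, Finset.mul_sum]
  refine Finset.sum_congr rfl fun ρ _ => ?_
  by_cases h : x.coeff ρ = 0
  · rw [h, MonoidAlgebra.single_zero, zero_mul, mul_zero]
  · exact single_permElt_mul_baseSym (hx ρ h) _

lemma coeff_baseSym_mul_permAlg (f : Fin n → ℕ) (x : MonoidAlgebra ℂ (Perm (Fin n)))
    (w : Wreath l n) :
    (baseSym ζ f * permAlg x).coeff w = (baseChar ζ f (colour w))⁻¹ * x.coeff w.right := by
  classical
  rw [baseSym, permAlg, Finset.sum_mul_sum]
  simp only [MonoidAlgebra.single_mul_single, MonoidAlgebra.coeff_sum, Finsupp.finsetSum_apply,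
    MonoidAlgebra.coeff_single, Finsupp.single_apply]
  rw [← Fintype.sum_prod_type' (f := fun (a : Fin n → ZMod l) (σ : Perm (Fin n)) =>
    if baseElt a * permElt σ = w then (baseChar ζ f a)⁻¹ * x.coeff σ else 0)]
  rw [Finset.sum_eq_single ((wreathEquiv l n).symm w)]
  · exact if_pos ((wreathEquiv l n).apply_symm_apply w)
  · intro y _ hy
    exact if_neg fun h => hy ((wreathEquiv l n).eq_symm_apply.2 h)
  · simp

/-- Sums over a conjugacy class of a quasi-idempotent attached to a character of the base group
and an element of the group algebra of the symmetric group. -/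
lemma sum_conj_coeff (hζ : IsPrimitiveRoot ζ l) {f : Fin n → ℕ}
    {x : MonoidAlgebra ℂ (Perm (Fin n))} (hx : ∀ ρ, x.coeff ρ ≠ 0 → ∀ k, f (ρ k) = f k)
    (w : Wreath l n) :
    ∑ g : Wreath l n, (baseSym ζ f * permAlg x).coeff (g⁻¹ * w⁻¹ * g) =
      (l : ℂ) ^ n * ∑ σ : Perm (Fin n),
        x.coeff (σ⁻¹ * w.right⁻¹ * σ) * baseChar ζ f (fun k => colour w (σ k)) := by
  have key : ∀ (b : Fin n → ZMod l) (σ : Perm (Fin n)),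
      (baseSym ζ f * permAlg x).coeff
        ((baseElt b * permElt σ)⁻¹ * w⁻¹ * (baseElt b * permElt σ)) =
      x.coeff (σ⁻¹ * w.right⁻¹ * σ) * baseChar ζ f (fun k => colour w (σ k)) := by
    intro b σ
    rw [coeff_baseSym_mul_permAlg]
    set g : Wreath l n := baseElt b * permElt σ with hg
    have hgr : g.right = σ := right_inl_mul_inr b σ
    set v : Wreath l n := g⁻¹ * w * g with hv
    have hvi : g⁻¹ * w⁻¹ * g = v⁻¹ := by rw [hv]; group
    have hvr : v.right = σ⁻¹ * w.right * σ := by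
      rw [hv, SemidirectProduct.mul_right, SemidirectProduct.mul_right,
        SemidirectProduct.inv_right, hgr]
    have hvr' : (v⁻¹).right = σ⁻¹ * w.right⁻¹ * σ := by
      rw [SemidirectProduct.inv_right, hvr]; group
    rw [hvi, hvr', mul_comm]
    -- Off the support of `x` both sides vanish; on it the conjugated permutation preserves `f`.
    by_cases h0 : x.coeff (σ⁻¹ * w.right⁻¹ * σ) = 0
    · rw [h0, zero_mul, zero_mul]
    congr 1
    have hpres := hx _ h0
    have hpres' : ∀ k, f (v.right k) = f k := fun k => by
      have := hpres (v.right k)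
      rw [← hvr', SemidirectProduct.inv_right, ← Perm.mul_apply, inv_mul_cancel,
        Perm.one_apply] at this
      exact this.symm
    have h1 : baseChar ζ f (colour v⁻¹) * baseChar ζ f (colour v) = 1 := by
      rw [← baseChar_comp hpres' (colour v), ← baseChar_add hζ]
      have : (colour v⁻¹ + fun k => colour v (v.right k)) = 0 := by
        funext k
        have h3 := colour_mul v⁻¹ v k
        rw [inv_mul_cancel, colour_one, SemidirectProduct.inv_right, inv_inv] at h3
        exact h3.symm
      rw [this]
      simp [baseChar]
    have h4 : baseChar ζ f (colour v) = baseChar ζ f (fun k => colour w (σ k)) := by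
      -- Colours of w g = g v. The base part `b` appears on both sides, permuted on one, and its
      -- contributions to the character agree because `f` is preserved.
      have h5 : (fun k => colour w (σ k)) + (fun k => b (σ ((σ⁻¹ * w.right⁻¹ * σ) k))) =
          (fun k => b (σ k)) + colour v := by
        funext k
        have h6 : w * g = g * v := by rw [hv]; group
        have h7 := congrArg (fun y : Wreath l n => colour y (σ k)) h6
        simp only [colour_mul, hgr, perm_inv_apply] at h7
        rw [hg, colour_inl_mul_inr, colour_inl_mul_inr] at h7
        rw [Pi.add_apply, Pi.add_apply, ← h7]
        simp
      have h8 := congrArg (baseChar ζ f) h5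
      rw [baseChar_add hζ, baseChar_add hζ,
        baseChar_comp (a := fun k => b (σ k)) hpres, mul_comm] at h8
      exact (mul_left_cancel₀ (baseChar_ne_zero hζ f _) h8).symm
    rw [← h4]
    exact inv_eq_of_mul_eq_one_right h1
  rw [sum_wreath]
  simp only [key]
  rw [Finset.sum_const, Finset.card_univ, Fintype.card_fun, ZMod.card, Fintype.card_fin,
    nsmul_eq_mul, Nat.cast_pow]

/-- The component of a letter. -/
def letterComp (lam : MultiPartition l n) : Fin n → Fin l := multiComp lam ∘ (tableau lam).symm

/-- The row of a letter. -/
def letterRow (lam : MultiPartition l n) : Fin n → Fin l × ℕ := multiRow lam ∘ (tableau lam).symm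

/-- The column of a letter. -/
def letterCol (lam : MultiPartition l n) : Fin n → Fin l × ℕ := multiCol lam ∘ (tableau lam).symm

lemma isTableau_letter (lam : MultiPartition l n) :
    IsTableau (letterComp lam) (letterRow lam) (letterCol lam) :=
  (isTableau_multi lam).comp_equiv (tableau lam)

lemma multiSchur_eq_letter (lam : MultiPartition l n) :
    multiSchur lam = tabSchur (letterComp lam) (letterRow lam) (letterCol lam) := by
  rw [multiSchur_eq_tabSchur]
  exact (tabSchur_comp_equiv (tableau lam) (isTableau_multi lam).compSupported_youngElt).symm

/-- The Young symmetrizer of the standard filling. -/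
def letterElt (lam : MultiPartition l n) : MonoidAlgebra ℂ (Perm (Fin n)) :=
  youngElt (letterRow lam) (letterCol lam)

/-- The constant of the Young symmetrizer of the standard filling. -/
def letterConst (lam : MultiPartition l n) : ℂ := youngConst (letterRow lam) (letterCol lam)

lemma letterConst_ne_zero (lam : MultiPartition l n) : letterConst lam ≠ 0 :=
  (isTableau_letter lam).youngConst_ne_zero

lemma letterElt_preserves {lam : MultiPartition l n} {ρ : Perm (Fin n)}
    (h : (letterElt lam).coeff ρ ≠ 0) (k : Fin n) : letterComp lam (ρ k) = letterComp lam k :=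
  (isTableau_letter lam).compSupported_youngElt ρ h k

lemma rowPerms_eq (lam : MultiPartition l n) : rowPerms lam = fixers (letterRow lam) := by
  ext σ
  rw [mem_fixers, rowPerms, Finset.mem_filter]
  simp only [Finset.mem_univ, true_and]
  refine forall_congr' fun k => ?_
  rw [letterRow, Function.comp_apply, Function.comp_apply, multiRow, sigmaMap, sigmaMap,
    Prod.mk.injEq, Fin.ext_iff]
  rfl

lemma colPerms_eq (lam : MultiPartition l n) : colPerms lam = fixers (letterCol lam) := by
  ext σ
  rw [mem_fixers, colPerms, Finset.mem_filter]
  simp only [Finset.mem_univ, true_and]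
  refine forall_congr' fun k => ?_
  rw [letterCol, Function.comp_apply, Function.comp_apply, multiCol, sigmaMap, sigmaMap,
    Prod.mk.injEq, Fin.ext_iff]
  rfl

lemma youngSymmetrizer_eq (lam : MultiPartition l n) :
    youngSymmetrizer lam = permAlg (letterElt lam) := by
  rw [permAlg_eq, letterElt, youngElt, youngSymmetrizer, rowPerms_eq, colPerms_eq,
    Finset.sum_mul_sum, map_sum]
  refine Finset.sum_congr rfl fun σ _ => ?_
  rw [map_sum]
  refine Finset.sum_congr rfl fun τ _ => ?_
  simp [permElt, csign, MonoidAlgebra.single_mul_single]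

lemma colourSymmetrizer_eq (lam : MultiPartition l n) :
    colourSymmetrizer ζ lam = baseSym ζ (compOf lam) := by
  refine Finset.sum_congr rfl fun a _ => ?_
  rw [Finset.prod_inv_distrib, MonoidAlgebra.of_apply, MonoidAlgebra.smul_single, smul_eq_mul,
    mul_one]
  rfl

/-- The generator of the irreducible module. -/
def wreathElt (ζ : ℂ) (lam : MultiPartition l n) : MonoidAlgebra ℂ (Wreath l n) :=
  colourSymmetrizer ζ lam * youngSymmetrizer lam

lemma wreathElt_eq (lam : MultiPartition l n) :
    wreathElt ζ lam = baseSym ζ (compOf lam) * permAlg (letterElt lam) := by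
  rw [wreathElt, colourSymmetrizer_eq, youngSymmetrizer_eq]

/-- The Young symmetrizer preserves components, so it commutes with the colour symmetrizer, and both
are quasi-idempotent. -/
lemma wreathElt_mul_self (hζ : IsPrimitiveRoot ζ l) (lam : MultiPartition l n) :
    wreathElt ζ lam * wreathElt ζ lam = ((l : ℂ) ^ n * letterConst lam) • wreathElt ζ lam := by
  have hx : ∀ ρ, (letterElt lam).coeff ρ ≠ 0 → ∀ k, compOf lam (ρ k) = compOf lam k :=
    fun ρ hρ k => congrArg Fin.val (letterElt_preserves hρ k)
  rw [wreathElt_eq, mul_assoc, ← mul_assoc (permAlg _), permAlg_mul_baseSym hx, mul_assoc,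
    ← mul_assoc, ← permAlg_mul, letterElt, (isTableau_letter lam).youngElt_mul_self,
    baseSym_mul_self hζ, permAlg_eq, map_smul, ← permAlg_eq, smul_mul_assoc, mul_smul_comm, smul_smul]
  rfl

/-- Trace on the left ideal of a quasi-idempotent; the l^n in its constant cancels the l^n
colourings in the sum over conjugates. -/
lemma irrChar_eq (hζ : IsPrimitiveRoot ζ l) (lam : MultiPartition l n) (w : Wreath l n) :
    irrChar ζ lam w = (letterConst lam)⁻¹ * ∑ σ : Perm (Fin n),
      (letterElt lam).coeff (σ⁻¹ * w.right⁻¹ * σ) *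
        baseChar ζ (compOf lam) (fun k => colour w (σ k)) := by
  have hl : ((l : ℂ) ^ n) ≠ 0 := pow_ne_zero _ (Nat.cast_ne_zero.2 (NeZero.ne l))
  have h := trace_leftIdealRep (mul_ne_zero hl (letterConst_ne_zero lam))
    (wreathElt_mul_self hζ lam) w
  have hx : ∀ ρ, (letterElt lam).coeff ρ ≠ 0 → ∀ k, compOf lam (ρ k) = compOf lam k :=
    fun ρ hρ k => congrArg Fin.val (letterElt_preserves hρ k)
  rw [wreathElt_eq, sum_conj_coeff hζ hx, mul_inv, ← mul_assoc, mul_right_comm _ _ ((l : ℂ) ^ n),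
    inv_mul_cancel₀ hl, one_mul, ← wreathElt_eq] at h
  exact h

end WreathChar

/-! ## Characters as coefficients of products of power sums -/

section CyclePow

open Equiv MvPolynomial

variable {l n : ℕ} [NeZero l] {ζ : ℂ}

open Classical in
/-- The sum of the colours along a cycle. -/
def orbColour (w : Wreath l n) (c : Orb w.right) : ZMod l :=
  ∑ i : Fin n with orbMk w.right i = c, colour w i

/-- The linear form `∑ ζ^{js} p_r[X^(j)]` of a cycle of length `r` with colour `s`. -/
def cycleForm (ζ : ℂ) (w : Wreath l n) (c : Orb w.right) : Fin l × ℕ+ →₀ Kt :=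
  orbForm (fun j => RatFunc.C (ζ ^ ((j : ℕ) * (orbColour w c).val))) (orbSize c)

open Classical in
/-- The product of the linear forms of the cycles of an element of the wreath product. -/
def cyclePow (ζ : ℂ) (w : Wreath l n) : MultiSym l :=
  ∏ c : Orb w.right, linForm (cycleForm ζ w c)

lemma zeta_pow_mul_val_sum (hζ : IsPrimitiveRoot ζ l) {ι : Type*} (s : Finset ι) (a : ι → ZMod l)
    (j : ℕ) : ζ ^ (j * (∑ x ∈ s, a x).val) = ∏ x ∈ s, ζ ^ (j * (a x).val) := by
  classical
  induction s using Finset.induction_on with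
  | empty => simp
  | insert x s hx ih =>
    rw [Finset.sum_insert hx, Finset.prod_insert hx, ← ih, mul_comm, pow_mul, zeta_pow_val_add hζ,
      mul_pow, ← pow_mul, ← pow_mul, mul_comm j, mul_comm j]

open Classical in
lemma prod_orbColour (hζ : IsPrimitiveRoot ζ l) (w : Wreath l n) (f : Orb w.right → ℕ) :
    ∏ c : Orb w.right, ζ ^ (f c * (orbColour w c).val) =
      baseChar ζ (fun x => f (orbMk w.right x)) (colour w) := by
  rw [baseChar, ← Finset.prod_fiberwise Finset.univ (fun x => orbMk w.right x)]
  refine Finset.prod_congr rfl fun c _ => ?_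
  rw [orbColour, zeta_pow_mul_val_sum hζ]
  exact Finset.prod_congr rfl fun x hx => by rw [(Finset.mem_filter.1 hx).2]

open Classical in
-- Intertwiners of `w.right` and ρ are the permutations conjugating one into the other, and the
-- weights of the cycles multiply to the base character at the colours of w.
lemma hallForm_cyclePow_permPow (hζ : IsPrimitiveRoot ζ l) (w : Wreath l n)
    {comp : Fin n → Fin l} {ρ : Perm (Fin n)} (hρ : ∀ x, comp (ρ x) = comp x) :
    hallForm l (cyclePow ζ w) (permPow comp ρ) = RatFunc.C (∑ g : Perm (Fin n),
      if g * w.right * g⁻¹ = ρ then baseChar ζ (fun x => (comp (g x) : ℕ)) (colour w) else 0) := by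
  rw [cyclePow]
  simp only [cycleForm]
  rw [hallForm_permPow, map_sum, intertwiners, Finset.sum_filter]
  refine Finset.sum_congr rfl fun g _ => ?_
  have hiff : (∀ x, g (w.right x) = ρ (g x)) ↔ g * w.right * g⁻¹ = ρ := by
    rw [mul_inv_eq_iff_eq_mul]
    exact ⟨fun h => Equiv.ext h, fun h x => congrArg (fun f : Perm (Fin n) => f x) h⟩
  simp only [hiff]
  split_ifs with h
  · rw [← map_prod]
    congr 1
    simp only [apply_orbMk_out hρ]
    rw [prod_orbColour hζ w fun c => (comp (g c.out) : ℕ)]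
    congr 1
    funext x
    have h1 : ∀ y, comp (g (w.right y)) = comp (g y) := fun y => by
      rw [hiff.2 h, hρ]
    rw [apply_orbMk_out (f := fun y => comp (g y)) h1]
  · rw [map_zero]

/-- The irreducible character as a Hall pairing. -/
lemma hallForm_cyclePow_multiSchur (hζ : IsPrimitiveRoot ζ l) (lam : MultiPartition l n)
    (w : Wreath l n) :
    hallForm l (cyclePow ζ w) (multiSchur lam) = RatFunc.C (irrChar ζ lam w) := by
  classical
  -- Reindexed by inverses to match the w⁻¹ in the trace formula for the character.
  have h1 : tabSym (letterComp lam) (letterRow lam) (letterCol lam) =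
      ∑ ρ : Perm (Fin n), (RatFunc.C ((letterElt lam).coeff ρ⁻¹) : Kt) •
        permPow (letterComp lam) ρ := by
    rw [tabSym, ← Equiv.sum_comp (Equiv.inv (Perm (Fin n)))]
    refine Finset.sum_congr rfl fun ρ _ => ?_
    rw [Equiv.inv_apply]
    by_cases h : (letterElt lam).coeff ρ⁻¹ = 0
    · rw [← letterElt, h, map_zero, zero_smul, zero_smul]
    · have h2 := permPow_inv (letterElt_preserves h)
      rw [inv_inv] at h2
      rw [← letterElt, h2]
  rw [multiSchur_eq_letter, tabSchur, h1, map_smul, map_sum, irrChar_eq hζ, smul_eq_mul, map_mul,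
    map_inv₀, ← letterConst]
  congr 1
  have h3 : ∀ ρ : Perm (Fin n), hallForm l (cyclePow ζ w)
      ((RatFunc.C ((letterElt lam).coeff ρ⁻¹) : Kt) • permPow (letterComp lam) ρ) =
      RatFunc.C (∑ g : Perm (Fin n), if g * w.right * g⁻¹ = ρ then
        (letterElt lam).coeff ρ⁻¹ *
          baseChar ζ (fun x => (letterComp lam (g x) : ℕ)) (colour w) else 0) := by
    intro ρ
    rw [map_smul, smul_eq_mul]
    by_cases h : (letterElt lam).coeff ρ⁻¹ = 0
    · rw [h, map_zero, zero_mul]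
      simp
    · have hρ : ∀ x, letterComp lam (ρ x) = letterComp lam x := fun x => by
        have := letterElt_preserves h (ρ x)
        rw [← Perm.mul_apply, inv_mul_cancel, Perm.one_apply] at this
        exact this.symm
      rw [hallForm_cyclePow_permPow hζ w hρ, ← map_mul, Finset.mul_sum]
      simp only [mul_ite, mul_zero]
  rw [Finset.sum_congr rfl fun ρ _ => h3 ρ, ← map_sum, Finset.sum_comm,
    ← Equiv.sum_comp (Equiv.inv (Perm (Fin n)))]
  congr 1
  refine Finset.sum_congr rfl fun g _ => ?_
  rw [Finset.sum_ite_eq, if_pos (Finset.mem_univ _), Equiv.inv_apply]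
  have h4 : (g⁻¹ * w.right * g⁻¹⁻¹)⁻¹ = g⁻¹ * w.right⁻¹ * g := by group
  rw [h4]
  congr 1
  rw [baseChar, baseChar,
    ← Equiv.prod_comp g fun x => ζ ^ ((letterComp lam (g⁻¹ x) : ℕ) * (colour w x).val)]
  refine Finset.prod_congr rfl fun x _ => ?_
  rw [perm_inv_apply]
  rfl

/-- The factor by which the substitution `zSub` scales the linear form of a cycle. -/
def cycleFactor (ζ : ℂ) (w : Wreath l n) (c : Orb w.right) : Kt :=
  (1 - RatFunc.C (ζ ^ (orbColour w c).val) * tt ^ orbSize c)⁻¹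

lemma one_sub_C_mul_tt_pow_ne_zero (a : ℂ) {r : ℕ} (hr : 0 < r) :
    (1 : Kt) - RatFunc.C a * tt ^ r ≠ 0 := by
  intro h
  have h1 : RatFunc.C a * tt ^ r = 1 := (sub_eq_zero.1 h).symm
  have ha : (RatFunc.C a : Kt) ≠ 0 := left_ne_zero_of_mul_eq_one h1
  refine tt_pow_ne_C hr a⁻¹ ?_
  rw [map_inv₀]
  exact (inv_eq_of_mul_eq_one_right h1).symm

/-- The residues d = i - p run over 0, ..., l - 1, and ζ^{is} depends only on i modulo l, so ζ^{ps}
factors out despite the wrap-around. This makes the cycle forms eigenvectors. -/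
lemma sum_fin_sub (hζ : IsPrimitiveRoot ζ l) (p : Fin l) (s r : ℕ) :
    ∑ i : Fin l, (RatFunc.C (ζ ^ ((i : ℕ) * s)) : Kt) * tt ^ (((i - p : Fin l) : ℕ) * r) =
      RatFunc.C (ζ ^ ((p : ℕ) * s)) * ∑ d : Fin l, (RatFunc.C (ζ ^ s) * tt ^ r) ^ (d : ℕ) := by
  rw [Finset.mul_sum, ← Equiv.sum_comp (Equiv.addRight p)]
  refine Finset.sum_congr rfl fun d _ => ?_
  rw [Equiv.coe_addRight, add_sub_cancel_right, mul_pow, ← map_pow, ← pow_mul, ← pow_mul,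
    ← mul_assoc, ← map_mul, mul_comm r]
  congr 2
  have h1 : ∀ m : ℕ, ζ ^ (m % l) = ζ ^ m := fun m => by
    conv_rhs => rw [← Nat.mod_add_div m l, pow_add, pow_mul, hζ.pow_eq_one, one_pow, mul_one]
  rw [Fin.val_add, pow_mul, h1, ← pow_mul, ← pow_add, add_mul, add_comm, mul_comm (d : ℕ)]

/-- The geometric sum of `sum_fin_sub` is (1 - t^{lr})/(1 - ζ^s t^r), and its numerator cancels the
denominator in `zSub`. -/
lemma linDeriv_cycleForm_zSub (hζ : IsPrimitiveRoot ζ l) (w : Wreath l n) (c : Orb w.right)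
    (x : Fin l × ℕ+) :
    linDeriv (powWeight l) (cycleForm ζ w c) (zSub l x) =
      C (cycleFactor ζ w c * (cycleForm ζ w c x * powWeight l x)) := by
  rw [zSub, Derivation.map_smul, map_sum]
  simp only [Derivation.map_smul, linDeriv_X, cycleForm, orbForm_apply]
  split_ifs with h
  · have hr : (x.2 : ℕ) = orbSize c := by
      rw [h, Nat.toPNat'_coe, if_pos (orbSize_pos c)]
    simp only [powWeight, hr]
    have h1 : ∀ i : Fin l, tt ^ (((i - x.1 : Fin l) : ℕ) * orbSize c) •
        (C ((RatFunc.C (ζ ^ ((i : ℕ) * (orbColour w c).val)) : Kt) * (orbSize c : Kt)) :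
          MultiSym l) =
        C ((orbSize c : Kt)) * C (RatFunc.C (ζ ^ ((i : ℕ) * (orbColour w c).val)) *
          tt ^ (((i - x.1 : Fin l) : ℕ) * orbSize c)) := by
      intro i
      rw [smul_eq_C_mul, ← C_mul, ← C_mul]
      congr 1
      ring
    simp only [h1]
    rw [← Finset.mul_sum, ← map_sum, sum_fin_sub hζ, smul_eq_C_mul, ← C_mul, ← C_mul]
    congr 1
    rw [Fin.sum_univ_eq_sum_range (fun d => (RatFunc.C (ζ ^ (orbColour w c).val) *
      tt ^ orbSize c) ^ d)]
    have h2 := mul_neg_geom_sum (RatFunc.C (ζ ^ (orbColour w c).val) * tt ^ orbSize c) l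
    rw [mul_pow, ← map_pow, ← pow_mul, mul_comm (orbColour w c).val, pow_mul, hζ.pow_eq_one, one_pow,
      map_one, one_mul, ← pow_mul, mul_comm (orbSize c)] at h2
    have h3 : (1 : Kt) - tt ^ (l * orbSize c) ≠ 0 :=
      sub_ne_zero.2 (tt_pow_ne_one (Nat.mul_pos (NeZero.pos l) (orbSize_pos c))).symm
    have h4 := one_sub_C_mul_tt_pow_ne_zero (ζ ^ (orbColour w c).val) (orbSize_pos c)
    rw [cycleFactor, ← h2]
    rw [← h2] at h3
    have h5 := right_ne_zero_of_mul h3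
    field_simp
  · simp

open Classical in
/-- The substitution `zSub` scales the pairing with a product of linear forms of cycles. -/
lemma hallForm_cyclePow_zSub (hζ : IsPrimitiveRoot ζ l) (w : Wreath l n) (F : MultiSym l) :
    hallForm l (cyclePow ζ w) (aeval (zSub l) F) =
      (∏ c : Orb w.right, cycleFactor ζ w c) * hallForm l (cyclePow ζ w) F := by
  refine hall_prod_linForm_aeval _ _ _ _ _ (fun x => ?_)
    (fun c _ x => linDeriv_cycleForm_zSub hζ w c x) F
  rw [zSub, constantCoeff_smul, map_sum, Finset.sum_eq_zero, smul_zero]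
  intro i _
  rw [constantCoeff_smul, constantCoeff_X, smul_zero]

open Classical in
lemma prod_cycleFactor_eq {w : Wreath l n} {rho : MultiPartition l n}
    (hw : HasCycleType w rho) :
    ∏ c : Orb w.right, cycleFactor ζ w c = ∏ j : Fin l, ((rho.2 j).parts.map fun r =>
      (1 - RatFunc.C (ζ ^ (j : ℕ)) * tt ^ r)⁻¹).prod := by
  rw [← Finset.prod_fiberwise Finset.univ fun c : Orb w.right =>
    (⟨(orbColour w c).val, ZMod.val_lt _⟩ : Fin l)]
  refine Finset.prod_congr rfl fun j _ => ?_
  rw [hw j, cycleParts, Multiset.map_map]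
  have h1 : (Finset.univ.filter fun c : Orb w.right =>
      (⟨(orbColour w c).val, ZMod.val_lt _⟩ : Fin l) = j) =
      Finset.univ.filter fun c : Orb w.right => orbColour w c = ((j : ℕ) : ZMod l) := by
    ext c
    simp only [Finset.mem_filter, Finset.mem_univ, true_and, Fin.ext_iff]
    constructor
    · intro h
      rw [← h, ZMod.natCast_zmod_val]
    · intro h
      rw [h, ZMod.val_natCast_of_lt j.2]
  rw [h1]
  change _ = ∏ c ∈ Finset.univ.filter fun c : Orb w.right => orbColour w c = ((j : ℕ) : ZMod l), _
  refine Finset.prod_congr rfl fun c hc => ?_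
  rw [cycleFactor, (Finset.mem_filter.1 hc).2, ZMod.val_natCast_of_lt j.2]
  rfl

/-- The character formula for the Kostka–Macdonald coefficients. -/
theorem sum_kostkaMacdonald_irrChar (hζ : IsPrimitiveRoot ζ l)
    {K : MultiPartition l n → MultiPartition l n → Kt} (hK : IsKostkaMacdonald K)
    (lam rho : MultiPartition l n) (w : Wreath l n) (hw : HasCycleType w rho) :
    ∑ mu : MultiPartition l n, K mu lam * RatFunc.C (irrChar ζ mu w) =
      (∏ j : Fin l, (hookPoly (lam.2 j) (tt ^ l) * ((rho.2 j).parts.map fun r =>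
        (1 - RatFunc.C (ζ ^ (j : ℕ)) * tt ^ r)⁻¹).prod)) * RatFunc.C (irrChar ζ lam w) := by
  classical
  have h1 := congrArg (hallForm l (cyclePow ζ w)) (hK lam)
  rw [multiG_eq, map_smul, hallForm_cyclePow_zSub hζ, hallForm_cyclePow_multiSchur hζ, map_sum,
    prod_cycleFactor_eq hw, smul_eq_mul, ← mul_assoc, ← Finset.prod_mul_distrib] at h1
  rw [h1]
  refine Finset.sum_congr rfl fun mu _ => ?_
  rw [map_smul, hallForm_cyclePow_multiSchur hζ, smul_eq_mul]

end CyclePow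

/-! ## The column of the trivial multipartition -/

section TrivialColumn

open Equiv MvPolynomial

variable {l n : ℕ} [NeZero l] {ζ : ℂ}

lemma sum_zmod_eq_sum_range {M : Type*} [AddCommMonoid M] (f : ℕ → M) :
    ∑ a : ZMod l, f a.val = ∑ i ∈ Finset.range l, f i := by
  refine Finset.sum_bij' (fun a _ => a.val) (fun i _ => (i : ZMod l)) ?_ ?_ ?_ ?_ ?_
  · exact fun a _ => Finset.mem_range.2 (ZMod.val_lt a)
  · exact fun _ _ => Finset.mem_univ _
  · exact fun a _ => ZMod.natCast_zmod_val a
  · exact fun i hi => ZMod.val_natCast_of_lt (Finset.mem_range.1 hi)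
  · exact fun _ _ => rfl

lemma sum_zeta_orthogonal (hζ : IsPrimitiveRoot ζ l) (f g : Fin l) :
    ∑ a : ZMod l, (ζ ^ ((f : ℕ) * a.val))⁻¹ * ζ ^ ((g : ℕ) * a.val) =
      if g = f then (l : ℂ) else 0 := by
  have hne : ζ ≠ 0 := hζ.ne_zero (NeZero.ne l)
  have h1 : ∀ a : ZMod l, (ζ ^ ((f : ℕ) * a.val))⁻¹ * ζ ^ ((g : ℕ) * a.val) =
      ((ζ ^ (f : ℕ))⁻¹ * ζ ^ (g : ℕ)) ^ a.val := fun a => by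
    rw [mul_pow, inv_pow, ← pow_mul, ← pow_mul]
  simp only [h1]
  rw [sum_zmod_eq_sum_range fun i => ((ζ ^ (f : ℕ))⁻¹ * ζ ^ (g : ℕ)) ^ i]
  split_ifs with h
  · rw [h, inv_mul_cancel₀ (pow_ne_zero _ hne)]
    simp
  · have h2 : (ζ ^ (f : ℕ))⁻¹ * ζ ^ (g : ℕ) ≠ 1 := fun h3 => by
      rw [inv_mul_eq_one₀ (pow_ne_zero _ hne)] at h3
      exact h (Fin.ext (hζ.pow_inj f.2 g.2 h3).symm)
    have h3 := mul_neg_geom_sum ((ζ ^ (f : ℕ))⁻¹ * ζ ^ (g : ℕ)) l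
    rw [mul_pow, inv_pow, ← pow_mul, ← pow_mul, mul_comm _ l, mul_comm _ l, pow_mul, pow_mul,
      hζ.pow_eq_one, one_pow, one_pow, inv_one, mul_one, sub_self] at h3
    exact (mul_eq_zero.1 h3).resolve_left (sub_ne_zero.2 h2.symm)

lemma sum_baseChar_orthogonal (hζ : IsPrimitiveRoot ζ l) (f g : Fin n → Fin l) :
    ∑ a : Fin n → ZMod l, (baseChar ζ (fun x => (f x : ℕ)) a)⁻¹ *
      baseChar ζ (fun x => (g x : ℕ)) a = if g = f then (l : ℂ) ^ n else 0 := by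
  simp only [baseChar, ← Finset.prod_inv_distrib, ← Finset.prod_mul_distrib]
  rw [← Fintype.prod_sum fun (x : Fin n) (b : ZMod l) =>
    (ζ ^ ((f x : ℕ) * b.val))⁻¹ * ζ ^ ((g x : ℕ) * b.val)]
  simp only [sum_zeta_orthogonal hζ]
  split_ifs with h
  · simp [h]
  · obtain ⟨x, hx⟩ := Function.ne_iff.1 h
    exact Finset.prod_eq_zero (Finset.mem_univ x) (if_neg hx)

open Classical in
lemma cyclePow_eq_sum (hζ : IsPrimitiveRoot ζ l) (w : Wreath l n) :
    cyclePow ζ w = ∑ J : Orb w.right → Fin l,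
      (RatFunc.C (baseChar ζ (fun x => (J (orbMk w.right x) : ℕ)) (colour w)) : Kt) •
        ∏ c : Orb w.right, X (J c, (orbSize c).toPNat') := by
  simp only [cyclePow, cycleForm, linForm_orbForm]
  rw [Fintype.prod_sum]
  refine Finset.sum_congr rfl fun J _ => ?_
  rw [← prod_orbColour hζ w fun c => (J c : ℕ), map_prod]
  simp only [smul_eq_C_mul, map_prod]
  rw [← Finset.prod_mul_distrib]

/-- Expanding `cyclePow` assigns a component to each cycle; orthogonality of base characters keeps
only the assignment given by `comp`. -/
lemma sum_baseChar_cyclePow (hζ : IsPrimitiveRoot ζ l) {comp : Fin n → Fin l}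
    {σ : Perm (Fin n)} (hσ : ∀ x, comp (σ x) = comp x) :
    ∑ a : Fin n → ZMod l, (RatFunc.C (baseChar ζ (fun x => (comp x : ℕ)) a)⁻¹ : Kt) •
      cyclePow ζ (baseElt a * permElt σ : Wreath l n) =
        (RatFunc.C ((l : ℂ) ^ n) : Kt) • permPow comp σ := by
  classical
  have h1 : ∀ a : Fin n → ZMod l, cyclePow ζ (baseElt a * permElt σ : Wreath l n) =
      ∑ J : Orb σ → Fin l,
        (RatFunc.C (baseChar ζ (fun x => (J (orbMk σ x) : ℕ)) a) : Kt) •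
          ∏ c : Orb σ, X (J c, (orbSize c).toPNat') := by
    intro a
    rw [cyclePow_eq_sum hζ]
    have h2 : (colour (baseElt a * permElt σ : Wreath l n)) = a :=
      funext fun i => colour_inl_mul_inr a σ i
    rw [h2]
    have h3 := right_inl_mul_inr a σ
    generalize (baseElt a * permElt σ : Wreath l n).right = τ at h3
    subst h3
    rfl
  simp only [h1, Finset.smul_sum, smul_smul, ← map_mul]
  rw [Finset.sum_comm]
  simp only [← Finset.sum_smul, ← map_sum]
  simp only [fun J : Orb σ → Fin l => sum_baseChar_orthogonal hζ comp fun x => J (orbMk σ x)]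
  have hcomp : (fun x => comp ((orbMk σ x).out)) = comp := by
    funext x
    exact apply_orbMk_out hσ x
  rw [Finset.sum_eq_single fun c : Orb σ => comp c.out]
  · rw [if_pos hcomp, permPow]
  · intro J _ hJ
    rw [if_neg, map_zero, zero_smul]
    intro h
    refine hJ (funext fun c => ?_)
    have := congrFun h c.out
    rw [← this, orbMk_out]
  · exact fun h => (h (Finset.mem_univ _)).elim

/-- The idempotent of an irreducible module. -/
def wreathIdem (ζ : ℂ) (mu : MultiPartition l n) : MonoidAlgebra ℂ (Wreath l n) :=
  ((l : ℂ) ^ n * letterConst mu)⁻¹ • wreathElt ζ mu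

lemma wreathConst_ne_zero (mu : MultiPartition l n) : (l : ℂ) ^ n * letterConst mu ≠ 0 :=
  mul_ne_zero (pow_ne_zero _ (Nat.cast_ne_zero.2 (NeZero.ne l))) (letterConst_ne_zero mu)

lemma wreathIdem_mul_self (hζ : IsPrimitiveRoot ζ l) (mu : MultiPartition l n) :
    wreathIdem ζ mu * wreathIdem ζ mu = wreathIdem ζ mu := by
  rw [wreathIdem, smul_mul_assoc, mul_smul_comm, wreathElt_mul_self hζ, smul_smul, smul_smul,
    mul_assoc, inv_mul_cancel₀ (wreathConst_ne_zero mu), mul_one]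

/-- The multi-Schur function is the Frobenius image of the idempotent. -/
lemma multiSchur_eq_sum_cyclePow (hζ : IsPrimitiveRoot ζ l) (mu : MultiPartition l n) :
    multiSchur mu = ∑ w : Wreath l n,
      (RatFunc.C ((wreathIdem ζ mu).coeff w) : Kt) • cyclePow ζ w := by
  have h1 : ∑ w : Wreath l n, (RatFunc.C ((wreathElt ζ mu).coeff w) : Kt) • cyclePow ζ w =
      (RatFunc.C ((l : ℂ) ^ n) : Kt) •
        tabSym (letterComp mu) (letterRow mu) (letterCol mu) := by
    rw [sum_wreath, Finset.sum_comm, tabSym, Finset.smul_sum]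
    refine Finset.sum_congr rfl fun σ _ => ?_
    rw [← letterElt]
    by_cases h : (letterElt mu).coeff σ = 0
    · rw [h, map_zero, zero_smul, smul_zero]
      refine Finset.sum_eq_zero fun a _ => ?_
      rw [wreathElt_eq, coeff_baseSym_mul_permAlg, right_inl_mul_inr, h, mul_zero, map_zero,
        zero_smul]
    · rw [smul_comm, ← sum_baseChar_cyclePow hζ (letterElt_preserves h), Finset.smul_sum]
      refine Finset.sum_congr rfl fun a _ => ?_
      rw [wreathElt_eq, coeff_baseSym_mul_permAlg, right_inl_mul_inr, smul_smul, ← map_mul,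
        mul_comm ((letterElt mu).coeff σ)]
      have h2 : (colour (baseElt a * permElt σ : Wreath l n)) = a :=
        funext fun i => colour_inl_mul_inr a σ i
      rw [h2]
      rfl
  have h2 : ∀ w : Wreath l n, (RatFunc.C ((wreathIdem ζ mu).coeff w) : Kt) • cyclePow ζ w =
      (RatFunc.C ((l : ℂ) ^ n * letterConst mu)⁻¹ : Kt) •
        (RatFunc.C ((wreathElt ζ mu).coeff w) : Kt) • cyclePow ζ w := fun w => by
    rw [smul_smul, ← map_mul]
    rfl
  simp only [h2]
  rw [← Finset.smul_sum, h1, smul_smul, ← map_mul, mul_inv, mul_right_comm, inv_mul_cancel₀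
    (pow_ne_zero _ (Nat.cast_ne_zero.2 (NeZero.ne l))), one_mul, multiSchur_eq_letter, tabSchur,
    map_inv₀, letterConst]

lemma rows_indiscrete {m : ℕ} (hm : m ≠ 0) : rows (Nat.Partition.indiscrete m) = [m] := by
  rw [rows, Nat.Partition.indiscrete_parts hm, Multiset.sort_singleton]

lemma cell_indiscrete {m : ℕ} (s : Cell (Nat.Partition.indiscrete m)) :
    m ≠ 0 ∧ (s.1 : ℕ) = 0 := by
  have hm : m ≠ 0 := by
    rintro rfl
    have h := card_cell (Nat.Partition.indiscrete 0)
    exact (Fintype.card_eq_zero_iff.1 h).elim s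
  refine ⟨hm, ?_⟩
  have h := s.1.2.trans_eq (congrArg List.length (rows_indiscrete hm))
  rw [List.length_singleton] at h
  omega

lemma row_indiscrete {m : ℕ} (s : Cell (Nat.Partition.indiscrete m)) :
    row (Nat.Partition.indiscrete m) s.1 = m := by
  obtain ⟨hm, h⟩ := cell_indiscrete s
  rw [h, row, rows_indiscrete hm]
  rfl

lemma snd_lt_of_cell_indiscrete {m : ℕ} (s : Cell (Nat.Partition.indiscrete m)) :
    (s.2 : ℕ) < m :=
  s.2.2.trans_eq ((row_of_lt s.1).symm.trans (row_indiscrete s))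

lemma hookLength_indiscrete {m : ℕ} (s : Cell (Nat.Partition.indiscrete m)) :
    hookLength s = m - s.2 := by
  obtain ⟨hm, h⟩ := cell_indiscrete s
  have h1 := snd_lt_of_cell_indiscrete s
  have h2 : col (Nat.Partition.indiscrete m) s.2 = 1 := by
    rw [col, Nat.Partition.indiscrete_parts hm, Multiset.filter_singleton, if_pos h1,
      Multiset.card_singleton]
  rw [hookLength, arm, leg, row_indiscrete, h2, h]
  omega

lemma prod_sigma_singleton {K : Type*} [CommMonoid K] {L : List ℕ} {m : ℕ} (hL : L = [m])
    (F : ℕ → K) : ∏ i : Fin L.length, ∏ c : Fin (L.get i), F c = ∏ c ∈ Finset.range m, F c := by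
  subst hL
  refine (Fin.prod_univ_one fun i : Fin 1 => ∏ c : Fin ([m].get i), F c).trans ?_
  exact Fin.prod_univ_eq_prod_range F m

lemma hookPoly_indiscrete {K : Type*} [CommRing K] (m : ℕ) (u : K) :
    hookPoly (Nat.Partition.indiscrete m) u = ∏ k ∈ Finset.range m, (1 - u ^ (k + 1)) := by
  rw [hookPoly]
  simp only [hookLength_indiscrete]
  rcases Nat.eq_zero_or_pos m with rfl | hm
  · rw [Finset.range_zero, Finset.prod_empty]
    exact Finset.prod_eq_one fun s _ => ((cell_indiscrete s).1 rfl).elim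
  · rw [Fintype.prod_sigma, prod_sigma_singleton (rows_indiscrete hm.ne') fun c => 1 - u ^ (m - c),
      ← Finset.prod_range_reflect]
    refine Finset.prod_congr rfl fun k hk => ?_
    have := Finset.mem_range.1 hk
    congr 2
    omega

lemma prod_hookPoly_trivialMP (u : Kt) :
    ∏ j, hookPoly ((trivialMP l n).2 j) u = ∏ k ∈ Finset.range n, (1 - u ^ (k + 1)) := by
  have h1 : ∀ j : Fin l, hookPoly ((trivialMP l n).2 j) u =
      ∏ k ∈ Finset.range ((Pi.single 0 n : Fin l → ℕ) j), (1 - u ^ (k + 1)) :=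
    fun j => hookPoly_indiscrete _ u
  rw [Fintype.prod_eq_single 0 fun j hj => ?_, h1, Pi.single_eq_same]
  rw [h1, Pi.single_eq_of_ne hj, Finset.range_zero, Finset.prod_empty]

lemma cell_trivialMP (s : MultiCell (trivialMP l n)) :
    s.1 = 0 ∧ (s.2.1 : ℕ) = 0 := by
  have h := cell_indiscrete s.2
  refine ⟨?_, h.2⟩
  by_contra h0
  exact h.1 (Pi.single_eq_of_ne (M := fun _ : Fin l => ℕ) h0 n)

/-- For a single row every permutation is a row permutation and the column group is trivial. -/
lemma letterElt_trivialMP (σ : Perm (Fin n)) : (letterElt (trivialMP l n)).coeff σ = 1 := by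
  have hrow : ∀ x, letterRow (trivialMP l n) x = (0, 0) := fun x =>
    Prod.ext (cell_trivialMP _).1 (cell_trivialMP _).2
  have hinj : Function.Injective (letterCol (trivialMP l n)) := by
    intro x y h
    exact (isTableau_letter (trivialMP l n)).inj x y ((hrow x).trans (hrow y).symm) h
  rw [letterElt, youngElt_coeff, Finset.sum_eq_single σ, Finset.sum_eq_single 1]
  · rw [mul_one, if_pos rfl, csign_one]
  · intro τ hτ h
    exact (h (Equiv.ext fun x => hinj (mem_fixers.1 hτ x))).elim
  · exact fun h => (h (one_mem_fixers _)).elim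
  · intro ρ _ h
    refine Finset.sum_eq_zero fun τ hτ => if_neg fun h1 => h ?_
    have h2 : τ = 1 := Equiv.ext fun x => hinj (mem_fixers.1 hτ x)
    rwa [h2, mul_one] at h1
  · exact fun h => (h (mem_fixers.2 fun x => by rw [hrow, hrow])).elim

lemma irrChar_trivialMP (hζ : IsPrimitiveRoot ζ l) (w : Wreath l n) :
    irrChar ζ (trivialMP l n) w = 1 := by
  have h1 : letterConst (trivialMP l n) = (n.factorial : ℂ) := by
    rw [letterConst, youngConst, ← letterElt, coeff_mul_eq_sum]
    simp [letterElt_trivialMP, Fintype.card_perm]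
  have h2 : compOf (trivialMP l n) = 0 := funext fun k => by
    rw [compOf, (cell_trivialMP _).1]
    rfl
  rw [irrChar_eq hζ, h1, h2]
  simp only [letterElt_trivialMP]
  have h3 : ((n.factorial : ℕ) : ℂ) ≠ 0 := Nat.cast_ne_zero.2 (Nat.factorial_ne_zero n)
  simp [baseChar, Fintype.card_perm, h3]

open Classical in
/-- The Molien-type formula for the column of the trivial multipartition. -/
lemma kostkaMacdonald_trivialMP (hζ : IsPrimitiveRoot ζ l)
    {K : MultiPartition l n → MultiPartition l n → Kt} (hK : IsKostkaMacdonald K)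
    (mu : MultiPartition l n) :
    K mu (trivialMP l n) = (∏ k ∈ Finset.range n, (1 - tt ^ (l * (k + 1)))) *
      ∑ w : Wreath l n, RatFunc.C ((wreathIdem ζ mu).coeff w) *
        ∏ c : Orb w.right, cycleFactor ζ w c := by
  -- Only `multiSchur mu` is expanded; the function of the trivial multipartition pairs to 1 with
  -- every `cyclePow`.
  rw [isKostkaMacdonald_iff.1 hK, multiG_eq, multiSchur_eq_sum_cyclePow hζ, map_sum,
    LinearMap.sum_apply, Finset.mul_sum]
  refine Finset.sum_congr rfl fun w _ => ?_
  rw [map_smul, map_smul, LinearMap.smul_apply, hallForm_cyclePow_zSub hζ,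
    hallForm_cyclePow_multiSchur hζ, irrChar_trivialMP hζ, map_one, mul_one,
    prod_hookPoly_trivialMP]
  simp only [smul_eq_mul, ← pow_mul]

end TrivialColumn

/-! ## Products of geometric series -/

section Geometric

/-- The exponent vectors of weight `D` for the weights `r`. -/
def weightVectors {ι : Type*} [Fintype ι] [DecidableEq ι] (r : ι → ℕ) (D : ℕ) : Finset (ι → ℕ) :=
  (Fintype.piFinset fun _ => Finset.range (D + 1)).filter fun k => ∑ i, r i * k i = D

lemma mem_weightVectors {ι : Type*} [Fintype ι] [DecidableEq ι] {r : ι → ℕ} (hr : ∀ i, 0 < r i)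
    {D : ℕ} {k : ι → ℕ} : k ∈ weightVectors r D ↔ ∑ i, r i * k i = D := by
  rw [weightVectors, Finset.mem_filter, and_iff_right_iff_imp]
  intro h
  refine Fintype.mem_piFinset.2 fun i => Finset.mem_range.2 (Nat.lt_succ_of_le ?_)
  calc k i ≤ r i * k i := Nat.le_mul_of_pos_left _ (hr i)
    _ ≤ ∑ i, r i * k i := Finset.single_le_sum (f := fun i => r i * k i)
        (fun _ _ => Nat.zero_le _) (Finset.mem_univ i)
    _ = D := h

variable {R : Type*} [CommRing R]

/-- The geometric series `∑ c ^ k X ^ (r k)`. -/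
def geomPow (c : R) (r : ℕ) : PowerSeries R :=
  PowerSeries.mk fun d => if r ∣ d then c ^ (d / r) else 0

lemma coeff_geomPow_mul (c : R) {r : ℕ} (hr : 0 < r) (k : ℕ) :
    PowerSeries.coeff (r * k) (geomPow c r) = c ^ k := by
  rw [geomPow, PowerSeries.coeff_mk, if_pos (dvd_mul_right r k), Nat.mul_div_cancel_left _ hr]

lemma one_sub_mul_geomPow (c : R) {r : ℕ} (hr : 0 < r) :
    (1 - PowerSeries.C c * PowerSeries.X ^ r) * geomPow c r = 1 := by
  ext d
  rw [sub_mul, one_mul, map_sub, mul_assoc, PowerSeries.coeff_C_mul, PowerSeries.coeff_X_pow_mul',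
    PowerSeries.coeff_one, geomPow, PowerSeries.coeff_mk, PowerSeries.coeff_mk]
  by_cases h : r ≤ d
  · rw [if_pos h, if_neg (show d ≠ 0 by omega)]
    by_cases h2 : r ∣ d
    · obtain ⟨k, rfl⟩ := h2
      have hk : 0 < k := Nat.pos_of_ne_zero fun h0 => by
        rw [h0] at h
        omega
      obtain ⟨k, rfl⟩ := Nat.exists_eq_succ_of_ne_zero hk.ne'
      have h3 : r * k.succ - r = r * k := by rw [Nat.mul_succ]; omega
      rw [h3, if_pos (dvd_mul_right r k.succ), if_pos (dvd_mul_right r k),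
        Nat.mul_div_cancel_left _ hr, Nat.mul_div_cancel_left _ hr, pow_succ', sub_self]
    · rw [if_neg h2, if_neg fun h3 => h2 ((Nat.dvd_sub_iff_left h dvd_rfl).1 h3), mul_zero,
        sub_zero]
  · rw [if_neg h, mul_zero, sub_zero]
    by_cases h2 : d = 0
    · simp [h2]
    · rw [if_neg h2, if_neg fun h3 => h (Nat.le_of_dvd (Nat.pos_of_ne_zero h2) h3)]

lemma coeff_prod_geomPow {ι : Type*} [Fintype ι] [DecidableEq ι] (c : ι → R) {r : ι → ℕ}
    (hr : ∀ i, 0 < r i) (D : ℕ) :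
    PowerSeries.coeff D (∏ i, geomPow (c i) (r i)) =
      ∑ k ∈ weightVectors r D, ∏ i, c i ^ k i := by
  rw [PowerSeries.coeff_prod]
  symm
  refine Finset.sum_bij_ne_zero
    (fun k _ _ => Finsupp.equivFunOnFinite.symm fun i => r i * k i) ?_ ?_ ?_ ?_
  · intro k hk _
    rw [Finset.mem_finsuppAntidiag]
    exact ⟨(mem_weightVectors hr).1 hk, Finset.subset_univ _⟩
  · intro k _ _ k' _ _ h
    funext i
    exact Nat.eq_of_mul_eq_mul_left (hr i) (congrFun (congrArg DFunLike.coe h) i)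
  · intro m hm hne
    have h1 : ∀ i, r i ∣ m i := by
      intro i
      by_contra h
      refine hne (Finset.prod_eq_zero (Finset.mem_univ i) ?_)
      rw [geomPow, PowerSeries.coeff_mk, if_neg h]
    have h2 : ∀ i, r i * (m i / r i) = m i := fun i => Nat.mul_div_cancel' (h1 i)
    refine ⟨fun i => m i / r i, (mem_weightVectors hr).2 ?_, ?_, ?_⟩
    · simp only [h2]
      exact (Finset.mem_finsuppAntidiag.1 hm).1
    · refine fun h => hne ?_
      rw [← h]
      refine Finset.prod_congr rfl fun i _ => ?_
      conv_lhs => rw [← h2 i, coeff_geomPow_mul _ (hr i)]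
    · ext i
      exact h2 i
  · intro k _ _
    refine Finset.prod_congr rfl fun i _ => ?_
    exact (coeff_geomPow_mul _ (hr i) _).symm

end Geometric

/-- The rank of an idempotent is its trace, taken on `S` because `V` may be infinite-dimensional. -/
lemma finrank_map_eq_trace {V : Type*} [AddCommGroup V] [Module ℂ V] {S : Submodule ℂ V}
    [Module.Finite ℂ S] {T : V →ₗ[ℂ] V} (hT : ∀ f ∈ S, T f ∈ S) (hTT : ∀ f ∈ S, T (T f) = T f) :
    (Module.finrank ℂ (S.map T) : ℂ) = LinearMap.trace ℂ _ (T.restrict hT) := by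
  have hp : LinearMap.IsProj (LinearMap.range (T.restrict hT)) (T.restrict hT) := by
    refine ⟨fun x => ⟨x, rfl⟩, ?_⟩
    rintro _ ⟨x, rfl⟩
    exact Subtype.ext (hTT x x.2)
  rw [hp.trace]
  congr 1
  rw [LinearEquiv.finrank_eq (Submodule.equivMapOfInjective _ (Submodule.subtype_injective S)
    (LinearMap.range (T.restrict hT))), ← LinearMap.range_comp, ← LinearMap.range_domRestrict]
  rfl

/-! ## Traces on homogeneous polynomials -/

section GradedTrace

open MvPolynomial

variable {n : ℕ}

/-- The exponent vectors of degree `D`. -/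
abbrev degVectors (n D : ℕ) : Finset (Fin n → ℕ) := weightVectors (fun _ : Fin n => 1) D

lemma mem_degVectors {D : ℕ} {a : Fin n → ℕ} : a ∈ degVectors n D ↔ ∑ i, a i = D := by
  rw [mem_weightVectors fun _ => Nat.one_pos]
  simp

/-- The monomial with exponent vector `a`. -/
def mono (a : Fin n → ℕ) : MvPolynomial (Fin n) ℂ := monomial (Finsupp.equivFunOnFinite.symm a) 1

lemma mono_eq_prod (a : Fin n → ℕ) : mono a = ∏ i, X i ^ a i := by
  rw [mono, monomial_eq, C_1, one_mul, Finsupp.prod_fintype _ _ fun _ => pow_zero _]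
  rfl

lemma coeff_mono (a b : Fin n → ℕ) :
    coeff (Finsupp.equivFunOnFinite.symm b) (mono a) = if a = b then 1 else 0 := by
  rw [mono, coeff_monomial]
  simp only [EmbeddingLike.apply_eq_iff_eq]

lemma mono_mem {a : Fin n → ℕ} {D : ℕ} (h : ∑ i, a i = D) :
    mono a ∈ homogeneousSubmodule (Fin n) ℂ D := by
  refine isHomogeneous_monomial 1 ?_
  rw [Finsupp.degree_eq_sum]
  exact h

lemma eq_sum_mono {f : MvPolynomial (Fin n) ℂ} {D : ℕ} (hf : f ∈ homogeneousSubmodule (Fin n) ℂ D) :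
    f = ∑ a ∈ degVectors n D, coeff (Finsupp.equivFunOnFinite.symm a) f • mono a := by
  refine MvPolynomial.ext _ _ fun m => ?_
  obtain ⟨b, rfl⟩ := Finsupp.equivFunOnFinite.symm.surjective m
  rw [coeff_sum]
  simp only [coeff_smul, coeff_mono, smul_eq_mul, mul_ite, mul_one, mul_zero]
  rw [Finset.sum_ite_eq' (degVectors n D) b]
  split_ifs with h
  · rfl
  · by_contra h0
    refine h (mem_degVectors.2 ?_)
    have := hf h0
    rw [Finsupp.weight_apply, Finsupp.sum_fintype _ _ fun _ => by simp] at this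
    simpa using this

/-- The monomial basis of the homogeneous polynomials of degree `D`. -/
def monoBasis (n D : ℕ) :
    Module.Basis (degVectors n D) ℂ (homogeneousSubmodule (Fin n) ℂ D) :=
  Module.Basis.ofEquivFun
    { toFun := fun f a => coeff (Finsupp.equivFunOnFinite.symm (a : Fin n → ℕ)) f.1
      map_add' := fun f g => funext fun a => by simp
      map_smul' := fun c f => funext fun a => by simp
      invFun := fun v => ⟨∑ a : degVectors n D, v a • mono (a : Fin n → ℕ),
        Submodule.sum_mem _ fun a _ => Submodule.smul_mem _ _ (mono_mem (mem_degVectors.1 a.2))⟩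
      left_inv := fun f => Subtype.ext (by
        conv_rhs => rw [eq_sum_mono f.2, ← Finset.sum_coe_sort])
      right_inv := fun v => funext fun b => by
        simp [coeff_sum, coeff_mono] }

lemma coe_monoBasis {D : ℕ} (a : degVectors n D) :
    (monoBasis n D a : MvPolynomial (Fin n) ℂ) = mono (a : Fin n → ℕ) := by
  classical
  rw [monoBasis, Module.Basis.coe_ofEquivFun]
  simp [Pi.single_apply]

instance finiteHomogeneous (D : ℕ) : Module.Finite ℂ (homogeneousSubmodule (Fin n) ℂ D) :=
  Module.Finite.of_basis (monoBasis n D)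

/-- The trace of a graded endomorphism in degree `D`. -/
def gradedTrace (D : ℕ) :
    (MvPolynomial (Fin n) ℂ →ₗ[ℂ] MvPolynomial (Fin n) ℂ) →ₗ[ℂ] ℂ where
  toFun T := ∑ a ∈ degVectors n D, coeff (Finsupp.equivFunOnFinite.symm a) (T (mono a))
  map_add' := fun S T => by simp [Finset.sum_add_distrib]
  map_smul' := fun c T => by simp [Finset.mul_sum]

lemma gradedTrace_apply (D : ℕ) (T : MvPolynomial (Fin n) ℂ →ₗ[ℂ] MvPolynomial (Fin n) ℂ) :
    gradedTrace D T =
      ∑ a ∈ degVectors n D, coeff (Finsupp.equivFunOnFinite.symm a) (T (mono a)) := rfl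

lemma trace_restrict {D : ℕ} {T : MvPolynomial (Fin n) ℂ →ₗ[ℂ] MvPolynomial (Fin n) ℂ}
    (hT : ∀ f ∈ homogeneousSubmodule (Fin n) ℂ D, T f ∈ homogeneousSubmodule (Fin n) ℂ D) :
    LinearMap.trace ℂ _ (T.restrict hT) = gradedTrace D T := by
  rw [LinearMap.trace_eq_matrix_trace ℂ (monoBasis n D), Matrix.trace, gradedTrace_apply,
    ← Finset.sum_coe_sort (degVectors n D) fun a =>
      coeff (Finsupp.equivFunOnFinite.symm a) (T (mono a))]
  refine Finset.sum_congr rfl fun a _ => ?_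
  rw [Matrix.diag_apply, LinearMap.toMatrix_apply, ← coe_monoBasis]
  rfl

lemma finrank_map_eq_gradedTrace {D : ℕ}
    {T : MvPolynomial (Fin n) ℂ →ₗ[ℂ] MvPolynomial (Fin n) ℂ}
    (hT : ∀ f ∈ homogeneousSubmodule (Fin n) ℂ D, T f ∈ homogeneousSubmodule (Fin n) ℂ D)
    (hTT : ∀ f, T (T f) = T f) :
    (Module.finrank ℂ ((homogeneousSubmodule (Fin n) ℂ D).map T) : ℂ) = gradedTrace D T := by
  rw [← trace_restrict hT]
  exact finrank_map_eq_trace hT fun x _ => hTT x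

variable {l : ℕ} [NeZero l] {ζ : ℂ}

lemma polyHom_mono (w : Wreath l n) (a : Fin n → ℕ) :
    polyHom ζ w (mono a) = (∏ i, ζ ^ (a i * (colour w (w.right i)).val)) •
      mono fun i => a (w.right⁻¹ i) := by
  rw [mono_eq_prod, mono_eq_prod, map_prod, smul_eq_C_mul, map_prod,
    ← Equiv.prod_comp w.right fun i => (X i : MvPolynomial (Fin n) ℂ) ^ a (w.right⁻¹ i),
    ← Finset.prod_mul_distrib]
  refine Finset.prod_congr rfl fun i _ => ?_
  rw [map_pow, polyHom_X, mul_pow, perm_inv_apply, ← map_pow, ← pow_mul, mul_comm (a i)]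

/-- Monomials are permuted up to roots of unity, so only the fixed exponent vectors contribute to
the trace. -/
lemma gradedTrace_polyRep (hζ : IsPrimitiveRoot ζ l) (w : Wreath l n) (D : ℕ) :
    gradedTrace D (polyRep hζ w) =
      ∑ a ∈ degVectors n D with ∀ i, a (w.right i) = a i, baseChar ζ a (colour w) := by
  rw [gradedTrace_apply, Finset.sum_filter]
  refine Finset.sum_congr rfl fun a _ => ?_
  rw [polyRep_apply, polyHom_mono, coeff_smul, coeff_mono, smul_eq_mul, mul_ite, mul_one, mul_zero]
  have h : ((fun i => a (w.right⁻¹ i)) = a) ↔ ∀ i, a (w.right i) = a i := by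
    constructor
    · intro h i
      rw [← congrFun h (w.right i), perm_inv_apply]
    · intro h
      funext i
      rw [← h, ← Equiv.Perm.mul_apply, mul_inv_cancel, Equiv.Perm.one_apply]
  simp only [h]
  refine if_ctx_congr Iff.rfl (fun h1 => ?_) fun _ => rfl
  rw [baseChar, ← Equiv.prod_comp w.right fun i => ζ ^ (a i * (colour w i).val)]
  exact Finset.prod_congr rfl fun i _ => by rw [h1]

open Classical in
/-- The graded trace of an element of the wreath product. -/
lemma gradedTrace_polyRep_eq_coeff (hζ : IsPrimitiveRoot ζ l) (w : Wreath l n) (D : ℕ) :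
    gradedTrace D (polyRep hζ w) = PowerSeries.coeff D
      (∏ c : Orb w.right, geomPow (ζ ^ (orbColour w c).val) (orbSize c)) := by
  rw [gradedTrace_polyRep, coeff_prod_geomPow _ fun c => orbSize_pos c]
  have hsum : ∀ k : Orb w.right → ℕ,
      ∑ c, orbSize c * k c = ∑ i, k (orbMk w.right i) := fun k => by
    rw [← Finset.sum_fiberwise Finset.univ fun i => orbMk w.right i]
    refine Finset.sum_congr rfl fun c _ => ?_
    rw [Finset.sum_congr rfl fun i hi => by rw [(Finset.mem_filter.1 hi).2], Finset.sum_const,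
      smul_eq_mul]
    rfl
  symm
  refine Finset.sum_bij' (fun k _ i => k (orbMk w.right i)) (fun a _ c => a c.out) ?_ ?_ ?_ ?_ ?_
  · intro k hk
    rw [Finset.mem_filter, mem_degVectors, ← hsum]
    exact ⟨(mem_weightVectors fun c => orbSize_pos c).1 hk, fun i => congrArg k (orbMk_apply w.right i)⟩
  · intro a ha
    rw [Finset.mem_filter, mem_degVectors] at ha
    rw [mem_weightVectors fun c => orbSize_pos c, hsum, ← ha.1]
    exact Finset.sum_congr rfl fun i _ => apply_orbMk_out ha.2 i
  · intro k _
    funext c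
    exact congrArg k (orbMk_out c)
  · intro a ha
    funext i
    exact apply_orbMk_out (Finset.mem_filter.1 ha).2 i
  · intro k _
    rw [← prod_orbColour hζ w k]
    exact Finset.prod_congr rfl fun c _ => by rw [← pow_mul, mul_comm]

end GradedTrace

/-! ## Standard monomials span the coinvariants -/

section StandardMonomials

open MvPolynomial

variable {l n : ℕ} [NeZero l] {ζ : ℂ}

lemma map_geomPow {R R' : Type*} [CommRing R] [CommRing R'] (φ : R →+* R') (c : R) (r : ℕ) :
    PowerSeries.map φ (geomPow c r) = geomPow (φ c) r := by
  ext d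
  rw [PowerSeries.coeff_map, geomPow, geomPow, PowerSeries.coeff_mk, PowerSeries.coeff_mk]
  split_ifs
  · rw [map_pow]
  · rw [map_zero]

lemma polyHom_X_pow (hζ : IsPrimitiveRoot ζ l) (w : Wreath l n) (i : Fin n) :
    polyHom ζ w (X i ^ l) = X (w.right i) ^ l := by
  rw [map_pow, polyHom_X, mul_pow, ← map_pow, ← pow_mul, mul_comm _ l, pow_mul, hζ.pow_eq_one,
    one_pow, C_1, one_mul]

/-- The generating series of the complete symmetric polynomials in the `l`-th powers of the
variables with index at least `k`. -/
def tailSeries (l n k : ℕ) : PowerSeries (MvPolynomial (Fin n) ℂ) :=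
  ∏ i ∈ Finset.univ.filter fun i : Fin n => k ≤ (i : ℕ), geomPow (X i ^ l) 1

/-- W permutes the l-th powers of the variables, so the full product is invariant; at the origin it
becomes the series 1, so positive coefficients have no constant term. -/
lemma coeff_tailSeries_zero_mem (hζ : IsPrimitiveRoot ζ l) {r : ℕ} (hr : r ≠ 0) :
    PowerSeries.coeff r (tailSeries l n 0) ∈ invIdeal (n := n) hζ := by
  refine Ideal.subset_span ⟨fun w => ?_, ?_⟩
  · rw [polyRep_apply]
    change (polyHom ζ w).toRingHom _ = _
    rw [← PowerSeries.coeff_map]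
    congr 1
    simp only [tailSeries, Nat.zero_le, Finset.filter_true]
    rw [map_prod, ← Equiv.prod_comp w.right fun i => geomPow (X i ^ l : MvPolynomial (Fin n) ℂ) 1]
    refine Finset.prod_congr rfl fun i _ => ?_
    rw [map_geomPow]
    congr 1
    exact polyHom_X_pow hζ w i
  · rw [← PowerSeries.coeff_map, tailSeries, map_prod, Finset.prod_eq_one, PowerSeries.coeff_one,
      if_neg hr]
    intro i _
    rw [map_geomPow, map_pow, constantCoeff_X, zero_pow (NeZero.ne l)]
    have h := one_sub_mul_geomPow (0 : ℂ) Nat.one_pos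
    rwa [map_zero, zero_mul, sub_zero, one_mul] at h

lemma tailSeries_succ (i : Fin n) :
    tailSeries l n (i + 1) = (1 - PowerSeries.C (X i ^ l) * PowerSeries.X) * tailSeries l n i := by
  have h : (Finset.univ.filter fun j : Fin n => (i : ℕ) ≤ j) =
      insert i (Finset.univ.filter fun j : Fin n => (i : ℕ) + 1 ≤ j) := by
    ext j
    simp only [Finset.mem_filter, Finset.mem_univ, true_and, Finset.mem_insert, Fin.ext_iff]
    omega
  have h2 := one_sub_mul_geomPow (X i ^ l : MvPolynomial (Fin n) ℂ) Nat.one_pos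
  rw [pow_one] at h2
  rw [tailSeries, tailSeries, h, Finset.prod_insert (by simp), ← mul_assoc, h2, one_mul]

/-- With y_i = x_i^l and h_r complete symmetric, h_r(y_{k+1}, ...) = h_r(y_k, ...) - y_k
h_{r-1}(y_k, ...). Each dropped variable costs one degree, so membership persists for r > k. -/
lemma coeff_tailSeries_mem (hζ : IsPrimitiveRoot ζ l) :
    ∀ {k r : ℕ}, k ≤ n → k < r → PowerSeries.coeff r (tailSeries l n k) ∈ invIdeal (n := n) hζ := by
  intro k
  induction k with
  | zero => exact fun {r} _ hr => coeff_tailSeries_zero_mem hζ (by omega)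
  | succ k ih =>
    intro r hk hr
    obtain ⟨r, rfl⟩ := Nat.exists_eq_succ_of_ne_zero (by omega : r ≠ 0)
    have h := tailSeries_succ (l := l) (⟨k, hk⟩ : Fin n)
    rw [h, sub_mul, one_mul, map_sub, mul_assoc, PowerSeries.coeff_C_mul,
      Nat.succ_eq_add_one, PowerSeries.coeff_succ_X_mul]
    exact Ideal.sub_mem _ (ih (by omega) (by omega))
      (Ideal.mul_mem_left _ _ (ih (by omega) (by omega)))

lemma coeff_tailSeries (k r : ℕ) :
    PowerSeries.coeff r (tailSeries l n k) =
      ∑ b ∈ (Finset.univ.filter fun i : Fin n => k ≤ (i : ℕ)).finsuppAntidiag r,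
        mono fun i => l * b i := by
  rw [tailSeries, PowerSeries.coeff_prod]
  refine Finset.sum_congr rfl fun b hb => ?_
  rw [mono_eq_prod, ← Finset.prod_subset (Finset.subset_univ
    (Finset.univ.filter fun i : Fin n => k ≤ (i : ℕ)))]
  · refine Finset.prod_congr rfl fun i _ => ?_
    have h := coeff_geomPow_mul (X i ^ l : MvPolynomial (Fin n) ℂ) Nat.one_pos (b i)
    rw [one_mul] at h
    rw [h, pow_mul]
  · intro i _ hi
    have h := (Finset.mem_finsuppAntidiag.1 hb).2
    have h0 : b i = 0 := by
      by_contra h1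
      exact hi (h (Finsupp.mem_support_iff.2 h1))
    rw [h0, mul_zero, pow_zero]

/-- The exponent vectors of the standard monomials of degree `d`. -/
def stdVectors (l n d : ℕ) : Finset (Fin n → ℕ) :=
  (degVectors n d).filter fun a => ∀ i : Fin n, a i < l * ((i : ℕ) + 1)

lemma mono_add (a b : Fin n → ℕ) : mono (a + b) = mono a * mono b := by
  simp only [mono_eq_prod, Pi.add_apply, pow_add, Finset.prod_mul_distrib]

/-- If a_i ≥ l(i+1), the monomial is divisible by y_i^{i+1}, a term of h_{i+1}(y_i, y_{i+1}, ...),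
which lies in the ideal. All other terms have larger weight ∑ i·a_i, which is at most n·d in degree
d; `N` bounds the remaining room. -/
lemma mono_mem_span_stdVectors (hζ : IsPrimitiveRoot ζ l) (d : ℕ) :
    ∀ (N : ℕ) (a : Fin n → ℕ), ∑ i, a i = d → n * d ≤ N + ∑ i : Fin n, (i : ℕ) * a i →
      mono a ∈ Submodule.span ℂ (mono '' (stdVectors l n d : Set (Fin n → ℕ))) ⊔
        (invIdeal (n := n) hζ).restrictScalars ℂ := by
  intro N
  induction N using Nat.strong_induction_on with
  | _ N ih =>
  intro a ha hN
  by_cases hstd : ∀ i : Fin n, a i < l * ((i : ℕ) + 1)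
  · refine Submodule.mem_sup_left (Submodule.subset_span ⟨a, ?_, rfl⟩)
    exact Finset.mem_coe.2 (Finset.mem_filter.2 ⟨mem_degVectors.2 ha, hstd⟩)
  push Not at hstd
  obtain ⟨i₀, hi₀⟩ := hstd
  set b₀ : Fin n →₀ ℕ := Finsupp.single i₀ ((i₀ : ℕ) + 1) with hb₀
  set A := (Finset.univ.filter fun i : Fin n => (i₀ : ℕ) ≤ (i : ℕ)).finsuppAntidiag ((i₀ : ℕ) + 1)
    with hA
  have hb₀A : b₀ ∈ A := by
    rw [hA, Finset.mem_finsuppAntidiag]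
    constructor
    · rw [hb₀, Finset.sum_eq_single i₀]
      · rw [Finsupp.single_eq_same]
      · exact fun j _ hj => Finsupp.single_eq_of_ne hj
      · exact fun h => (h (by simp)).elim
    · refine Finsupp.support_single_subset.trans ?_
      simp
  set a' : Fin n → ℕ := a - fun i => l * b₀ i with ha'
  have haa' : a = a' + fun i => l * b₀ i := by
    funext i
    rw [ha', Pi.add_apply, Pi.sub_apply]
    by_cases hi : i = i₀
    · subst hi
      rw [hb₀, Finsupp.single_eq_same]
      omega
    · rw [hb₀, Finsupp.single_eq_of_ne hi]
      omega
  have hsum : ∀ b ∈ A, ∑ i, b i = (i₀ : ℕ) + 1 := by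
    intro b hb
    rw [hA, Finset.mem_finsuppAntidiag] at hb
    rw [← hb.1]
    symm
    refine Finset.sum_subset (Finset.subset_univ _) fun i _ hi => ?_
    by_contra h1
    exact hi (hb.2 (Finsupp.mem_support_iff.2 h1))
  have hlt : ∀ b ∈ A, b ≠ b₀ → ∑ i : Fin n, (i : ℕ) * b₀ i < ∑ i : Fin n, (i : ℕ) * b i := by
    intro b hb hne
    have h0 : ∑ i : Fin n, (i : ℕ) * b₀ i = ∑ i : Fin n, (i₀ : ℕ) * b i := by
      rw [← Finset.mul_sum, hsum b hb, ← hsum b₀ hb₀A, Finset.mul_sum]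
      refine Finset.sum_congr rfl fun i _ => ?_
      by_cases hi : i = i₀
      · rw [hi]
      · rw [hb₀, Finsupp.single_eq_of_ne hi, mul_zero, mul_zero]
    rw [h0]
    have hle : ∀ i : Fin n, (i₀ : ℕ) * b i ≤ (i : ℕ) * b i := by
      intro i
      by_cases hi : b i = 0
      · rw [hi, mul_zero, mul_zero]
      · have := (Finset.mem_finsuppAntidiag.1 hb).2 (Finsupp.mem_support_iff.2 hi)
        exact Nat.mul_le_mul_right _ (Finset.mem_filter.1 this).2
    have hex : ∃ i, i ≠ i₀ ∧ b i ≠ 0 := by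
      by_contra h
      push Not at h
      refine hne (Finsupp.ext fun i => ?_)
      by_cases hi : i = i₀
      · rw [hb₀, hi, Finsupp.single_eq_same, ← hsum b hb,
          Finset.sum_eq_single i₀ (fun j _ hj => h j hj) (by simp)]
      · rw [hb₀, Finsupp.single_eq_of_ne hi, h i hi]
    obtain ⟨i, hi, hbi⟩ := hex
    refine Finset.sum_lt_sum (fun j _ => hle j) ⟨i, Finset.mem_univ i, ?_⟩
    have h1 := (Finset.mem_filter.1
      ((Finset.mem_finsuppAntidiag.1 hb).2 (Finsupp.mem_support_iff.2 hbi))).2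
    have h2 : (i₀ : ℕ) < i := lt_of_le_of_ne h1 fun h => hi (Fin.ext h.symm)
    exact Nat.mul_lt_mul_of_pos_right h2 (Nat.pos_of_ne_zero hbi)
  have hdeg : ∀ b ∈ A, ∑ i, (a' + fun i => l * b i) i = d := by
    intro b hb
    rw [← ha]
    conv_rhs => rw [haa']
    simp only [Pi.add_apply, Finset.sum_add_distrib, ← Finset.mul_sum, hsum b hb, hsum b₀ hb₀A]
  -- Solves the relation in the ideal for its term b₀.
  have key : mono a = mono a' * PowerSeries.coeff ((i₀ : ℕ) + 1) (tailSeries l n i₀) -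
      ∑ b ∈ A.erase b₀, mono (a' + fun i => l * b i) := by
    rw [coeff_tailSeries, ← hA, ← Finset.add_sum_erase A _ hb₀A, mul_add, ← mono_add, ← haa',
      Finset.mul_sum]
    simp only [mono_add]
    rw [add_sub_cancel_right]
  rw [key]
  refine Submodule.sub_mem _ (Submodule.mem_sup_right ?_) (Submodule.sum_mem _ fun b hb => ?_)
  · exact Ideal.mul_mem_left _ _ (coeff_tailSeries_mem hζ i₀.2.le (Nat.lt_succ_self _))
  · obtain ⟨hne, hbA⟩ := Finset.mem_erase.1 hb
    have hw : ∑ i : Fin n, (i : ℕ) * a i < ∑ i : Fin n, (i : ℕ) * (a' + fun i => l * b i) i := by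
      conv_lhs => rw [haa']
      simp only [Pi.add_apply, mul_add, Finset.sum_add_distrib, mul_left_comm _ l, ← Finset.mul_sum]
      have := Nat.mul_lt_mul_of_pos_left (hlt b hbA hne) (NeZero.pos l)
      omega
    have hb1 : ∑ i : Fin n, (i : ℕ) * (a' + fun i => l * b i) i ≤ n * d := by
      rw [← hdeg b hbA, Finset.mul_sum]
      exact Finset.sum_le_sum fun i _ => Nat.mul_le_mul_right _ i.2.le
    exact ih (n * d - ∑ i : Fin n, (i : ℕ) * (a' + fun i => l * b i) i) (by omega) _ (hdeg b hbA)
      (by omega)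

lemma homogeneous_le_span_stdVectors (hζ : IsPrimitiveRoot ζ l) (d : ℕ) :
    homogeneousSubmodule (Fin n) ℂ d ≤
      Submodule.span ℂ (mono '' (stdVectors l n d : Set (Fin n → ℕ))) ⊔
        (invIdeal (n := n) hζ).restrictScalars ℂ := by
  intro f hf
  rw [eq_sum_mono hf]
  refine Submodule.sum_mem _ fun a ha => Submodule.smul_mem _ _ ?_
  exact mono_mem_span_stdVectors hζ d (n * d) a (mem_degVectors.1 ha) (Nat.le_add_right _ _)

/-- Division with remainder of exponent vectors. -/
lemma sum_card_stdVectors_le (l n D : ℕ) [NeZero l] :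
    ∑ x ∈ Finset.HasAntidiagonal.antidiagonal D, (weightVectors (fun i : Fin n => l * ((i : ℕ) + 1)) x.1).card *
      (stdVectors l n x.2).card ≤ (degVectors n D).card := by
  have hpos : ∀ i : Fin n, 0 < l * ((i : ℕ) + 1) := fun i => Nat.mul_pos (NeZero.pos l) (by omega)
  simp only [← Finset.card_product]
  rw [← Finset.card_sigma]
  refine Finset.card_le_card_of_injOn
    (fun y i => l * ((i : ℕ) + 1) * y.2.1 i + y.2.2 i) ?_ ?_
  · rintro ⟨x, m, a⟩ h
    simp only [Finset.coe_sigma, Set.mem_sigma_iff, Finset.mem_coe, Finset.mem_product,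
      Finset.HasAntidiagonal.mem_antidiagonal] at h
    obtain ⟨h1, h2, h3⟩ := h
    rw [Finset.mem_coe, mem_degVectors, Finset.sum_add_distrib, (mem_weightVectors hpos).1 h2,
      mem_degVectors.1 (Finset.mem_filter.1 h3).1, h1]
  · rintro ⟨⟨x1, x2⟩, m, a⟩ h ⟨⟨x1', x2'⟩, m', a'⟩ h' heq
    simp only [Finset.coe_sigma, Set.mem_sigma_iff, Finset.mem_coe, Finset.mem_product,
      Finset.HasAntidiagonal.mem_antidiagonal] at h h'
    have hmod : ∀ i, a i = a' i := fun i => by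
      have := congrArg (· % (l * ((i : ℕ) + 1))) (congrFun heq i)
      simpa [Nat.mul_add_mod, Nat.mod_eq_of_lt ((Finset.mem_filter.1 h.2.2).2 i),
        Nat.mod_eq_of_lt ((Finset.mem_filter.1 h'.2.2).2 i)] using this
    have ha : a = a' := funext hmod
    subst ha
    have hm : m = m' := funext fun i => by
      have := congrFun heq i
      exact Nat.eq_of_mul_eq_mul_left (hpos i) (Nat.add_right_cancel this)
    subst hm
    have e1 := (mem_weightVectors hpos).1 h.2.1
    have e1' := (mem_weightVectors hpos).1 h'.2.1
    have e2 := mem_degVectors.1 (Finset.mem_filter.1 h.2.2).1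
    have e2' := mem_degVectors.1 (Finset.mem_filter.1 h'.2.2).1
    subst e1 e2
    subst e1' e2'
    rfl

lemma stdVectors_eq_empty {d : ℕ} (hd : n * (l * n) < d) : stdVectors l n d = ∅ := by
  refine Finset.eq_empty_of_forall_notMem fun a ha => ?_
  obtain ⟨h1, h2⟩ := Finset.mem_filter.1 ha
  rw [mem_degVectors] at h1
  have : ∑ i, a i ≤ ∑ _i : Fin n, l * n := Finset.sum_le_sum fun i _ =>
    (h2 i).le.trans (Nat.mul_le_mul_left _ i.2)
  rw [Finset.sum_const, Finset.card_univ, Fintype.card_fin, smul_eq_mul] at this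
  omega

end StandardMonomials

/-! ## Generators of the ideal of invariants -/

section Generators

open MvPolynomial

variable {l n : ℕ} [NeZero l] {ζ : ℂ}

/-- The fundamental invariants: elementary symmetric polynomials in the `l`-th powers. -/
def fundInv (l n : ℕ) (k : Fin n) : MvPolynomial (Fin n) ℂ :=
  expand l (esymm (Fin n) ℂ ((k : ℕ) + 1))

lemma polyHom_expand (hζ : IsPrimitiveRoot ζ l) (w : Wreath l n) (f : MvPolynomial (Fin n) ℂ) :
    polyHom ζ w (expand l f) = expand l (rename w.right f) := by
  have h : (polyHom ζ w).comp (expand l) = (expand l).comp (rename w.right) := by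
    refine algHom_ext fun i => ?_
    rw [AlgHom.comp_apply, AlgHom.comp_apply, expand_X, rename_X, expand_X, polyHom_X_pow hζ]
  exact DFunLike.congr_fun h f

lemma polyHom_fundInv (hζ : IsPrimitiveRoot ζ l) (w : Wreath l n) (k : Fin n) :
    polyHom ζ w (fundInv l n k) = fundInv l n k := by
  rw [fundInv, polyHom_expand hζ, esymm_isSymmetric]

lemma isHomogeneous_fundInv (k : Fin n) : (fundInv l n k).IsHomogeneous (l * ((k : ℕ) + 1)) := by
  have h : (esymm (Fin n) ℂ ((k : ℕ) + 1)).IsHomogeneous ((k : ℕ) + 1) := by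
    refine IsHomogeneous.sum _ _ _ fun t ht => ?_
    have h1 := IsHomogeneous.prod t (fun i => (X i : MvPolynomial (Fin n) ℂ)) (fun _ => 1)
      fun i _ => isHomogeneous_X ℂ i
    rwa [Finset.sum_const, smul_eq_mul, mul_one, (Finset.mem_powersetCard.1 ht).2] at h1
  exact h.aeval (n := l) _ fun i => isHomogeneous_X_pow i l

lemma constantCoeff_fundInv (k : Fin n) : constantCoeff (fundInv l n k) = 0 := by
  by_contra h
  have := (isHomogeneous_fundInv (l := l) k).coeff_eq_zero (d := 0) (by
    simp [NeZero.ne l])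
  exact h this

/-- The base element with colour 1 at `i` scales the coefficient of x^m by ζ^{m_i}. -/
lemma dvd_of_invariant (hζ : IsPrimitiveRoot ζ l) {f : MvPolynomial (Fin n) ℂ}
    (hf : ∀ w : Wreath l n, polyRep hζ w f = f) {m : Fin n →₀ ℕ} (hm : coeff m f ≠ 0) (i : Fin n) :
    l ∣ m i := by
  have h1 := hf (baseElt (Pi.single i 1))
  have h2 : ∀ (g : MvPolynomial (Fin n) ℂ) (m : Fin n →₀ ℕ),
      coeff m (polyHom ζ (baseElt (Pi.single i 1) : Wreath l n) g) =
        (ζ ^ (1 : ZMod l).val) ^ m i * coeff m g := by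
    intro g
    induction g using MvPolynomial.induction_on' with
    | monomial u c =>
      intro m
      have h3 : polyHom ζ (baseElt (Pi.single i 1) : Wreath l n) (monomial u c) =
          monomial u ((ζ ^ (1 : ZMod l).val) ^ u i * c) := by
        rw [polyHom, aeval_monomial, Finsupp.prod_fintype _ _ fun _ => pow_zero _]
        have h4 : ∀ k : Fin n, (C (ζ ^ (colour (baseElt (Pi.single i 1) : Wreath l n)
            ((baseElt (Pi.single i 1) : Wreath l n).right k)).val) *
            X ((baseElt (Pi.single i 1) : Wreath l n).right k) : MvPolynomial (Fin n) ℂ) ^ u k =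
            C (if k = i then (ζ ^ (1 : ZMod l).val) ^ u i else 1) * X k ^ u k := by
          intro k
          have h5 : (baseElt (Pi.single i 1) : Wreath l n).right = 1 := rfl
          have h6 : colour (baseElt (Pi.single i 1) : Wreath l n) k =
            (Pi.single i 1 : Fin n → ZMod l) k := rfl
          rw [h5, Equiv.Perm.one_apply, h6, mul_pow, ← map_pow]
          by_cases hk : k = i
          · subst hk
            rw [Pi.single_eq_same, if_pos rfl]
          · rw [Pi.single_eq_of_ne hk, if_neg hk, ZMod.val_zero, pow_zero, one_pow]
        rw [Finset.prod_congr rfl fun k _ => h4 k, Finset.prod_mul_distrib, ← map_prod,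
          Finset.prod_ite_eq' Finset.univ i, if_pos (Finset.mem_univ _), monomial_eq,
          Finsupp.prod_fintype _ _ fun _ => pow_zero _, algebraMap_eq, ← mul_assoc, ← map_mul,
          mul_comm c]
      rw [h3, coeff_monomial, coeff_monomial]
      split_ifs with h
      · rw [h]
      · rw [mul_zero]
    | add p q hp hq =>
      intro m
      rw [map_add, coeff_add, coeff_add, hp, hq, mul_add]
  have h3 := congrArg (coeff m) h1
  rw [polyRep_apply, h2] at h3
  have h4 := mul_right_cancel₀ hm (h3.trans (one_mul _).symm)
  -- For l = 1 the representative of 1 in ℤ/l is 0, so that case is treated apart.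
  rcases Nat.lt_or_ge 1 l with hl | hl
  · have : Fact (1 < l) := ⟨hl⟩
    rw [ZMod.val_one, pow_one] at h4
    exact hζ.dvd_of_pow_eq_one _ h4
  · have hl1 : l = 1 := le_antisymm hl (NeZero.pos l)
    rw [hl1]
    exact one_dvd _

/-- Invariance under the base group makes f a polynomial in the l-th powers, and invariance under
permutations makes that polynomial symmetric; then the fundamental theorem applies. -/
lemma exists_aeval_fundInv (hζ : IsPrimitiveRoot ζ l) {f : MvPolynomial (Fin n) ℂ}
    (hf : ∀ w : Wreath l n, polyRep hζ w f = f) :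
    ∃ P : MvPolynomial (Fin n) ℂ, f = aeval (fundInv l n) P := by
  have hl : 0 < l := NeZero.pos l
  obtain ⟨g, hg⟩ : ∃ g : MvPolynomial (Fin n) ℂ, f = expand l g := by
    refine ⟨∑ m ∈ f.support, monomial (m.mapRange (· / l) (Nat.zero_div l)) (coeff m f), ?_⟩
    rw [map_sum]
    conv_lhs => rw [f.as_sum]
    refine Finset.sum_congr rfl fun m hm => ?_
    rw [expand_monomial]
    refine congrArg (fun u => monomial u (coeff m f)) (Finsupp.ext fun i => ?_)
    rw [Finsupp.smul_apply, Finsupp.mapRange_apply, smul_eq_mul,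
      Nat.mul_div_cancel' (dvd_of_invariant hζ hf (mem_support_iff.1 hm) i)]
  have hsym : g.IsSymmetric := by
    intro σ
    have h := hf (permElt σ)
    rw [polyRep_apply, hg, polyHom_expand hζ] at h
    exact expand_injective hl h
  obtain ⟨P, hP⟩ := esymmAlgHom_fin_surjective ℂ (le_refl n) ⟨g, hsym⟩
  refine ⟨P, ?_⟩
  have h1 := esymmAlgHom_apply (σ := Fin n) (n := n) P
  rw [hP] at h1
  rw [hg]
  change expand l g = _
  change g = _ at h1
  rw [h1, ← AlgHom.comp_apply, comp_aeval]
  rfl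

/-- A polynomial in the `fundInv` differs from its constant term by an element of their ideal. -/
lemma invIdeal_eq_span (hζ : IsPrimitiveRoot ζ l) :
    invIdeal (n := n) hζ = Ideal.span (Set.range (fundInv l n)) := by
  refine le_antisymm (Ideal.span_le.2 ?_) (Ideal.span_le.2 ?_)
  · rintro f ⟨hf, hf0⟩
    obtain ⟨P, rfl⟩ := exists_aeval_fundInv hζ hf
    have key : ∀ Q : MvPolynomial (Fin n) ℂ,
        aeval (fundInv l n) Q - C (constantCoeff Q) ∈ Ideal.span (Set.range (fundInv l n)) ∧
          constantCoeff (aeval (fundInv l n) Q) = constantCoeff Q := by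
      intro Q
      induction Q using MvPolynomial.induction_on with
      | C a => simp
      | add p q hp hq =>
        refine ⟨?_, by simp only [map_add, hp.2, hq.2]⟩
        rw [map_add, map_add, C_add, add_sub_add_comm]
        exact Ideal.add_mem _ hp.1 hq.1
      | mul_X p i _ =>
        simp only [map_mul, aeval_X, constantCoeff_X, mul_zero, map_zero, sub_zero,
          constantCoeff_fundInv, and_true]
        exact Ideal.mul_mem_left _ _ (Ideal.subset_span ⟨i, rfl⟩)
    have h := key P
    rw [← h.2, hf0, map_zero, sub_zero] at h
    exact h.1
  · rintro _ ⟨k, rfl⟩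
    exact Ideal.subset_span ⟨fun w => polyHom_fundInv hζ w k, constantCoeff_fundInv k⟩

lemma homogeneousComponent_mul_of_isHomogeneous {g : MvPolynomial (Fin n) ℂ} {d : ℕ}
    (hg : g.IsHomogeneous d) (h : MvPolynomial (Fin n) ℂ) (D : ℕ) :
    homogeneousComponent D (g * h) =
      if d ≤ D then g * homogeneousComponent (D - d) h else 0 := by
  have h1 : homogeneousComponent D (g * h) = ∑ i ∈ Finset.range (h.totalDegree + 1),
      if D = d + i then g * homogeneousComponent i h else 0 := by
    conv_lhs => rw [← sum_homogeneousComponent h, Finset.mul_sum, map_sum]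
    exact Finset.sum_congr rfl fun i _ =>
      homogeneousComponent_of_mem (hg.mul (homogeneousComponent_isHomogeneous i h))
  rw [h1]
  split_ifs with hd
  · rw [Finset.sum_eq_single (D - d)]
    · rw [if_pos (by omega)]
    · intro i _ hi
      rw [if_neg (by omega)]
    · intro hi
      rw [if_pos (by omega), homogeneousComponent_eq_zero _ _ (by
        rw [Finset.mem_range] at hi
        omega), mul_zero]
  · exact Finset.sum_eq_zero fun i _ => if_neg (by omega)

/-- Only the homogeneous components of the coefficients in the right degree matter. The truncated
subtraction is harmless, as the sum is restricted to l(k+1) ≤ D. -/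
lemma exists_eq_sum_fundInv (hζ : IsPrimitiveRoot ζ l) {f : MvPolynomial (Fin n) ℂ} {D : ℕ}
    (hf : f ∈ homogeneousSubmodule (Fin n) ℂ D) (hI : f ∈ invIdeal (n := n) hζ) :
    ∃ h : Fin n → MvPolynomial (Fin n) ℂ,
      (∀ k : Fin n, h k ∈ homogeneousSubmodule (Fin n) ℂ (D - l * ((k : ℕ) + 1))) ∧
      f = ∑ k ∈ Finset.univ.filter fun k : Fin n => l * ((k : ℕ) + 1) ≤ D, fundInv l n k * h k := by
  rw [invIdeal_eq_span, Ideal.span, Submodule.mem_span_range_iff_exists_fun] at hI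
  obtain ⟨c, hc⟩ := hI
  refine ⟨fun k => homogeneousComponent (D - l * ((k : ℕ) + 1)) (c k),
    fun k => homogeneousComponent_mem _ _, ?_⟩
  have h1 := congrArg (homogeneousComponent D) hc
  rw [homogeneousComponent_of_mem hf, if_pos rfl, map_sum] at h1
  rw [← h1, Finset.sum_filter]
  refine Finset.sum_congr rfl fun k _ => ?_
  rw [smul_eq_mul, mul_comm, homogeneousComponent_mul_of_isHomogeneous (isHomogeneous_fundInv k)]

end Generators

/-! ## The graded Nakayama bound -/

section Nakayama

open MvPolynomial

variable {l n : ℕ} [NeZero l] {ζ : ℂ}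

lemma exists_finset_span_sup_ker {V V' : Type*} [AddCommGroup V] [Module ℂ V] [AddCommGroup V']
    [Module ℂ V'] (φ : V →ₗ[ℂ] V') (M : Submodule ℂ V) [Module.Finite ℂ (M.map φ)] :
    ∃ B : Finset V, (∀ b ∈ B, b ∈ M) ∧ B.card ≤ Module.finrank ℂ (M.map φ) ∧
      M ≤ Submodule.span ℂ (B : Set V) ⊔ LinearMap.ker φ := by
  classical
  let b := Module.finBasis ℂ (M.map φ)
  have hb : ∀ i, ∃ v ∈ M, φ v = b i := fun i => (b i).2
  choose v hv hφ using hb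
  refine ⟨Finset.univ.image v, ?_, ?_, ?_⟩
  · intro x hx
    obtain ⟨i, _, rfl⟩ := Finset.mem_image.1 hx
    exact hv i
  · exact Finset.card_image_le.trans (by rw [Finset.card_univ, Fintype.card_fin])
  · intro x hx
    have h1 := b.sum_repr ⟨φ x, x, hx, rfl⟩
    set c := b.repr ⟨φ x, x, hx, rfl⟩
    have h2 : φ x = φ (∑ i, c i • v i) := by
      rw [map_sum]
      simp only [map_smul, hφ]
      have := congrArg Subtype.val h1
      simpa using this.symm
    rw [← add_sub_cancel (∑ i, c i • v i) x]
    refine Submodule.add_mem_sup (Submodule.sum_mem _ fun i _ => Submodule.smul_mem _ _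
      (Submodule.subset_span (by simp))) ?_
    rw [LinearMap.mem_ker, map_sub, h2, sub_self]

lemma sum_mul_add_single (r m : Fin n → ℕ) (k : Fin n) :
    ∑ i, r i * (m + Pi.single k 1 : Fin n → ℕ) i = ∑ i, r i * m i + r k := by
  simp [mul_add, Finset.sum_add_distrib, Pi.single_apply]

/-- The monomials in the fundamental invariants. -/
def fundMono (l n : ℕ) (m : Fin n → ℕ) : MvPolynomial (Fin n) ℂ := ∏ k, fundInv l n k ^ m k

/-- The projections for which the Hilbert series is computed. -/
structure IsInvProj (hζ : IsPrimitiveRoot ζ l)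
    (p : MvPolynomial (Fin n) ℂ →ₗ[ℂ] MvPolynomial (Fin n) ℂ) : Prop where
  idem : ∀ f, p (p f) = p f
  fund : ∀ k f, p (fundInv l n k * f) = fundInv l n k * p f
  homogeneous : ∀ d, ∀ f ∈ homogeneousSubmodule (Fin n) ℂ d,
    p f ∈ homogeneousSubmodule (Fin n) ℂ d
  ideal : ∀ f ∈ invIdeal (n := n) hζ, p f ∈ invIdeal (n := n) hζ

/-- The dimension of the image of a projection in degree `d`. -/
def imageDim (p : MvPolynomial (Fin n) ℂ →ₗ[ℂ] MvPolynomial (Fin n) ℂ) (d : ℕ) : ℕ :=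
  Module.finrank ℂ ((homogeneousSubmodule (Fin n) ℂ d).map p)

/-- The dimension of the image of a projection in the coinvariants of degree `d`. -/
def coinvDim (hζ : IsPrimitiveRoot ζ l)
    (p : MvPolynomial (Fin n) ℂ →ₗ[ℂ] MvPolynomial (Fin n) ℂ) (d : ℕ) : ℕ :=
  Module.finrank ℂ (((homogeneousSubmodule (Fin n) ℂ d).map p).map
    ((invIdeal (n := n) hζ).restrictScalars ℂ).mkQ)

/-- Graded Nakayama: lifts of a basis of the image in the coinvariants, multiplied by monomials in
the fundamental invariants, span the image, by induction on the degree. -/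
lemma imageDim_le {hζ : IsPrimitiveRoot ζ l}
    {p : MvPolynomial (Fin n) ℂ →ₗ[ℂ] MvPolynomial (Fin n) ℂ} (hp : IsInvProj hζ p) (D : ℕ) :
    imageDim p D ≤ ∑ x ∈ Finset.HasAntidiagonal.antidiagonal D,
      (weightVectors (fun i : Fin n => l * ((i : ℕ) + 1)) x.1).card * coinvDim hζ p x.2 := by
  classical
  have hpos : ∀ i : Fin n, 0 < l * ((i : ℕ) + 1) := fun i => Nat.mul_pos (NeZero.pos l) (by omega)
  have hB := fun d => exists_finset_span_sup_ker ((invIdeal (n := n) hζ).restrictScalars ℂ).mkQ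
    ((homogeneousSubmodule (Fin n) ℂ d).map p)
  choose B hBmem hBcard hBspan using hB
  simp only [Submodule.ker_mkQ] at hBspan
  let T : ℕ → Finset (MvPolynomial (Fin n) ℂ) := fun D =>
    (Finset.HasAntidiagonal.antidiagonal D).biUnion fun x => Finset.image₂
      (fun m b => fundMono l n m * b) (weightVectors (fun i : Fin n => l * ((i : ℕ) + 1)) x.1)
      (B x.2)
  have hT : ∀ D, (homogeneousSubmodule (Fin n) ℂ D).map p ≤
      Submodule.span ℂ (T D : Set (MvPolynomial (Fin n) ℂ)) := by
    intro D
    induction D using Nat.strong_induction_on with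
    | _ D ih =>
    intro f hf
    obtain ⟨v, hv, g, hg, rfl⟩ := Submodule.mem_sup.1 (hBspan D hf)
    have hvT : v ∈ Submodule.span ℂ (T D : Set (MvPolynomial (Fin n) ℂ)) := by
      refine Submodule.span_mono ?_ hv
      intro b hb
      refine Finset.mem_coe.2 (Finset.mem_biUnion.2 ⟨(0, D), ?_, Finset.mem_image₂.2
        ⟨0, ?_, b, hb, ?_⟩⟩)
      · rw [Finset.HasAntidiagonal.mem_antidiagonal, zero_add]
      · rw [mem_weightVectors hpos]
        simp
      · simp [fundMono]
    refine Submodule.add_mem _ hvT ?_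
    have hvp : v ∈ (homogeneousSubmodule (Fin n) ℂ D).map p :=
      Submodule.span_le.2 (fun b hb => hBmem D b hb) hv
    have hgp : g ∈ (homogeneousSubmodule (Fin n) ℂ D).map p := by
      have := Submodule.sub_mem _ hf hvp
      rwa [add_sub_cancel_left] at this
    obtain ⟨g', hg', hgg'⟩ := hgp
    have hgD : g ∈ homogeneousSubmodule (Fin n) ℂ D := by
      rw [← hgg']
      exact hp.homogeneous D g' hg'
    have hpg : p g = g := by rw [← hgg', hp.idem]
    obtain ⟨h, hh, hgh⟩ := exists_eq_sum_fundInv hζ hgD hg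
    -- Applying `p` again replaces the cofactors `h k` by `p (h k)`, which lie in the image in
    -- smaller degree.
    rw [← hpg, hgh, map_sum]
    refine Submodule.sum_mem _ fun k hk => ?_
    rw [hp.fund]
    have hkD := (Finset.mem_filter.1 hk).2
    have h1 := ih (D - l * ((k : ℕ) + 1)) (by have := hpos k; omega)
      (Submodule.mem_map_of_mem (f := p) (hh k))
    have h2 : Submodule.span ℂ (T (D - l * ((k : ℕ) + 1)) : Set (MvPolynomial (Fin n) ℂ)) ≤
        (Submodule.span ℂ (T D : Set (MvPolynomial (Fin n) ℂ))).comap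
          (LinearMap.mulLeft ℂ (fundInv l n k)) := by
      refine Submodule.span_le.2 fun y hy => ?_
      obtain ⟨⟨d1, d2⟩, hx, hy⟩ := Finset.mem_biUnion.1 (Finset.mem_coe.1 hy)
      obtain ⟨m, hm, b, hb, rfl⟩ := Finset.mem_image₂.1 hy
      rw [Finset.HasAntidiagonal.mem_antidiagonal] at hx
      refine Submodule.subset_span (Finset.mem_coe.2 (Finset.mem_biUnion.2
        ⟨(d1 + l * ((k : ℕ) + 1), d2), ?_, Finset.mem_image₂.2
        ⟨m + Pi.single k 1, ?_, b, hb, ?_⟩⟩))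
      · rw [Finset.HasAntidiagonal.mem_antidiagonal]
        dsimp only at hx ⊢
        omega
      · rw [mem_weightVectors hpos] at hm ⊢
        rw [sum_mul_add_single, hm]
      · rw [LinearMap.mulLeft_apply, ← mul_assoc]
        congr 1
        simp only [fundMono, Pi.add_apply, pow_add, Finset.prod_mul_distrib]
        rw [mul_comm, Fintype.prod_eq_single k fun j hj => by rw [Pi.single_eq_of_ne hj, pow_zero],
          Pi.single_eq_same, pow_one]
    exact h2 h1
  calc imageDim p D ≤ Module.finrank ℂ
        (Submodule.span ℂ (T D : Set (MvPolynomial (Fin n) ℂ))) :=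
        Submodule.finrank_mono (hT D)
    _ ≤ (T D).card := finrank_span_finset_le_card (R := ℂ) (T D)
    _ ≤ ∑ x ∈ Finset.HasAntidiagonal.antidiagonal D, (Finset.image₂
          (fun m b => fundMono l n m * b)
          (weightVectors (fun i : Fin n => l * ((i : ℕ) + 1)) x.1) (B x.2)).card :=
        Finset.card_biUnion_le
    _ ≤ _ := Finset.sum_le_sum fun x _ => (Finset.card_image₂_le _ _ _).trans
        (Nat.mul_le_mul_left _ (hBcard x.2))

end Nakayama

/-! ## Dimensions of the coinvariants -/

section Dimensions

open MvPolynomial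

variable {l n : ℕ} [NeZero l] {ζ : ℂ}

lemma coinvDim_id_le (hζ : IsPrimitiveRoot ζ l) (d : ℕ) :
    coinvDim (n := n) hζ LinearMap.id d ≤ (stdVectors l n d).card := by
  classical
  set φ := ((invIdeal (n := n) hζ).restrictScalars ℂ).mkQ
  have h1 : (homogeneousSubmodule (Fin n) ℂ d).map φ ≤ Submodule.span ℂ
      (((stdVectors l n d).image fun a => φ (mono a) : Finset _) : Set _) := by
    refine (Submodule.map_mono (homogeneous_le_span_stdVectors hζ d)).trans ?_
    rw [Submodule.map_sup, Submodule.mkQ_map_self, sup_bot_eq, Submodule.map_span, Finset.coe_image,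
      Set.image_image]
  rw [coinvDim, Submodule.map_id]
  exact (Submodule.finrank_mono h1).trans
    ((finrank_span_finset_le_card (R := ℂ) _).trans Finset.card_image_le)

lemma IsInvProj.id_sub {hζ : IsPrimitiveRoot ζ l}
    {p : MvPolynomial (Fin n) ℂ →ₗ[ℂ] MvPolynomial (Fin n) ℂ} (hp : IsInvProj hζ p) :
    IsInvProj hζ (LinearMap.id - p) where
  idem f := by simp [hp.idem]
  fund k f := by simp [hp.fund, mul_sub]
  homogeneous d f hf := Submodule.sub_mem _ hf (hp.homogeneous d f hf)
  ideal f hf := Ideal.sub_mem _ hf (hp.ideal f hf)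

/-- The ranks are traces, and the traces of `p` and `id - p` add up to that of the identity. -/
lemma imageDim_add {hζ : IsPrimitiveRoot ζ l}
    {p : MvPolynomial (Fin n) ℂ →ₗ[ℂ] MvPolynomial (Fin n) ℂ} (hp : IsInvProj hζ p) (D : ℕ) :
    imageDim p D + imageDim (LinearMap.id - p) D = (degVectors n D).card := by
  have h : ((imageDim p D + imageDim (LinearMap.id - p) D : ℕ) : ℂ) =
      ((degVectors n D).card : ℕ) := by
    rw [Nat.cast_add, imageDim, imageDim, finrank_map_eq_gradedTrace (hp.homogeneous D) hp.idem,
      finrank_map_eq_gradedTrace (hp.id_sub.homogeneous D) hp.id_sub.idem, map_sub,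
      add_sub_cancel, gradedTrace_apply]
    simp [coeff_mono]
  exact_mod_cast h

/-- Rank and nullity of the endomorphism induced by `p` on the image of `M` in the quotient; the
image of `id - p` lies in its kernel. -/
lemma finrank_map_mkQ_add_le {V : Type*} [AddCommGroup V] [Module ℂ V] (I M : Submodule ℂ V)
    [Module.Finite ℂ M] {p : V →ₗ[ℂ] V} (hI : I ≤ I.comap p) (hM : ∀ f ∈ M, p f ∈ M)
    (hp : ∀ f, p (p f) = p f) :
    Module.finrank ℂ ((M.map p).map I.mkQ) + Module.finrank ℂ ((M.map (LinearMap.id - p)).map I.mkQ) ≤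
      Module.finrank ℂ (M.map I.mkQ) := by
  set f := (I.mapQ I p hI).domRestrict (M.map I.mkQ)
  have h1 : LinearMap.range f = (M.map p).map I.mkQ := by
    rw [LinearMap.range_domRestrict, ← Submodule.map_comp, ← Submodule.map_comp,
      Submodule.mapQ_mkQ]
  have h2 : (M.map (LinearMap.id - p)).map I.mkQ ≤
      (LinearMap.ker f).map (M.map I.mkQ).subtype := by
    rintro _ ⟨_, ⟨v, hv, rfl⟩, rfl⟩
    refine ⟨⟨I.mkQ (v - p v), v - p v, M.sub_mem hv (hM v hv), rfl⟩, ?_, rfl⟩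
    change I.mapQ I p hI (I.mkQ (v - p v)) = 0
    rw [Submodule.mkQ_apply, Submodule.mapQ_apply, map_sub, hp, sub_self, Submodule.Quotient.mk_zero]
  have h3 := LinearMap.finrank_range_add_finrank_ker f
  have h4 : Module.finrank ℂ ((LinearMap.ker f).map (M.map I.mkQ).subtype) =
      Module.finrank ℂ (LinearMap.ker f) :=
    (LinearEquiv.finrank_eq (Submodule.equivMapOfInjective _
      (Submodule.subtype_injective (M.map I.mkQ)) (LinearMap.ker f))).symm
  rw [← h3, h1, ← h4]
  exact Nat.add_le_add_left (Submodule.finrank_mono h2) _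

lemma coinvDim_add_le {hζ : IsPrimitiveRoot ζ l}
    {p : MvPolynomial (Fin n) ℂ →ₗ[ℂ] MvPolynomial (Fin n) ℂ} (hp : IsInvProj hζ p) (d : ℕ) :
    coinvDim hζ p d + coinvDim hζ (LinearMap.id - p) d ≤ (stdVectors l n d).card := by
  refine le_trans ?_ (coinvDim_id_le hζ d)
  rw [coinvDim, coinvDim, coinvDim, Submodule.map_id]
  exact finrank_map_mkQ_add_le _ _ hp.ideal (hp.homogeneous d) hp.idem

/-- The Hilbert series identity: the polynomial ring is free over the invariants. -/
lemma imageDim_eq {hζ : IsPrimitiveRoot ζ l}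
    {p : MvPolynomial (Fin n) ℂ →ₗ[ℂ] MvPolynomial (Fin n) ℂ} (hp : IsInvProj hζ p) (D : ℕ) :
    imageDim p D = ∑ x ∈ Finset.HasAntidiagonal.antidiagonal D,
      (weightVectors (fun i : Fin n => l * ((i : ℕ) + 1)) x.1).card * coinvDim hζ p x.2 := by
  -- The bounds for `p` and `id - p` add up to at most the number of monomials of degree D, which is
  -- also the sum of the two left sides; hence both are equalities.
  have h1 := imageDim_le hp D
  have h2 := imageDim_le hp.id_sub D
  have h3 := imageDim_add hp D
  have h4 := sum_card_stdVectors_le l n D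
  have h5 : ∑ x ∈ Finset.HasAntidiagonal.antidiagonal D,
      (weightVectors (fun i : Fin n => l * ((i : ℕ) + 1)) x.1).card * coinvDim hζ p x.2 +
      ∑ x ∈ Finset.HasAntidiagonal.antidiagonal D,
      (weightVectors (fun i : Fin n => l * ((i : ℕ) + 1)) x.1).card *
        coinvDim hζ (LinearMap.id - p) x.2 ≤
      ∑ x ∈ Finset.HasAntidiagonal.antidiagonal D,
      (weightVectors (fun i : Fin n => l * ((i : ℕ) + 1)) x.1).card * (stdVectors l n x.2).card := by
    rw [← Finset.sum_add_distrib]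
    refine Finset.sum_le_sum fun x _ => ?_
    rw [← mul_add]
    exact Nat.mul_le_mul_left _ (coinvDim_add_le hp x.2)
  omega

lemma coinvDim_eq_zero {hζ : IsPrimitiveRoot ζ l}
    {p : MvPolynomial (Fin n) ℂ →ₗ[ℂ] MvPolynomial (Fin n) ℂ} (hp : IsInvProj hζ p) {d : ℕ}
    (hd : n * (l * n) < d) : coinvDim hζ p d = 0 := by
  have h := coinvDim_add_le hp d
  rw [stdVectors_eq_empty hd, Finset.card_empty] at h
  omega

end Dimensions

/-! ## Multiplicities as dimensions of images of idempotents -/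

section Multiplicity

variable {G : Type} [Group G] [Fintype G]

/-- Evaluation of intertwining maps at the generator of a left ideal. -/
def evalGenerator (e : MonoidAlgebra ℂ G) {M : Type*} [AddCommGroup M] [Module ℂ M]
    (σ : Representation ℂ G M) :
    Representation.IntertwiningMap (leftIdealRep e) σ →ₗ[ℂ] M where
  toFun φ := φ ⟨e, Ideal.subset_span rfl⟩
  map_add' _ _ := rfl
  map_smul' _ _ := rfl

lemma intertwiningMap_apply_mul {e : MonoidAlgebra ℂ G} {M : Type*} [AddCommGroup M] [Module ℂ M]
    {σ : Representation ℂ G M} (φ : Representation.IntertwiningMap (leftIdealRep e) σ)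
    (a : MonoidAlgebra ℂ G) (x : Ideal.span {e}) :
    φ (a • x) = σ.asAlgebraHom a (φ x) := by
  induction a using MonoidAlgebra.induction_linear with
  | zero => simp
  | add a b ha hb => rw [add_smul, map_add, map_add, ha, hb, LinearMap.add_apply]
  | single g c =>
    rw [Representation.asAlgebraHom_single, LinearMap.smul_apply, ← φ.isIntertwining, ← map_smul]
    congr 1
    refine Subtype.ext ?_
    change MonoidAlgebra.single g c * (x : MonoidAlgebra ℂ G) =
      c • (MonoidAlgebra.single g 1 * (x : MonoidAlgebra ℂ G))
    rw [← smul_mul_assoc, MonoidAlgebra.smul_single, smul_eq_mul, mul_one]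

/-- Evaluation at `e` identifies the equivariant maps from the left ideal of `e` with the image of
`e`: the generator determines the map, and e e = κ e places its value in that image. -/
lemma finrank_intertwiningMap {e : MonoidAlgebra ℂ G} {κ : ℂ} (hκ : κ ≠ 0) (he : e * e = κ • e)
    {M : Type*} [AddCommGroup M] [Module ℂ M] (σ : Representation ℂ G M) :
    Module.finrank ℂ (Representation.IntertwiningMap (leftIdealRep e) σ) =
      Module.finrank ℂ (LinearMap.range (σ.asAlgebraHom e)) := by
  set x₀ : Ideal.span {e} := ⟨e, Ideal.subset_span rfl⟩
  have hinj : Function.Injective (evalGenerator e σ) := by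
    intro φ ψ h
    refine Representation.IntertwiningMap.ext (LinearMap.ext fun x => ?_)
    obtain ⟨a, ha⟩ := Ideal.mem_span_singleton'.1 x.2
    have hx : x = a • x₀ := Subtype.ext ha.symm
    change φ x = ψ x
    rw [hx, intertwiningMap_apply_mul, intertwiningMap_apply_mul]
    exact congrArg _ h
  rw [← LinearMap.finrank_range_of_inj hinj]
  suffices h : LinearMap.range (evalGenerator e σ) = LinearMap.range (σ.asAlgebraHom e) by rw [h]
  refine le_antisymm ?_ ?_
  · rintro _ ⟨φ, rfl⟩
    refine ⟨κ⁻¹ • φ x₀, ?_⟩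
    rw [map_smul, ← intertwiningMap_apply_mul]
    have h1 : e • x₀ = κ • x₀ := Subtype.ext he
    rw [h1, map_smul, smul_smul, inv_mul_cancel₀ hκ, one_smul]
    rfl
  · rintro _ ⟨m, rfl⟩
    -- The map x ↦ x m is equivariant and takes the generator to e m.
    let f : Ideal.span {e} →ₗ[ℂ] M :=
      { toFun := fun x => σ.asAlgebraHom (x : MonoidAlgebra ℂ G) m
        map_add' := fun x y => by simp
        map_smul' := fun c x => by
          change σ.asAlgebraHom (c • (x : MonoidAlgebra ℂ G)) m = _
          simp }
    have hf : ∀ g, ∀ x, f (leftIdealRep e g x) = σ g (f x) := fun g x => ?_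
    · exact ⟨LinearMap.intertwiningMap_of_isIntertwiningMap _ _ f hf, rfl⟩
    change σ.asAlgebraHom (MonoidAlgebra.single g 1 * (x : MonoidAlgebra ℂ G)) m = _
    rw [map_mul, Representation.asAlgebraHom_single_one]
    rfl

open MvPolynomial

variable {l n : ℕ} [NeZero l] {ζ : ℂ}

/-- The action of the group algebra on polynomials. -/
def polyAct (hζ : IsPrimitiveRoot ζ l) (x : MonoidAlgebra ℂ (Wreath l n)) :
    MvPolynomial (Fin n) ℂ →ₗ[ℂ] MvPolynomial (Fin n) ℂ :=
  (polyRep hζ).asAlgebraHom x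

lemma polyAct_eq_sum (hζ : IsPrimitiveRoot ζ l) (x : MonoidAlgebra ℂ (Wreath l n)) :
    polyAct hζ x = ∑ w, x.coeff w • polyRep hζ w := by
  conv_lhs => rw [polyAct, eq_sum_single x, map_sum]
  exact Finset.sum_congr rfl fun w _ => Representation.asAlgebraHom_single _ _ _

lemma polyAct_apply (hζ : IsPrimitiveRoot ζ l) (x : MonoidAlgebra ℂ (Wreath l n))
    (f : MvPolynomial (Fin n) ℂ) : polyAct hζ x f = ∑ w, x.coeff w • polyHom ζ w f := by
  rw [polyAct_eq_sum, LinearMap.sum_apply]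
  rfl

lemma isInvProj_polyAct (hζ : IsPrimitiveRoot ζ l) {x : MonoidAlgebra ℂ (Wreath l n)}
    (hx : x * x = x) : IsInvProj hζ (polyAct hζ x) where
  idem f := by
    rw [← Module.End.mul_apply, polyAct, ← map_mul, hx]
  fund k f := by
    rw [polyAct_apply, polyAct_apply, Finset.mul_sum]
    refine Finset.sum_congr rfl fun w _ => ?_
    rw [map_mul, polyHom_fundInv hζ, mul_smul_comm]
  homogeneous d f hf := by
    rw [polyAct_apply]
    exact Submodule.sum_mem _ fun w _ =>
      Submodule.smul_mem _ _ (polyRep_homogeneous hζ w d f hf)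
  ideal f hf := by
    rw [polyAct_apply]
    exact Submodule.sum_mem ((invIdeal hζ).restrictScalars ℂ) fun w _ =>
      Submodule.smul_mem _ _ (invIdeal_stable hζ w hf)

lemma coe_asAlgebraHom_coinvPiece (hζ : IsPrimitiveRoot ζ l) (d : ℕ)
    (x : MonoidAlgebra ℂ (Wreath l n)) {f : MvPolynomial (Fin n) ℂ}
    (v : (coinvPiece (n := n) hζ d).toSubmodule)
    (hv : (v : MvPolynomial (Fin n) ℂ ⧸ (invIdeal (n := n) hζ).restrictScalars ℂ) =
      ((invIdeal (n := n) hζ).restrictScalars ℂ).mkQ f) :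
    (((coinvPiece (n := n) hζ d).toRepresentation.asAlgebraHom x v :
      (coinvPiece (n := n) hζ d).toSubmodule) :
        MvPolynomial (Fin n) ℂ ⧸ (invIdeal (n := n) hζ).restrictScalars ℂ) =
      ((invIdeal (n := n) hζ).restrictScalars ℂ).mkQ (polyAct hζ x f) := by
  induction x using MonoidAlgebra.induction_linear with
  | zero => simp [polyAct]
  | add a b ha hb =>
    rw [map_add, LinearMap.add_apply, Submodule.coe_add, ha, hb, ← map_add]
    simp [polyAct]
  | single w c =>
    rw [Representation.asAlgebraHom_single, LinearMap.smul_apply, Submodule.coe_smul, polyAct,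
      Representation.asAlgebraHom_single, LinearMap.smul_apply, map_smul]
    congr 1
    change coinvRep hζ w (v : _) = _
    rw [hv]
    rfl

/-- The multiplicity of an irreducible module in the coinvariants. -/
lemma coinvMult_eq (hζ : IsPrimitiveRoot ζ l) (mu : MultiPartition l n) (d : ℕ) :
    coinvMult hζ mu d = coinvDim hζ (polyAct hζ (wreathIdem ζ mu)) d := by
  have h1 : coinvMult hζ mu d = Module.finrank ℂ (LinearMap.range
      ((coinvPiece (n := n) hζ d).toRepresentation.asAlgebraHom (wreathElt ζ mu))) :=
    finrank_intertwiningMap (wreathConst_ne_zero mu) (wreathElt_mul_self hζ mu) _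
  have h2 : wreathElt ζ mu = ((l : ℂ) ^ n * letterConst mu) • wreathIdem ζ mu := by
    rw [wreathIdem, smul_smul, mul_inv_cancel₀ (wreathConst_ne_zero mu), one_smul]
  have h3 : (LinearMap.range ((coinvPiece (n := n) hζ d).toRepresentation.asAlgebraHom
      (wreathIdem ζ mu))).map (coinvPiece (n := n) hζ d).toSubmodule.subtype =
      ((homogeneousSubmodule (Fin n) ℂ d).map (polyAct hζ (wreathIdem ζ mu))).map
        ((invIdeal (n := n) hζ).restrictScalars ℂ).mkQ := by
    refine le_antisymm ?_ ?_
    · rintro _ ⟨_, ⟨⟨_, f, hf, rfl⟩, rfl⟩, rfl⟩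
      exact ⟨_, ⟨f, hf, rfl⟩, (coe_asAlgebraHom_coinvPiece hζ d _ _ rfl).symm⟩
    · rintro _ ⟨_, ⟨f, hf, rfl⟩, rfl⟩
      exact ⟨_, ⟨⟨_, f, hf, rfl⟩, rfl⟩, coe_asAlgebraHom_coinvPiece hζ d _ _ rfl⟩
  rw [h1, h2, map_smul, LinearMap.range_smul _ _ (wreathConst_ne_zero mu), coinvDim, ← h3]
  exact LinearEquiv.finrank_eq (Submodule.equivMapOfInjective _
    (Submodule.subtype_injective (coinvPiece (n := n) hζ d).toSubmodule) _)

end Multiplicity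

/-! ## Fake degrees -/

section FakeDegree

variable {l n : ℕ} [NeZero l] {ζ : ℂ}

open scoped RatFunc in
/-- The embedding of `ℂ(t)` into the Laurent series. -/
def laurent : Kt →+* LaurentSeries ℂ := algebraMap (RatFunc ℂ) (LaurentSeries ℂ)

/-- The inclusion of the power series in the Laurent series. -/
def ofSeries : PowerSeries ℂ →+* LaurentSeries ℂ := HahnSeries.ofPowerSeries ℤ ℂ

lemma laurent_tt : laurent tt = ofSeries PowerSeries.X :=
  RatFunc.coe_X.trans PowerSeries.coe_X.symm

lemma laurent_C (a : ℂ) : laurent (RatFunc.C a) = ofSeries (PowerSeries.C a) := by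
  have h := RatFunc.coe_coe (Polynomial.C a)
  rw [Polynomial.coe_C] at h
  rw [← RatFunc.algebraMap_C]
  exact h.symm

lemma laurent_inv_one_sub (a : ℂ) {r : ℕ} (hr : 0 < r) :
    laurent (1 - RatFunc.C a * tt ^ r)⁻¹ = ofSeries (geomPow a r) := by
  rw [map_inv₀]
  refine inv_eq_of_mul_eq_one_right ?_
  rw [map_sub, map_one, map_mul, map_pow, laurent_tt, laurent_C, ← map_pow, ← map_mul,
    ← map_one ofSeries, ← map_sub, ← map_mul, one_sub_mul_geomPow a hr]

open Classical in
-- Molien's formula for an idempotent: the dimension of its image is its trace, a combination of the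
-- graded traces of the group elements.
lemma mk_imageDim_eq (hζ : IsPrimitiveRoot ζ l) {x : MonoidAlgebra ℂ (Wreath l n)}
    (hx : x * x = x) :
    PowerSeries.mk (fun d => (imageDim (polyAct hζ x) d : ℂ)) =
      ∑ w : Wreath l n, PowerSeries.C (x.coeff w) *
        ∏ c : Orb w.right, geomPow (ζ ^ (orbColour w c).val) (orbSize c) := by
  have hp := isInvProj_polyAct hζ hx
  ext d
  rw [PowerSeries.coeff_mk, imageDim, finrank_map_eq_gradedTrace (hp.homogeneous d) hp.idem,
    polyAct_eq_sum, map_sum, map_sum]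
  refine Finset.sum_congr rfl fun w _ => ?_
  rw [map_smul, gradedTrace_polyRep_eq_coeff, PowerSeries.coeff_C_mul, smul_eq_mul]

/-- The identity `imageDim_eq` is a product of series, with the Hilbert series of the invariants as
one factor; that factor is inverted. -/
lemma mk_coinvDim_eq (hζ : IsPrimitiveRoot ζ l) {x : MonoidAlgebra ℂ (Wreath l n)}
    (hx : x * x = x) :
    PowerSeries.mk (fun d => (coinvDim hζ (polyAct hζ x) d : ℂ)) =
      (∏ k ∈ Finset.range n, (1 - PowerSeries.X ^ (l * (k + 1)))) *
        PowerSeries.mk fun d => (imageDim (polyAct hζ x) d : ℂ) := by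
  have hpos : ∀ i : Fin n, 0 < l * ((i : ℕ) + 1) := fun i => Nat.mul_pos (NeZero.pos l) (by omega)
  have h1 : PowerSeries.mk (fun d => (imageDim (polyAct hζ x) d : ℂ)) =
      (∏ i : Fin n, geomPow (1 : ℂ) (l * ((i : ℕ) + 1))) *
        PowerSeries.mk fun d => (coinvDim hζ (polyAct hζ x) d : ℂ) := by
    ext D
    rw [PowerSeries.coeff_mk, imageDim_eq (isInvProj_polyAct hζ hx), PowerSeries.coeff_mul,
      Nat.cast_sum]
    refine Finset.sum_congr rfl fun y _ => ?_
    rw [coeff_prod_geomPow _ hpos, PowerSeries.coeff_mk, Nat.cast_mul]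
    simp
  rw [h1, ← mul_assoc, ← Fin.prod_univ_eq_prod_range (fun k => (1 : PowerSeries ℂ) -
    PowerSeries.X ^ (l * (k + 1))), ← Finset.prod_mul_distrib, Finset.prod_eq_one, one_mul]
  intro i _
  have h := one_sub_mul_geomPow (1 : ℂ) (hpos i)
  rwa [map_one, one_mul] at h

lemma support_coinvMult_subset (hζ : IsPrimitiveRoot ζ l) (mu : MultiPartition l n) :
    Function.support (coinvMult hζ mu) ⊆ (Finset.range (n * (l * n) + 1) : Set ℕ) := by
  intro d hd
  by_contra h
  refine hd ?_
  rw [coinvMult_eq, coinvDim_eq_zero (isInvProj_polyAct hζ (wreathIdem_mul_self hζ mu))]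
  simpa using h

lemma laurent_fakeDegree (hζ : IsPrimitiveRoot ζ l) (mu : MultiPartition l n) :
    laurent (fakeDegree hζ mu) = ofSeries (PowerSeries.mk fun d => (coinvMult hζ mu d : ℂ)) := by
  have h1 : fakeDegree hζ mu =
      ∑ d ∈ Finset.range (n * (l * n) + 1), (coinvMult hζ mu d : Kt) * tt ^ d := by
    refine finsum_eq_sum_of_support_subset _ fun d hd => support_coinvMult_subset hζ mu ?_
    intro h0
    refine hd ?_
    dsimp only
    rw [h0, Nat.cast_zero, zero_mul]
  have h2 : PowerSeries.mk (fun d => (coinvMult hζ mu d : ℂ)) =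
      ∑ d ∈ Finset.range (n * (l * n) + 1),
        (coinvMult hζ mu d : PowerSeries ℂ) * PowerSeries.X ^ d := by
    ext D
    rw [PowerSeries.coeff_mk, map_sum]
    have h3 : ∀ d, PowerSeries.coeff D ((coinvMult hζ mu d : PowerSeries ℂ) * PowerSeries.X ^ d) =
        if D = d then (coinvMult hζ mu d : ℂ) else 0 := fun d => by
      rw [← map_natCast (PowerSeries.C (R := ℂ)), PowerSeries.coeff_C_mul, PowerSeries.coeff_X_pow,
        mul_ite, mul_one, mul_zero]
    simp only [h3]
    rw [Finset.sum_ite_eq]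
    split_ifs with h
    · rfl
    · by_contra h0
      exact h (support_coinvMult_subset hζ mu fun h4 => h0 (by rw [h4, Nat.cast_zero]))
  rw [h1, h2, map_sum, map_sum]
  simp only [map_mul, map_pow, map_natCast, laurent_tt]

/-- The column of the trivial multipartition consists of the fake degrees. -/
theorem kostkaMacdonald_trivialMP_eq_fakeDegree (hζ : IsPrimitiveRoot ζ l)
    {K : MultiPartition l n → MultiPartition l n → Kt} (hK : IsKostkaMacdonald K)
    (mu : MultiPartition l n) : K mu (trivialMP l n) = fakeDegree hζ mu := by
  classical
  -- In Laurent series the rational factors of the cycles become geometric series and can be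
  -- compared with graded dimensions.
  refine laurent.injective ?_
  rw [kostkaMacdonald_trivialMP hζ hK, laurent_fakeDegree]
  simp only [coinvMult_eq]
  rw [mk_coinvDim_eq hζ (wreathIdem_mul_self hζ mu), mk_imageDim_eq hζ (wreathIdem_mul_self hζ mu)]
  simp only [map_mul, map_prod, map_sum, map_sub, map_one, map_pow, laurent_tt, laurent_C]
  congr 1
  refine Finset.sum_congr rfl fun w _ => ?_
  congr 1
  exact Finset.prod_congr rfl fun c _ => laurent_inv_one_sub _ (orbSize_pos c)

end FakeDegree

end WreathKM

end

theorem proposition3p3 (l n : ℕ) [NeZero l] (ζ : ℂ) (hζ : IsPrimitiveRoot ζ l) :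
    (∃! K : WreathKM.MultiPartition l n → WreathKM.MultiPartition l n → RatFunc ℂ,
      WreathKM.IsKostkaMacdonald K) ∧
    ∀ K : WreathKM.MultiPartition l n → WreathKM.MultiPartition l n → RatFunc ℂ,
      WreathKM.IsKostkaMacdonald K →
      (∀ (lam rho : WreathKM.MultiPartition l n) (w : WreathKM.Wreath l n),
        WreathKM.HasCycleType w rho →
        ∑ mu : WreathKM.MultiPartition l n,
            K mu lam * RatFunc.C (WreathKM.irrChar ζ mu w) =
          (∏ j : Fin l,
            (WreathKM.hookPoly (lam.2 j) ((RatFunc.X : RatFunc ℂ) ^ l) *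
              ((rho.2 j).parts.map fun r =>
                (1 - RatFunc.C (ζ ^ (j : ℕ)) * (RatFunc.X : RatFunc ℂ) ^ r)⁻¹).prod)) *
            RatFunc.C (WreathKM.irrChar ζ lam w)) ∧
      (∀ mu : WreathKM.MultiPartition l n,
        (Function.support (WreathKM.coinvMult hζ mu)).Finite ∧
        K mu (WreathKM.trivialMP l n) = WreathKM.fakeDegree hζ mu) := by
  exact ⟨WreathKM.existsUnique_isKostkaMacdonald, fun K hK =>
    ⟨fun lam rho w hw => WreathKM.sum_kostkaMacdonald_irrChar hζ hK lam rho w hw, fun mu =>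
      ⟨(Finset.finite_toSet _).subset (WreathKM.support_coinvMult_subset hζ mu),
        WreathKM.kostkaMacdonald_trivialMP_eq_fakeDegree hζ hK mu⟩⟩⟩
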